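/- Let $T>0$, $Q=(0,1)\times(0,T)$; let $\omega,\omega_1,\omega_2\subset(0,1)$ be nonempty open sets with $\omega_i\cap\omega=\emptyset$, let $O_d\subset(0,1)$ be measurable, $c\in L^\infty(Q)$, and $\alpha_i,\mu_i>0$ $(i=1,2)$. Let $x_0\in\omega$, and let $a\in C^1([0,1]\setminus\{x_0\})$ satisfy $a>0$ on $[0,1]\setminus\{x_0\}$, $a(x_0)=0$ and $(x-x_0)a'\le Ka$ on $[0,1]\setminus\{x_0\}$, where either $K\in(0,1)$ (weakly degenerate case), or $K\in[1,2)$ and $a\in W^{1,\infty}(0,1)$, i.e. $a$ is Lipschitz on $[0,1]$ (strongly degenerate case). Let $H^1_a(0,1)$ be the space of $z\in L^2(0,1)$ with $\sqrt a\,z_x\in L^2(0,1)$ and $z(0)=z(1)=0$ that are absolutely continuous on $[0,1]$ in the weakly degenerate case, and locally absolutely continuous on $[0,x_0)\cup(x_0,1]$ in the strongly degenerate case. Let $\sigma(t)=\exp\big(-\tfrac s2\min_{x\in[0,1]}\tau(t)\Psi(x)\big)$, where $s>0$, $\Psi(x)=c_1\big(\int_{x_0}^x\frac{y-x_0}{a(y)}dy-c_2\big)$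 with $c_1>0$ and $c_2>\max\big\{\frac{(1-x_0)^2}{a(1)(2-K)},\frac{x_0^2}{a(0)(2-K)}\big\}$, and $\tau(t)$ is either $[t(T-t)]^{-4}$ on all of $(0,T)$, or $2^8/T^8$ for $t\le T/2$ and $[t(T-t)]^{-4}$ for $t>T/2$. For $y_0\in L^2(0,1)$, $y_{1,d},y_{2,d}\in L^2(O_d\times(0,T))$ and $f\in L^2(\omega\times(0,T))$ consider the optimality system $$\begin{cases} y_t-(ay_x)_x+cy=f\chi_\omega-\sum_{i=1}^2\frac1{\mu_i}\sigma^{-2}q^i\chi_{\omega_i} &\text{in }Q,\\ -q^i_t-(aq^i_x)_x+cq^i=\alpha_i(y-y_{i,d})\chi_{O_d} &\text{in }Q,\\ y=q^i=0 &\text{at }x=0,1,\\ y(\cdot,0)=y_0,\quad q^i(\cdot,T)=0, \end{cases}$$ and for $\varphi_T\in L^2(0,1)$ the adjoint system $$\begin{cases} -\varphi_t-(a\varphi_x)_x+c\varphi=(\alpha_1\psi^1+\alpha_2\psi^2)\chi_{O_d} &\text{in }Q,\\ \psi^i_t-(a\psi^i_x)_x+c\psi^i=-\frac1{\mu_i}\sigma^{-2}\varphi\chi_{\omega_i}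 &\text{in }Q,\\ \varphi=\psi^i=0 &\text{at }x=0,1,\\ \varphi(\cdot,T)=\varphi_T,\quad \psi^i(\cdot,0)=0. \end{cases}$$ Solutions are weak solutions in $C([0,T];L^2(0,1))\cap L^2(0,T;H^1_a(0,1))$. **Proposition.** Suppose that there is a constant $C>0$ such that for every $\varphi_T\in L^2(0,1)$ the corresponding solution of the adjoint system satisfies $$\int_0^1|\varphi(x,0)|^2dx+\sum_{i=1}^2\int_Q|\psi^i|^2dxdt\le C\int_{\omega\times(0,T)}|\varphi|^2dxdt .$$ Then the optimality system is null controllable: for all $y_0\in L^2(0,1)$ and $y_{1,d},y_{2,d}\in L^2(O_d\times(0,T))$ there is $\bar f\in L^2(\omega\times(0,T))$ such that the optimality system with $f=\bar f$ has a solution, and its state satisfies $y(\cdot,T)=0$ in $(0,1)$. Moreover, for every $\varphi_T\in L^2(0,1)$ the adjoint system has a unique solution, and for given $y_0,y_{i,d}$ a control $\bar f$ is obtained as follows. Put $$F(\varphi_T)=\frac12\int_{\omega\times(0,T)}|\varphi|^2dxdt+\int_0^1y_0(x)\varphi(x,0)\,dx-\sum_{i=1}^2\int_{O_d\times(0,T)}\alpha_i\psi^iy_{i,d}\,dxdt,$$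 and let $\mathcal H$ be the closure in $L^2(\omega\times(0,T))$ of $\{\varphi\chi_\omega:\varphi_T\in L^2(0,1)\}$. Then $F(\varphi_T)=\Phi(\varphi\chi_\omega)$ for a continuous, strictly convex, coercive functional $\Phi$ on $\mathcal H$; $\bar f$ is the minimizer of $\Phi$ on $\mathcal H$; and whenever $F$ attains its minimum over $L^2(0,1)$ at some $\bar\varphi_T$, then $\bar f=\bar\varphi\chi_\omega$, where $\bar\varphi$ belongs to the solution of the adjoint system with final datum $\bar\varphi_T$. -/

import Mathlib

open MeasureTheory Set Filter Topology

noncomputable section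

namespace HierControl

/-- The Hilbert space `L²(0,1)`. -/
abbrev L2I : Type := Lp ℝ 2 (volume.restrict (Ioo (0 : ℝ) 1))

/-- The Hilbert space `L²(D × (0,T))`; points are written `(x, t)`. -/
abbrev L2Q (D : Set ℝ) (T : ℝ) : Type :=
  Lp ℝ 2 ((volume : Measure (ℝ × ℝ)).restrict (D ×ˢ Ioo 0 T))

/-- The two kinds of interior degeneracy. -/
inductive Degeneracy
  | weak
  | strong

/-- `a` is `C¹` on `[0,1] \ {x₀}`, positive there, vanishes at `x₀ ∈ (0,1)`, and satisfies
`(x - x₀) a' ≤ K a` there, with `K ∈ (0,1)` in the weakly degenerate case, and with `K ∈ [1,2)` and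
`a ∈ W^{1,∞}(0,1)` (that is, `a` Lipschitz) in the strongly degenerate case.
The derivative is one-sided at the end points `0` and `1`. -/
structure IsDegenerate (d : Degeneracy) (a : ℝ → ℝ) (x₀ K : ℝ) : Prop where
  point_mem : x₀ ∈ Ioo (0 : ℝ) 1
  contDiffOn : ContDiffOn ℝ 1 a (Icc 0 1 \ {x₀})
  pos : ∀ x ∈ Icc (0 : ℝ) 1 \ {x₀}, 0 < a x
  zero : a x₀ = 0
  slope : ∀ x ∈ Icc (0 : ℝ) 1 \ {x₀}, (x - x₀) * derivWithin a (Icc 0 1) x ≤ K * a x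
  exponent : match d with
    | .weak => 0 < K ∧ K < 1
    | .strong => 1 ≤ K ∧ K < 2 ∧ ∃ L, LipschitzOnWith L a (Icc 0 1)

/-- The regularity in the definition of `H¹_a(0,1)`: absolutely continuous on `[0,1]` in the weakly
degenerate case, locally absolutely continuous on `[0,x₀) ∪ (x₀,1]` in the strongly degenerate
case. -/
def ACRegular (d : Degeneracy) (x₀ : ℝ) (w : ℝ → ℝ) : Prop :=
  match d with
  | .weak => AbsolutelyContinuousOnInterval w 0 1
  | .strong => (∀ x ∈ Ico 0 x₀, AbsolutelyContinuousOnInterval w 0 x) ∧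
      ∀ x ∈ Ioc x₀ 1, AbsolutelyContinuousOnInterval w x 1

/-- `z ∈ H¹_a(0,1)` and `√a z_x = g` in `L²(0,1)`. Thus `z ∈ H¹_a(0,1)` if and only if such a `g`
exists, and then `g` is unique. -/
def HasSqrtFlux (d : Degeneracy) (a : ℝ → ℝ) (x₀ : ℝ) (z g : L2I) : Prop :=
  ∃ w : ℝ → ℝ, (∀ᵐ x ∂volume.restrict (Ioo (0 : ℝ) 1), z x = w x) ∧
    ACRegular d x₀ w ∧ w 0 = 0 ∧ w 1 = 0 ∧
    ∀ᵐ x ∂volume.restrict (Ioo (0 : ℝ) 1), g x = √(a x) * deriv w x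

/-- The spatial part `c₁ (∫_{x₀}^x (y - x₀) / a(y) dy - c₂)` of the exponential weights. -/
def weightPsi (a : ℝ → ℝ) (x₀ c₁ c₂ x : ℝ) : ℝ :=
  c₁ * ((∫ y in x₀..x, (y - x₀) / a y) - c₂)

/-- The time profile `1 / (t (T - t))⁴`, singular at both ends of `(0,T)`. -/
def theta (T t : ℝ) : ℝ := 1 / (t * (T - t)) ^ 4

/-- The time profile that equals `2⁸ / T⁸` up to `T / 2` and `1 / (t (T - t))⁴` afterwards. -/
def eta (T t : ℝ) : ℝ := if t ≤ T / 2 then 2 ^ 8 / T ^ 8 else 1 / (t ^ 4 * (T - t) ^ 4)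

/-- The weight `exp (- s m(t) / 2)` with `m(t)` the minimum over `x ∈ [0,1]` of
`profile t * weightPsi x`. -/
def weightSigma (a : ℝ → ℝ) (x₀ c₁ c₂ s : ℝ) (profile : ℝ → ℝ) (t : ℝ) : ℝ :=
  Real.exp (-s * sInf ((fun x => profile t * weightPsi a x₀ c₁ c₂ x) '' Icc 0 1) / 2)

/-- The data of the hierarchic control problem with one leader and two followers (indexed by
`Fin 2`), with their standing assumptions. -/
structure ControlData where
  /-- the final time -/
  T : ℝ
  T_pos : 0 < T
  /-- the kind of degeneracy -/
  deg : Degeneracy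
  /-- the diffusion coefficient -/
  a : ℝ → ℝ
  /-- the degeneracy point -/
  x₀ : ℝ
  /-- the degeneracy exponent -/
  K : ℝ
  degenerate : IsDegenerate deg a x₀ K
  /-- the leader control region -/
  ω : Set ℝ
  ω_open : IsOpen ω
  ω_sub : ω ⊆ Ioo 0 1
  x₀_mem : x₀ ∈ ω
  /-- the follower control regions -/
  ωf : Fin 2 → Set ℝ
  ωf_open : ∀ i, IsOpen (ωf i)
  ωf_nonempty : ∀ i, (ωf i).Nonempty
  ωf_sub : ∀ i, ωf i ⊆ Ioo 0 1
  ωf_disjoint : ∀ i, Disjoint (ωf i) ω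
  /-- the common observation region of the followers -/
  Od : Set ℝ
  Od_meas : MeasurableSet Od
  Od_sub : Od ⊆ Ioo 0 1
  /-- the potential, a function of `(x, t)` -/
  c : ℝ × ℝ → ℝ
  c_bdd : MemLp c ⊤ ((volume : Measure (ℝ × ℝ)).restrict (Ioo 0 1 ×ˢ Ioo 0 T))
  α : Fin 2 → ℝ
  α_pos : ∀ i, 0 < α i
  μ : Fin 2 → ℝ
  μ_pos : ∀ i, 0 < μ i
  /-- the constants of the weight function -/
  c₁ : ℝ
  c₁_pos : 0 < c₁
  c₂ : ℝ
  c₂_gt : max ((1 - x₀) ^ 2 / (a 1 * (2 - K))) (x₀ ^ 2 / (a 0 * (2 - K))) < c₂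
  s : ℝ
  s_pos : 0 < s
  /-- the time profile of the weight function; both usual choices are allowed -/
  profile : ℝ → ℝ
  profile_eq : profile = theta T ∨ profile = eta T

namespace ControlData

variable (P : ControlData)

/-- The weight `σ` in the cost functionals of the followers. -/
def σ (t : ℝ) : ℝ := weightSigma P.a P.x₀ P.c₁ P.c₂ P.s P.profile t

/-- `u` is the weak solution, in the class `C([0,T]; L²(0,1)) ∩ L²(0,T; H¹_a(0,1))`, of
`u_t - (a u_x)_x + c u = h` in `Q`, `u = 0` at `x = 0, 1`, `u(·,0) = u₀`; the equation is tested with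
`v ∈ H¹_a(0,1)` and integrated over `(0,t)`. Here `h x t` is the source and `G t = √a u_x(·,t)`. -/
def IsForwardSol (h : ℝ → ℝ → ℝ) (u₀ : L2I) (u : ℝ → L2I) : Prop :=
  ContinuousOn u (Icc 0 P.T) ∧ u 0 = u₀ ∧
  ∃ G : ℝ → L2I, MemLp G 2 (volume.restrict (Ioo 0 P.T)) ∧
    (∀ᵐ t ∂volume.restrict (Ioo 0 P.T), HasSqrtFlux P.deg P.a P.x₀ (u t) (G t)) ∧
    ∀ v Gv : L2I, HasSqrtFlux P.deg P.a P.x₀ v Gv → ∀ t ∈ Icc 0 P.T,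
      inner ℝ (u t) v
        + ∫ r in (0 : ℝ)..t, (inner ℝ (G r) Gv + ∫ x in Ioo (0 : ℝ) 1, P.c (x, r) * u r x * v x)
      = inner ℝ u₀ v + ∫ r in (0 : ℝ)..t, ∫ x in Ioo (0 : ℝ) 1, h x r * v x

/-- `u` is the weak solution, in the same class, of the backward problem
`-u_t - (a u_x)_x + c u = h` in `Q`, `u = 0` at `x = 0, 1`, `u(·,T) = u_T`. -/
def IsBackwardSol (h : ℝ → ℝ → ℝ) (uT : L2I) (u : ℝ → L2I) : Prop :=
  ContinuousOn u (Icc 0 P.T) ∧ u P.T = uT ∧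
  ∃ G : ℝ → L2I, MemLp G 2 (volume.restrict (Ioo 0 P.T)) ∧
    (∀ᵐ t ∂volume.restrict (Ioo 0 P.T), HasSqrtFlux P.deg P.a P.x₀ (u t) (G t)) ∧
    ∀ v Gv : L2I, HasSqrtFlux P.deg P.a P.x₀ v Gv → ∀ t ∈ Icc 0 P.T,
      inner ℝ (u t) v
        + ∫ r in t..P.T, (inner ℝ (G r) Gv + ∫ x in Ioo (0 : ℝ) 1, P.c (x, r) * u r x * v x)
      = inner ℝ uT v + ∫ r in t..P.T, ∫ x in Ioo (0 : ℝ) 1, h x r * v x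

/-- `(y, q¹, q²)` solves the optimality system with leader control `f`, initial state `y₀` and
targets `y_{i,d}`. -/
structure IsOptimalitySol (y₀ : L2I) (yd : Fin 2 → L2Q P.Od P.T) (f : L2Q P.ω P.T)
    (y : ℝ → L2I) (q : Fin 2 → ℝ → L2I) : Prop where
  state : P.IsForwardSol
    (fun x t => P.ω.indicator (fun x => f (x, t)) x
      - ∑ i, 1 / P.μ i * (P.σ t ^ 2)⁻¹ * (P.ωf i).indicator (fun x => q i t x) x) y₀ y
  costate : ∀ i, P.IsBackwardSol
    (fun x t => P.α i * P.Od.indicator (fun x => y t x - yd i (x, t)) x) 0 (q i)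

/-- `(φ, ψ¹, ψ²)` solves the adjoint system with final datum `φ_T`. -/
structure IsAdjointSol (φT : L2I) (φ : ℝ → L2I) (ψ : Fin 2 → ℝ → L2I) : Prop where
  backward : P.IsBackwardSol
    (fun x t => P.Od.indicator (fun x => ∑ i, P.α i * ψ i t x) x) φT φ
  forward : ∀ i, P.IsForwardSol
    (fun x t => -(1 / P.μ i) * (P.σ t ^ 2)⁻¹ * (P.ωf i).indicator (fun x => φ t x) x) 0 (ψ i)

/-- The observability inequality for the adjoint system. -/
def Observability : Prop :=
  ∃ C : ℝ, 0 < C ∧ ∀ (φT : L2I) (φ : ℝ → L2I) (ψ : Fin 2 → ℝ → L2I), P.IsAdjointSol φT φ ψ →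
    (∫ x in Ioo (0 : ℝ) 1, (φ 0 x) ^ 2)
        + ∑ i, ∫ t in (0 : ℝ)..P.T, ∫ x in Ioo (0 : ℝ) 1, (ψ i t x) ^ 2
      ≤ C * ∫ t in (0 : ℝ)..P.T, ∫ x in P.ω, (φ t x) ^ 2

/-- The leader control `f` drives the state `y` of the optimality system to rest at time `T`. -/
def SteersToZero (y₀ : L2I) (yd : Fin 2 → L2Q P.Od P.T) (f : L2Q P.ω P.T) : Prop :=
  (∃ y q, P.IsOptimalitySol y₀ yd f y q) ∧ ∀ y q, P.IsOptimalitySol y₀ yd f y q → y P.T = 0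

/-- Null controllability of the optimality system. -/
def NullControllable : Prop :=
  ∀ (y₀ : L2I) (yd : Fin 2 → L2Q P.Od P.T), ∃ f : L2Q P.ω P.T, P.SteersToZero y₀ yd f

/-- Existence and uniqueness (on `[0,T]`) for the adjoint system. -/
def AdjointWellPosed : Prop :=
  ∀ φT : L2I, ∃ (φ : ℝ → L2I) (ψ : Fin 2 → ℝ → L2I), P.IsAdjointSol φT φ ψ ∧
    ∀ (φ' : ℝ → L2I) (ψ' : Fin 2 → ℝ → L2I), P.IsAdjointSol φT φ' ψ' →
      EqOn φ' φ (Icc 0 P.T) ∧ ∀ i, EqOn (ψ' i) (ψ i) (Icc 0 P.T)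

/-- `g = φ χ_ω` as elements of `L²(ω × (0,T))`. -/
def IsRestriction (φ : ℝ → L2I) (g : L2Q P.ω P.T) : Prop :=
  ∀ᵐ t ∂volume.restrict (Ioo 0 P.T), ∀ᵐ x ∂volume.restrict P.ω, g (x, t) = φ t x

/-- The closure in `L²(ω × (0,T))` of the set of all `φ χ_ω`, where `φ` belongs to a solution of the
adjoint system with some final datum in `L²(0,1)`. -/
def obsSpace : Set (L2Q P.ω P.T) :=
  closure {g | ∃ φT φ ψ, P.IsAdjointSol φT φ ψ ∧ P.IsRestriction φ g}

/-- The value `F(φ_T)` of the dual functional, computed from the solution `(φ, ψ¹, ψ²)` of the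
adjoint system with final datum `φ_T`. -/
def dualF (y₀ : L2I) (yd : Fin 2 → L2Q P.Od P.T) (φ : ℝ → L2I) (ψ : Fin 2 → ℝ → L2I) : ℝ :=
  1 / 2 * (∫ t in (0 : ℝ)..P.T, ∫ x in P.ω, (φ t x) ^ 2)
    + (∫ x in Ioo (0 : ℝ) 1, y₀ x * φ 0 x)
    - ∑ i, ∫ t in (0 : ℝ)..P.T, ∫ x in P.Od, P.α i * ψ i t x * yd i (x, t)

end ControlData

end HierControl

end

/-!
# Null controllability from observability for a degenerate hierarchic control problem

The proof is the Hilbert uniqueness method. If `(φ, ψ)` solves the adjoint system with final datum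
`φ_T` and `(y, q)` solves the optimality system with control `f`, testing the two systems against
each other gives
`⟪y(T), φ_T⟫ = ⟪y₀, φ(0)⟫ + ⟪f, φ χ_ω⟫ - ∑ α_i ⟪y_{i,d}, ψ_i⟫` (`Coupling.inner_final_eq`). With
`f = 0` this identifies the linear part of the dual functional with `φ_T ↦ ⟪y⁰(T), φ_T⟫`, where `y⁰`
is the uncontrolled state. The observability inequality bounds it by a multiple of `‖φ χ_ω‖`, so
that it equals `⟪r, φ χ_ω⟫` for some `r` in the closure of the observations (`exists_inner_eq_of_le`).
Hence the dual functional is the quadratic functional `½ ‖g‖² + ⟪r, g⟫` at `g = φ χ_ω`, with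
minimizer `-r`, and under the control `f = -r` the identity says `⟪y(T), φ_T⟫ = 0` for all `φ_T`.

Most of the text provides the theory of the two systems. An `EnergySpace` abstracts the triple
`H¹_a ⊆ L²` with the gradient `√a ∂_x`. Weak solutions exist by Lions' projection method, with the
weight `exp (2 l t)` absorbing the potential (`testOp_coercive`), and they are continuous in time
because their regularisations by the resolvents `(1 + ε A)⁻¹` are uniformly Cauchy
(`exists_isWeakSol`). Integrating by parts in time for the regularised solutions and passing to the
limit gives the duality formula (`EnergySpace.duality`), and with it uniqueness and the fact that
the forward and backward solution operators are adjoint to each other. The systems of three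
equations then reduce to one equation with the operator `1 + χ S ρ S* χ`, which is coercive since
the feedback `ρ` is nonnegative (`Coupling.exists_solve`).

For the concrete problem, `H¹_a` is realised as the graph of `z ↦ √a z_x`. It is closed because
membership is expressed by bounded functionals of the flux (`IsDegenerate.hasSqrtFlux_iff`); in the
weakly degenerate case this uses that `1 / a` is integrable. Functions on `(0,1) × (0,T)` become
functions of time with values in `L²(0,1)` through `curryEquiv`.
-/

open MeasureTheory Set Filter Topology

noncomputable section

namespace HierControl

/-! ### Integration by parts for Bochner primitives -/

section Primitive

variable {E F G : Type*} [NormedAddCommGroup E] [NormedSpace ℝ E] [CompleteSpace E]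
  [NormedAddCommGroup F] [NormedSpace ℝ F] [CompleteSpace F]
  [NormedAddCommGroup G] [NormedSpace ℝ G] [CompleteSpace G]

/-- Fubini on the two triangles of a square. -/
theorem bilin_integral_integral (B : E →L[ℝ] F →L[ℝ] G) {f : ℝ → E} {g : ℝ → F} {a b : ℝ}
    (hab : a ≤ b) (hf : IntervalIntegrable f volume a b) (hg : IntervalIntegrable g volume a b) :
    (∫ s in a..b, B (f s) (∫ r in a..s, g r)) + ∫ s in a..b, B (∫ r in a..s, f r) (g s)
      = B (∫ s in a..b, f s) (∫ s in a..b, g s) := by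
  rw [intervalIntegrable_iff_integrableOn_Ioc_of_le hab] at hf hg
  set μ : Measure ℝ := volume.restrict (Ioc a b) with hμ
  have hf' : Integrable f μ := hf
  have hg' : Integrable g μ := hg
  have hh : Integrable (fun p : ℝ × ℝ => B (f p.1) (g p.2)) (μ.prod μ) :=
    hf'.op_fst_snd (op := fun x y => B x y) B.continuous₂ ⟨‖B‖, B.le_opNorm₂⟩ hg'
  let A : Set (ℝ × ℝ) := {p | p.2 ≤ p.1}
  have hA : MeasurableSet A := measurableSet_le measurable_snd measurable_fst
  have hsplit := integral_add_compl hA hh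
  rw [integral_prod _ hh] at hsplit
  have htot : ∫ x, ∫ y, B (f x) (g y) ∂μ ∂μ = B (∫ s, f s ∂μ) (∫ s, g s ∂μ) := by
    have h1 : ∀ x, ∫ y, B (f x) (g y) ∂μ = B (f x) (∫ y, g y ∂μ) := fun x =>
      (B (f x)).integral_comp_comm hg'
    simp_rw [h1]
    exact (B.flip (∫ y, g y ∂μ)).integral_comp_comm hf'
  have h1 : ∫ p in A, B (f p.1) (g p.2) ∂(μ.prod μ)
      = ∫ s in a..b, B (f s) (∫ r in a..s, g r) := by
    rw [← integral_indicator hA, integral_prod _ (hh.indicator hA),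
      intervalIntegral.integral_of_le hab]
    refine setIntegral_congr_fun measurableSet_Ioc fun s hs => ?_
    have : ∀ r, A.indicator (fun p : ℝ × ℝ => B (f p.1) (g p.2)) (s, r)
        = (Iic s).indicator (fun r => B (f s) (g r)) r := by
      intro r; simp [indicator, A]
    simp_rw [this]
    rw [integral_indicator measurableSet_Iic, intervalIntegral.integral_of_le hs.1.le,
      hμ, Measure.restrict_restrict measurableSet_Iic,
      show Iic s ∩ Ioc a b = Ioc a s by ext x; simp; grind]
    exact (B (f s)).integral_comp_comm (hg.mono_set (Ioc_subset_Ioc_right hs.2))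
  have h2 : ∫ p in Aᶜ, B (f p.1) (g p.2) ∂(μ.prod μ)
      = ∫ s in a..b, B (∫ r in a..s, f r) (g s) := by
    rw [← integral_indicator hA.compl, integral_prod_symm _ (hh.indicator hA.compl),
      intervalIntegral.integral_of_le hab]
    refine setIntegral_congr_fun measurableSet_Ioc fun s hs => ?_
    have : ∀ r, Aᶜ.indicator (fun p : ℝ × ℝ => B (f p.1) (g p.2)) (r, s)
        = (Iio s).indicator (fun r => B (f r) (g s)) r := by
      intro r; simp [indicator, A]
    simp_rw [this]
    rw [integral_indicator measurableSet_Iio, intervalIntegral.integral_of_le hs.1.le,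
      hμ, Measure.restrict_restrict measurableSet_Iio,
      show Iio s ∩ Ioc a b = Ioo a s by ext x; simp; grind, ← integral_Ioc_eq_integral_Ioo]
    exact (B.flip (g s)).integral_comp_comm (hf.mono_set (Ioc_subset_Ioc_right hs.2))
  rw [h1, h2, htot] at hsplit
  rw [hsplit, intervalIntegral.integral_of_le hab, intervalIntegral.integral_of_le hab]

/-- Integration by parts for a bounded bilinear map and primitives of integrable functions. -/
theorem bilin_primitive (B : E →L[ℝ] F →L[ℝ] G) {f : ℝ → E} {g : ℝ → F} {a b : ℝ}
    (hab : a ≤ b) (hf : IntervalIntegrable f volume a b) (hg : IntervalIntegrable g volume a b)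
    (u : E) (p : F) :
    ∫ s in a..b, (B (f s) (p + ∫ r in a..s, g r) + B (u + ∫ r in a..s, f r) (g s))
      = B (u + ∫ s in a..b, f s) (p + ∫ s in a..b, g s) - B u p := by
  have cf : ContinuousOn (fun s => ∫ r in a..s, f r) (uIcc a b) :=
    intervalIntegral.continuousOn_primitive_interval' hf left_mem_uIcc
  have cg : ContinuousOn (fun s => ∫ r in a..s, g r) (uIcc a b) :=
    intervalIntegral.continuousOn_primitive_interval' hg left_mem_uIcc
  have i1 : IntervalIntegrable (fun s => B (f s) (∫ r in a..s, g r)) volume a b := by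
    obtain ⟨C, hC⟩ := isCompact_uIcc.exists_bound_of_continuousOn cg
    rw [intervalIntegrable_iff] at hf ⊢
    refine B.integrable_of_bilin_of_bdd_right C hf
      ((cg.mono uIoc_subset_uIcc).aestronglyMeasurable measurableSet_uIoc) ?_
    filter_upwards [ae_restrict_mem measurableSet_uIoc] with s hs using hC s (uIoc_subset_uIcc hs)
  have i2 : IntervalIntegrable (fun s => B (∫ r in a..s, f r) (g s)) volume a b := by
    obtain ⟨C, hC⟩ := isCompact_uIcc.exists_bound_of_continuousOn cf
    rw [intervalIntegrable_iff] at hg ⊢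
    refine B.integrable_of_bilin_of_bdd_left C
      ((cf.mono uIoc_subset_uIcc).aestronglyMeasurable measurableSet_uIoc) ?_ hg
    filter_upwards [ae_restrict_mem measurableSet_uIoc] with s hs using hC s (uIoc_subset_uIcc hs)
  have i3 : IntervalIntegrable (fun s => B.flip p (f s)) volume a b :=
    ⟨(B.flip p).integrable_comp hf.1, (B.flip p).integrable_comp hf.2⟩
  have i4 : IntervalIntegrable (fun s => B u (g s)) volume a b :=
    ⟨(B u).integrable_comp hg.1, (B u).integrable_comp hg.2⟩
  have key := bilin_integral_integral B hab hf hg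
  have e : ∀ s, B (f s) (p + ∫ r in a..s, g r) + B (u + ∫ r in a..s, f r) (g s)
      = (B.flip p (f s) + B u (g s)) + (B (f s) (∫ r in a..s, g r)
        + B (∫ r in a..s, f r) (g s)) := by
    intro s; simp only [map_add, _root_.add_apply, ContinuousLinearMap.flip_apply]
    abel
  simp_rw [e]
  rw [intervalIntegral.integral_add (i3.add i4) (i1.add i2), intervalIntegral.integral_add i1 i2,
    key, intervalIntegral.integral_add i3 i4, (B.flip p).intervalIntegral_comp_comm hf,
    (B u).intervalIntegral_comp_comm hg]
  simp only [map_add, _root_.add_apply, ContinuousLinearMap.flip_apply]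
  abel

end Primitive

/-! ### Hilbert space tools and the resolvents of an energy space -/

section Hilbert

variable {H V : Type*} [NormedAddCommGroup H] [InnerProductSpace ℝ H] [CompleteSpace H]
  [NormedAddCommGroup V] [InnerProductSpace ℝ V] [CompleteSpace V]

/-- Lax–Milgram for an operator. -/
theorem exists_inverse_of_coercive (Q : H →L[ℝ] H) {c : ℝ} (hc : 0 < c)
    (h : ∀ v, c * ‖v‖ ^ 2 ≤ inner ℝ (Q v) v) : ∃ S : H →L[ℝ] H, ∀ x, Q (S x) = x := by
  let B : H →L[ℝ] H →L[ℝ] ℝ := (innerSL ℝ).comp Q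
  have hB : IsCoercive B := ⟨c, hc, fun u => by
    have := h u
    simp only [B, ContinuousLinearMap.comp_apply, innerSL_apply_apply]
    nlinarith⟩
  have hQ : ∀ v, hB.continuousLinearEquivOfBilin v = Q v := fun v =>
    (hB.unique_continuousLinearEquivOfBilin (v := v) (f := Q v) fun w => by
      simp [B, innerSL_apply_apply]).symm
  exact ⟨hB.continuousLinearEquivOfBilin.symm, fun x => by
    rw [← hQ]; simp⟩

/-- Lions' representation lemma: a functional bounded by `‖K ·‖` is represented through `K`, and the
representing vector can be chosen in the closure of the range of `K`. -/
theorem exists_inner_eq_of_le {W : Type*} [AddCommGroup W] [Module ℝ W] (K : W →ₗ[ℝ] H)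
    (L : W →ₗ[ℝ] ℝ) {C : ℝ} (h : ∀ φ, |L φ| ≤ C * ‖K φ‖) :
    ∃ u ∈ closure (range K), ∀ φ, inner ℝ u (K φ) = L φ := by
  obtain ⟨s, hs⟩ := K.rangeRestrict.exists_rightInverse_of_surjective
    (LinearMap.range_rangeRestrict K)
  have hs' : ∀ y, K (s y) = y := fun y => congrArg Subtype.val (LinearMap.congr_fun hs y)
  let ℓ : StrongDual ℝ (LinearMap.range K) := (L ∘ₗ s).mkContinuous C fun y => by
    have := h (s y)
    rw [hs'] at this
    exact this
  obtain ⟨g, hg, -⟩ := exists_extension_norm_eq (LinearMap.range K) ℓ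
  let u₀ := (InnerProductSpace.toDual ℝ H).symm g
  let M : Submodule ℝ H := (LinearMap.range K).topologicalClosure
  have hMc : IsClosed (M : Set H) := Submodule.isClosed_topologicalClosure _
  have : CompleteSpace M := hMc.completeSpace_coe
  refine ⟨M.starProjection u₀, ?_, fun φ => ?_⟩
  · have : M.starProjection u₀ ∈ M := Submodule.starProjection_apply_mem M u₀
    exact this
  · have hφ : K φ ∈ M := Submodule.le_topologicalClosure _ ⟨φ, rfl⟩
    have e1 : inner ℝ (M.starProjection u₀) (K φ) = inner ℝ u₀ (K φ) := by
      rw [Submodule.inner_starProjection_left_eq_right,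
        Submodule.starProjection_eq_self_iff.mpr hφ]
    rw [e1, InnerProductSpace.toDual_symm_apply]
    have e2 := hg ⟨K φ, φ, rfl⟩
    simp only at e2
    rw [e2]
    -- `L` vanishes on the kernel of `K`, by the bound.
    have e3 : L (φ - s ⟨K φ, φ, rfl⟩) = 0 := by
      have := h (φ - s ⟨K φ, φ, rfl⟩)
      have h0 : K (φ - s ⟨K φ, φ, rfl⟩) = 0 := by
        rw [map_sub K, sub_eq_zero]; exact (hs' ⟨K φ, φ, rfl⟩).symm
      rw [h0, norm_zero, mul_zero] at this
      exact abs_nonpos_iff.mp this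
    rw [map_sub, sub_eq_zero] at e3
    exact e3.symm

/-- Uniformly bounded operators that converge on a dense set converge strongly. -/
theorem tendsto_of_denseRange {W E F : Type*} [NormedAddCommGroup E] [NormedSpace ℝ E]
    [NormedAddCommGroup F] [NormedSpace ℝ F]
    {j : W → E} (hj : DenseRange j) {S : ℕ → E →L[ℝ] F} (S' : E →L[ℝ] F) {C : ℝ}
    (hS : ∀ n, ‖S n‖ ≤ C) (h : ∀ w, Tendsto (fun n => S n (j w)) atTop (𝓝 (S' (j w)))) (x : E) :
    Tendsto (fun n => S n x) atTop (𝓝 (S' x)) := by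
  have hC : 0 ≤ C := (norm_nonneg _).trans (hS 0)
  rw [Metric.tendsto_atTop]
  intro ε hε
  obtain ⟨w, hw⟩ := Metric.denseRange_iff.mp hj x (ε / (3 * (C + ‖S'‖ + 1)))
    (by positivity)
  obtain ⟨N, hN⟩ := Metric.tendsto_atTop.mp (h w) (ε / 3) (by positivity)
  refine ⟨N, fun n hn => ?_⟩
  rw [dist_eq_norm] at hw
  have h1 := hN n hn
  rw [dist_eq_norm] at h1 ⊢
  have hd : (C + ‖S'‖) * ‖x - j w‖ < ε / 3 := by
    have hp : 0 < C + ‖S'‖ + 1 := by positivity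
    calc (C + ‖S'‖) * ‖x - j w‖ ≤ (C + ‖S'‖ + 1) * ‖x - j w‖ :=
          mul_le_mul_of_nonneg_right (by linarith) (norm_nonneg _)
      _ < (C + ‖S'‖ + 1) * (ε / (3 * (C + ‖S'‖ + 1))) := by gcongr
      _ = ε / 3 := by field_simp
  have e : S n x - S' x = S n (x - j w) + (S n (j w) - S' (j w)) - S' (x - j w) := by
    simp only [map_sub]; abel
  have a1 : ‖S n (x - j w)‖ ≤ C * ‖x - j w‖ := (S n).le_of_opNorm_le (hS n) _
  have a2 : ‖S' (x - j w)‖ ≤ ‖S'‖ * ‖x - j w‖ := S'.le_opNorm _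
  rw [e]
  calc _ ≤ ‖S n (x - j w) + (S n (j w) - S' (j w))‖ + ‖S' (x - j w)‖ := norm_sub_le _ _
    _ ≤ ‖S n (x - j w)‖ + ‖S n (j w) - S' (j w)‖ + ‖S' (x - j w)‖ := by
      gcongr; exact norm_add_le _ _
    _ < ε := by nlinarith

end Hilbert

/-- An abstract energy space `V`: `ι` is its embedding into the pivot space `H`, and `D` is the
square root of the generator, so that `⟪D v, D w⟫` is the Dirichlet form. -/
structure EnergySpace (H V : Type*) [NormedAddCommGroup H] [InnerProductSpace ℝ H]
    [NormedAddCommGroup V] [InnerProductSpace ℝ V] where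
  /-- the embedding into the pivot space -/
  ι : V →L[ℝ] H
  /-- the gradient -/
  D : V →L[ℝ] H
  inner_eq : ∀ v w, inner ℝ v w = inner ℝ (ι v) (ι w) + inner ℝ (D v) (D w)
  inj : Function.Injective ι
  dense : DenseRange ι

namespace EnergySpace

variable {H V : Type*} [NormedAddCommGroup H] [InnerProductSpace ℝ H]
  [NormedAddCommGroup V] [InnerProductSpace ℝ V] (E : EnergySpace H V)

/-- The resolvent parameter `1 / (n + 1)`. -/
def eps (n : ℕ) : ℝ := 1 / (n + 1)

theorem eps_pos (n : ℕ) : 0 < eps n := by unfold eps; positivity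

theorem eps_le_one (n : ℕ) : eps n ≤ 1 := by
  unfold eps
  rw [div_le_one (by positivity)]
  linarith [n.cast_nonneg (α := ℝ)]

theorem tendsto_eps : Tendsto eps atTop (𝓝 0) := tendsto_one_div_add_atTop_nhds_zero_nat

theorem norm_sq_eq (v : V) : ‖v‖ ^ 2 = ‖E.ι v‖ ^ 2 + ‖E.D v‖ ^ 2 := by
  rw [← real_inner_self_eq_norm_sq, E.inner_eq, real_inner_self_eq_norm_sq,
    real_inner_self_eq_norm_sq]

variable [CompleteSpace H] [CompleteSpace V]

theorem exists_resolvent (n : ℕ) : ∃ J : H →L[ℝ] V, ∀ h v,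
    inner ℝ (E.ι (J h)) (E.ι v) + eps n * inner ℝ (E.D (J h)) (E.D v) = inner ℝ h (E.ι v) := by
  let Q : V →L[ℝ] V := E.ι.adjoint ∘L E.ι + eps n • (E.D.adjoint ∘L E.D)
  have hQ : ∀ v w, inner ℝ (Q v) w
      = inner ℝ (E.ι v) (E.ι w) + eps n * inner ℝ (E.D v) (E.D w) := by
    intro v w
    simp [Q, inner_add_left, real_inner_smul_left, ContinuousLinearMap.adjoint_inner_left]
  obtain ⟨S, hS⟩ := exists_inverse_of_coercive Q (eps_pos n) fun v => by
    rw [hQ, E.norm_sq_eq, real_inner_self_eq_norm_sq, real_inner_self_eq_norm_sq]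
    nlinarith [eps_le_one n, sq_nonneg ‖E.ι v‖]
  refine ⟨S ∘L E.ι.adjoint, fun h v => ?_⟩
  rw [← hQ, ContinuousLinearMap.comp_apply, hS, ContinuousLinearMap.adjoint_inner_left]

/-- The resolvent `(1 + ε A)⁻¹` of the generator, as an operator into the energy space. -/
def J (n : ℕ) : H →L[ℝ] V := (E.exists_resolvent n).choose

theorem J_spec (n : ℕ) (h : H) (v : V) :
    inner ℝ (E.ι (E.J n h)) (E.ι v) + eps n * inner ℝ (E.D (E.J n h)) (E.D v)
      = inner ℝ h (E.ι v) := (E.exists_resolvent n).choose_spec h v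

/-- The resolvent as an operator of the pivot space. -/
def R (n : ℕ) : H →L[ℝ] H := E.ι ∘L E.J n

/-- The resolvent as an operator of the energy space. -/
def S (n : ℕ) : V →L[ℝ] V := E.J n ∘L E.ι

theorem ι_J (n : ℕ) (h : H) : E.ι (E.J n h) = E.R n h := rfl
theorem J_ι (n : ℕ) (v : V) : E.J n (E.ι v) = E.S n v := rfl
theorem ι_S (n : ℕ) (v : V) : E.ι (E.S n v) = E.R n (E.ι v) := rfl

theorem R_symm (n : ℕ) (h k : H) : inner ℝ (E.R n h) k = inner ℝ h (E.R n k) := by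
  have h1 := E.J_spec n h (E.J n k)
  have h2 := E.J_spec n k (E.J n h)
  rw [ι_J, ι_J] at h1 h2
  rw [← h1, real_inner_comm, ← h2, real_inner_comm (E.R n h), real_inner_comm (E.D (E.J n h))]

theorem D_S_symm (n : ℕ) (v w : V) :
    inner ℝ (E.D (E.S n v)) (E.D w) = inner ℝ (E.D v) (E.D (E.S n w)) := by
  have h1 := E.J_spec n (E.ι v) w
  have h2 := E.J_spec n (E.ι w) v
  rw [ι_J, J_ι] at h1 h2
  have h3 := E.R_symm n (E.ι v) (E.ι w)
  have h4 : eps n * inner ℝ (E.D (E.S n v)) (E.D w) = eps n * inner ℝ (E.D v) (E.D (E.S n w)) := by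
    rw [real_inner_comm (E.ι v), real_inner_comm (E.D v), real_inner_comm (E.ι v) (E.ι w)] at h2
    linarith
  exact mul_left_cancel₀ (eps_pos n).ne' h4

theorem norm_R_apply_le (n : ℕ) (h : H) : ‖E.R n h‖ ≤ ‖h‖ := by
  have h1 := E.J_spec n h (E.J n h)
  rw [ι_J, real_inner_self_eq_norm_sq, real_inner_self_eq_norm_sq] at h1
  have h2 := real_inner_le_norm h (E.R n h)
  have h3 : 0 ≤ eps n * ‖E.D (E.J n h)‖ ^ 2 := by have := eps_pos n; positivity
  by_contra hc
  push Not at hc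
  nlinarith [norm_nonneg h]

/-- The equation `S v - v = -ε A S v`, tested with `S v - v`. -/
theorem S_sub_estimate (n : ℕ) (v : V) :
    ‖E.ι (E.S n v - v)‖ ^ 2 + eps n * inner ℝ (E.D (E.S n v)) (E.D (E.S n v - v)) = 0 := by
  have h1 := E.J_spec n (E.ι v) (E.S n v - v)
  rw [J_ι] at h1
  rw [← real_inner_self_eq_norm_sq]
  nth_rw 1 [map_sub]
  rw [inner_sub_left]
  linarith

theorem norm_D_S_le (n : ℕ) (v : V) : ‖E.D (E.S n v)‖ ≤ ‖E.D v‖ := by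
  have h1 := E.S_sub_estimate n v
  rw [map_sub E.D, inner_sub_right, real_inner_self_eq_norm_sq] at h1
  have h2 := real_inner_le_norm (E.D (E.S n v)) (E.D v)
  have h3 : ‖E.D (E.S n v)‖ ^ 2 - inner ℝ (E.D (E.S n v)) (E.D v) ≤ 0 := by
    by_contra hc
    push Not at hc
    nlinarith [sq_nonneg ‖E.ι (E.S n v - v)‖, mul_pos (eps_pos n) hc]
  by_contra hc
  push Not at hc
  nlinarith [norm_nonneg (E.D v)]

theorem norm_R_le (n : ℕ) : ‖E.R n‖ ≤ 1 :=
  ContinuousLinearMap.opNorm_le_bound _ zero_le_one fun h => by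
    rw [one_mul]; exact E.norm_R_apply_le n h

theorem norm_S_le (n : ℕ) : ‖E.S n‖ ≤ 1 :=
  ContinuousLinearMap.opNorm_le_bound _ zero_le_one fun v => by
    rw [one_mul, ← sq_le_sq₀ (norm_nonneg _) (norm_nonneg _), E.norm_sq_eq, E.norm_sq_eq]
    have h1 := E.norm_D_S_le n v
    have h2 := E.norm_R_apply_le n (E.ι v)
    rw [← ι_S] at h2
    gcongr

/-- Resolvents converge strongly in the pivot space. -/
theorem tendsto_R (h : H) : Tendsto (fun n => E.R n h) atTop (𝓝 h) := by
  refine tendsto_of_denseRange E.dense (ContinuousLinearMap.id ℝ H) E.norm_R_le (fun v => ?_) h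
  rw [ContinuousLinearMap.id_apply, tendsto_iff_norm_sub_tendsto_zero]
  have hb : ∀ n, ‖E.R n (E.ι v) - E.ι v‖ ^ 2 ≤ eps n * (2 * ‖E.D v‖ ^ 2) := by
    intro n
    have h1 := E.S_sub_estimate n v
    rw [map_sub E.ι, ι_S] at h1
    have h2 : |inner ℝ (E.D (E.S n v)) (E.D (E.S n v - v))| ≤ 2 * ‖E.D v‖ ^ 2 := by
      refine (abs_real_inner_le_norm _ _).trans ?_
      have a := E.norm_D_S_le n v
      have b : ‖E.D (E.S n v - v)‖ ≤ 2 * ‖E.D v‖ := by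
        rw [map_sub]; exact (norm_sub_le _ _).trans (by linarith)
      calc _ ≤ ‖E.D v‖ * (2 * ‖E.D v‖) := by gcongr
        _ = _ := by ring
    have h3 := neg_abs_le (inner ℝ (E.D (E.S n v)) (E.D (E.S n v - v)))
    nlinarith [eps_pos n]
  have h0 : Tendsto (fun n => eps n * (2 * ‖E.D v‖ ^ 2)) atTop (𝓝 0) := by
    simpa using tendsto_eps.mul_const (2 * ‖E.D v‖ ^ 2)
  have h1 := squeeze_zero (fun n => sq_nonneg _) hb h0
  have h2 := h1.sqrt
  simpa [Real.sqrt_sq] using h2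

/-- Resolvents converge strongly in the energy space. -/
theorem tendsto_S (v : V) : Tendsto (fun n => E.S n v) atTop (𝓝 v) := by
  -- The vectors `ι* h` lie in the domain of the generator, with `A (ι* h) = h - ι (ι* h)`; they are
  -- dense in the energy space because `ι` is injective.
  have hd : DenseRange E.ι.adjoint := by
    change Dense ((LinearMap.range (E.ι.adjoint : H →ₗ[ℝ] V) : Submodule ℝ V) : Set V)
    rw [Submodule.dense_iff_topologicalClosure_eq_top]
    rw [Submodule.topologicalClosure_eq_top_iff]
    rw [E.ι.adjoint.orthogonal_range, ContinuousLinearMap.adjoint_adjoint]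
    exact LinearMap.ker_eq_bot.mpr E.inj
  refine tendsto_of_denseRange hd (ContinuousLinearMap.id ℝ V) E.norm_S_le (fun h => ?_) v
  set z := E.ι.adjoint h with hz
  set k := h - E.ι z with hk
  rw [ContinuousLinearMap.id_apply, tendsto_iff_norm_sub_tendsto_zero]
  have hform : ∀ w, inner ℝ (E.D z) (E.D w) = inner ℝ k (E.ι w) := by
    intro w
    have h1 := E.inner_eq z w
    rw [hz, ContinuousLinearMap.adjoint_inner_left, ← hz] at h1
    rw [hk, inner_sub_left]
    linarith
  have hb : ∀ n, ‖E.S n z - z‖ ^ 2 ≤ eps n * (2 * ‖k‖ ^ 2) := by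
    intro n
    set y := E.S n z - z with hy
    have h1 := E.S_sub_estimate n z
    rw [← hy, show E.S n z = y + z by rw [hy]; abel, map_add, inner_add_left,
      real_inner_self_eq_norm_sq, hform] at h1
    have h2 : |inner ℝ k (E.ι y)| ≤ ‖k‖ * ‖E.ι y‖ := abs_real_inner_le_norm _ _
    have h3 := neg_abs_le (inner ℝ k (E.ι y))
    have he := eps_pos n
    have he1 := eps_le_one n
    have h4 : ‖E.ι y‖ ^ 2 + eps n * ‖E.D y‖ ^ 2 ≤ eps n * (‖k‖ * ‖E.ι y‖) := by
      nlinarith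
    have h5 : ‖E.ι y‖ ≤ eps n * ‖k‖ := by
      by_contra hc
      push Not at hc
      have : 0 < ‖E.ι y‖ := lt_of_le_of_lt (by positivity) hc
      nlinarith [mul_nonneg he.le (sq_nonneg ‖E.D y‖)]
    have h6 : ‖E.D y‖ ^ 2 ≤ ‖k‖ * ‖E.ι y‖ := by
      have : eps n * ‖E.D y‖ ^ 2 ≤ eps n * (‖k‖ * ‖E.ι y‖) := by
        nlinarith [sq_nonneg ‖E.ι y‖]
      exact le_of_mul_le_mul_left this he
    have h7 : ‖k‖ * ‖E.ι y‖ ≤ eps n * ‖k‖ ^ 2 := by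
      calc ‖k‖ * ‖E.ι y‖ ≤ ‖k‖ * (eps n * ‖k‖) := by gcongr
        _ = _ := by ring
    have h8 : ‖E.ι y‖ ^ 2 ≤ eps n * ‖k‖ ^ 2 := by
      calc ‖E.ι y‖ ^ 2 ≤ (eps n * ‖k‖) ^ 2 := by gcongr
        _ = eps n * (eps n * ‖k‖ ^ 2) := by ring
        _ ≤ 1 * (eps n * ‖k‖ ^ 2) := by gcongr
        _ = _ := one_mul _
    rw [E.norm_sq_eq]
    linarith
  have h0 : Tendsto (fun n => eps n * (2 * ‖k‖ ^ 2)) atTop (𝓝 0) := by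
    simpa using tendsto_eps.mul_const (2 * ‖k‖ ^ 2)
  have h1 := squeeze_zero (fun n => sq_nonneg _) hb h0
  have h2 := h1.sqrt
  simpa [Real.sqrt_sq] using h2

end EnergySpace

/-! ### Bochner spaces and weak solutions -/

/-- The Hilbert space `L²(0,T; H)`. -/
abbrev XT (H : Type*) [NormedAddCommGroup H] (T : ℝ) : Type _ :=
  Lp H 2 ((volume : Measure ℝ).restrict (Ioo 0 T))

section Bochner

variable {α : Type*} [MeasurableSpace α] {μ : Measure α}

theorem norm_sq_eq_integral {H : Type*} [NormedAddCommGroup H] [InnerProductSpace ℝ H]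
    (x : Lp H 2 μ) : ‖x‖ ^ 2 = ∫ t, ‖x t‖ ^ 2 ∂μ := by
  rw [← real_inner_self_eq_norm_sq, L2.inner_def]
  simp_rw [real_inner_self_eq_norm_sq]

theorem integrable_norm_sq {H : Type*} [NormedAddCommGroup H]
    (x : Lp H 2 μ) : Integrable (fun t => ‖x t‖ ^ 2) μ :=
  (Lp.memLp x).norm.integrable_sq

theorem integrable_norm_mul_norm {H K : Type*} [NormedAddCommGroup H] [NormedAddCommGroup K]
    (x : Lp H 2 μ) (y : Lp K 2 μ) : Integrable (fun t => ‖x t‖ * ‖y t‖) μ :=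
  (Lp.memLp x).norm.integrable_mul (Lp.memLp y).norm

theorem integral_norm_mul_norm_le {H K : Type*} [NormedAddCommGroup H] [NormedAddCommGroup K]
    (x : Lp H 2 μ) (y : Lp K 2 μ) : ∫ t, ‖x t‖ * ‖y t‖ ∂μ ≤ ‖x‖ * ‖y‖ := by
  have hx := (Lp.memLp x).norm
  have hy := (Lp.memLp y).norm
  have e1 : ‖hx.toLp‖ = ‖x‖ := by
    rw [Lp.norm_toLp, Lp.norm_def, eLpNorm_norm]
  have e2 : ‖hy.toLp‖ = ‖y‖ := by
    rw [Lp.norm_toLp, Lp.norm_def, eLpNorm_norm]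
  have h := real_inner_le_norm hx.toLp hy.toLp
  rw [e1, e2, L2.inner_def] at h
  refine le_trans (le_of_eq (integral_congr_ae ?_)) h
  filter_upwards [hx.coeFn_toLp, hy.coeFn_toLp] with t h1 h2
  rw [h1, h2]
  simp [mul_comm]

/-- Strong convergence of uniformly bounded operators passes to Bochner spaces. -/
theorem tendsto_compLpL {H : Type*} [NormedAddCommGroup H] [InnerProductSpace ℝ H]
    {S : ℕ → H →L[ℝ] H} (hS : ∀ n, ‖S n‖ ≤ 1) (h : ∀ v, Tendsto (fun n => S n v) atTop (𝓝 v))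
    (x : Lp H 2 μ) : Tendsto (fun n => (S n).compLpL 2 μ x) atTop (𝓝 x) := by
  rw [tendsto_iff_norm_sub_tendsto_zero]
  have key : Tendsto (fun n => ∫ t, ‖S n (x t) - x t‖ ^ 2 ∂μ) atTop (𝓝 (∫ _, (0 : ℝ) ∂μ)) := by
    refine tendsto_integral_of_dominated_convergence (fun t => 4 * ‖x t‖ ^ 2) (fun n => ?_)
      ((integrable_norm_sq x).const_mul 4) (fun n => ?_) ?_
    · exact ((((S n).continuous.comp_aestronglyMeasurable (Lp.aestronglyMeasurable x)).sub
        (Lp.aestronglyMeasurable x)).norm).pow 2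
    · refine Eventually.of_forall fun t => ?_
      have h1 : ‖S n (x t) - x t‖ ≤ 2 * ‖x t‖ := by
        have := (S n).le_of_opNorm_le (hS n) (x t)
        exact (norm_sub_le _ _).trans (by linarith)
      rw [Real.norm_of_nonneg (sq_nonneg _)]
      calc ‖S n (x t) - x t‖ ^ 2 ≤ (2 * ‖x t‖) ^ 2 := by gcongr
        _ = _ := by ring
    · refine Eventually.of_forall fun t => ?_
      have := (tendsto_iff_norm_sub_tendsto_zero.mp (h (x t))).pow 2
      simpa using this
  have e : ∀ n, ‖(S n).compLpL 2 μ x - x‖ ^ 2 = ∫ t, ‖S n (x t) - x t‖ ^ 2 ∂μ := by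
    intro n
    rw [norm_sq_eq_integral]
    refine integral_congr_ae ?_
    filter_upwards [Lp.coeFn_sub ((S n).compLpL 2 μ x) x, (S n).coeFn_compLpL x] with t h1 h2
    rw [h1, Pi.sub_apply, h2]
  simp_rw [← e] at key
  have := key.sqrt
  simpa [Real.sqrt_sq] using this

end Bochner

/-- Integration by parts for the inner product of two primitives. -/
theorem inner_primitive {H : Type*} [NormedAddCommGroup H] [InnerProductSpace ℝ H]
    [CompleteSpace H] {f g : ℝ → H} {a b : ℝ} (hab : a ≤ b)
    (hf : IntervalIntegrable f volume a b) (hg : IntervalIntegrable g volume a b) (u p : H) :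
    ∫ s in a..b, (inner ℝ (f s) (p + ∫ r in a..s, g r) + inner ℝ (u + ∫ r in a..s, f r) (g s))
      = inner ℝ (u + ∫ s in a..b, f s) (p + ∫ s in a..b, g s) - inner ℝ u p :=
  bilin_primitive (innerSL ℝ) hab hf hg u p

namespace XT

variable {H : Type*} [NormedAddCommGroup H] {T : ℝ}

theorem ae_of_ae_Ioo {p : ℝ → Prop} (h : ∀ᵐ t ∂volume.restrict (Ioo (0 : ℝ) T), p t) {a b : ℝ}
    (ha : a ∈ Icc 0 T) (hb : b ∈ Icc 0 T) : ∀ᵐ t ∂volume.restrict (uIoc a b), p t := by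
  rw [restrict_Ioo_eq_restrict_Ioc] at h
  refine ae_mono (Measure.restrict_mono ?_ le_rfl) h
  intro x hx
  rw [mem_uIoc] at hx
  rcases hx with hx | hx
  · exact ⟨ha.1.trans_lt hx.1, hx.2.trans hb.2⟩
  · exact ⟨hb.1.trans_lt hx.1, hx.2.trans ha.2⟩

theorem intervalIntegrable_of_integrable {f : ℝ → H}
    (hf : Integrable f (volume.restrict (Ioo 0 T))) {a b : ℝ}
    (ha : a ∈ Icc 0 T) (hb : b ∈ Icc 0 T) : IntervalIntegrable f volume a b := by
  rw [intervalIntegrable_iff]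
  have h1 : IntegrableOn f (Ioc 0 T) := by
    rw [integrableOn_Ioc_iff_integrableOn_Ioo]; exact hf
  refine h1.mono_set ?_
  intro x hx
  rw [mem_uIoc] at hx
  rcases hx with hx | hx
  · exact ⟨ha.1.trans_lt hx.1, hx.2.trans hb.2⟩
  · exact ⟨hb.1.trans_lt hx.1, hx.2.trans ha.2⟩

theorem integrable (x : XT H T) : Integrable x (volume.restrict (Ioo 0 T)) :=
  (Lp.memLp x).integrable one_le_two

theorem intervalIntegrable (x : XT H T) {a b : ℝ} (ha : a ∈ Icc 0 T) (hb : b ∈ Icc 0 T) :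
    IntervalIntegrable x volume a b :=
  intervalIntegrable_of_integrable x.integrable ha hb

theorem interval_congr [NormedSpace ℝ H] {f g : ℝ → H}
    (h : ∀ᵐ t ∂volume.restrict (Ioo (0 : ℝ) T), f t = g t) {a b : ℝ}
    (ha : a ∈ Icc 0 T) (hb : b ∈ Icc 0 T) : ∫ t in a..b, f t = ∫ t in a..b, g t :=
  intervalIntegral.integral_congr_ae_restrict (ae_of_ae_Ioo h ha hb)

theorem integral_Ioo [NormedSpace ℝ H] (hT : 0 ≤ T) (f : ℝ → H) :
    ∫ t, f t ∂volume.restrict (Ioo 0 T) = ∫ t in (0 : ℝ)..T, f t := by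
  rw [intervalIntegral.integral_of_le hT, integral_Ioc_eq_integral_Ioo]

theorem memLp_of_continuousOn {f : ℝ → H} (h : ContinuousOn f (Icc 0 T)) :
    MemLp f 2 (volume.restrict (Ioo 0 T)) := by
  obtain ⟨C, hC⟩ := isCompact_Icc.exists_bound_of_continuousOn h
  refine MemLp.of_bound ?_ C ?_
  · exact (h.mono Ioo_subset_Icc_self).aestronglyMeasurable measurableSet_Ioo
  · filter_upwards [ae_restrict_mem measurableSet_Ioo] with t ht
    exact hC t (Ioo_subset_Icc_self ht)

theorem continuousOn_primitive [NormedSpace ℝ H] (x : XT H T) (hT : 0 ≤ T) :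
    ContinuousOn (fun t => ∫ r in (0 : ℝ)..t, x r) (Icc 0 T) := by
  have h := intervalIntegral.continuousOn_primitive_interval'
    (x.intervalIntegrable (left_mem_Icc.mpr hT) (right_mem_Icc.mpr hT)) left_mem_uIcc
  rwa [uIcc_of_le hT] at h

/-- The reflection `t ↦ T - t` preserves Lebesgue measure on `(0,T)`. -/
theorem measurePreserving_reflect (T : ℝ) : MeasurePreserving (fun t : ℝ => T - t)
    (volume.restrict (Ioo 0 T)) (volume.restrict (Ioo 0 T)) := by
  have h := (Measure.measurePreserving_sub_left (volume : Measure ℝ) T).restrict_preimage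
    (measurableSet_Ioo (a := (0 : ℝ)) (b := T))
  have e : (fun t : ℝ => T - t) ⁻¹' Ioo 0 T = Ioo 0 T := by
    ext t; simp only [mem_preimage, mem_Ioo]; constructor <;> intro h <;> constructor <;> linarith
  rwa [e] at h

theorem ae_reflect {p : ℝ → Prop} (h : ∀ᵐ t ∂volume.restrict (Ioo (0 : ℝ) T), p t) :
    ∀ᵐ t ∂volume.restrict (Ioo (0 : ℝ) T), p (T - t) :=
  (measurePreserving_reflect T).quasiMeasurePreserving.ae h

variable [InnerProductSpace ℝ H]

/-- Time reversal on `L²(0,T; H)`. -/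
def rev : XT H T →L[ℝ] XT H T :=
  (Lp.compMeasurePreservingₗᵢ ℝ (fun t : ℝ => T - t)
    (measurePreserving_reflect T)).toContinuousLinearMap

theorem rev_ae (x : XT H T) : ∀ᵐ t ∂volume.restrict (Ioo (0 : ℝ) T), rev x t = x (T - t) :=
  Lp.coeFn_compMeasurePreserving x (measurePreserving_reflect T)

theorem rev_rev (x : XT H T) : rev (rev x) = x := by
  refine Lp.ext ?_
  filter_upwards [rev_ae (rev x), ae_reflect (rev_ae x)] with t h1 h2
  rw [h1, h2, sub_sub_cancel]

theorem inner_rev (x y : XT H T) : inner ℝ (rev x) (rev y) = inner ℝ x y :=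
  (Lp.compMeasurePreservingₗᵢ ℝ (fun t : ℝ => T - t) (measurePreserving_reflect T)).inner_map_map
    x y

theorem inner_rev_left (x y : XT H T) : inner ℝ (rev x) y = inner ℝ x (rev y) := by
  rw [← inner_rev, rev_rev]

theorem inner_eq (hT : 0 ≤ T) (x y : XT H T) :
    inner ℝ x y = ∫ t in (0 : ℝ)..T, inner ℝ (x t) (y t) := by
  rw [L2.inner_def, integral_Ioo hT]

end XT

namespace EnergySpace

variable {H V : Type*} [NormedAddCommGroup H] [InnerProductSpace ℝ H]
  [NormedAddCommGroup V] [InnerProductSpace ℝ V] (E : EnergySpace H V) {T : ℝ}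

/-- `u` is the weak solution of `u' + D*D u = f`, `u(0) = u₀`, where `z` is `u` regarded as a
function with values in the energy space. -/
structure IsWeakSol (T : ℝ) (f : XT H T) (u₀ : H) (u : ℝ → H) (z : XT V T) : Prop where
  cont : ContinuousOn u (Icc 0 T)
  init : u 0 = u₀
  mem : ∀ᵐ t ∂volume.restrict (Ioo (0 : ℝ) T), u t = E.ι (z t)
  weak : ∀ v, ∀ t ∈ Icc 0 T, inner ℝ (u t) (E.ι v)
    = inner ℝ u₀ (E.ι v) + ∫ r in (0 : ℝ)..t, (inner ℝ (f r) (E.ι v) - inner ℝ (E.D (z r)) (E.D v))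

/-- The embedding of `L²(0,T; V)` into `L²(0,T; H)`. -/
def ιX (T : ℝ) : XT V T →L[ℝ] XT H T := E.ι.compLpL 2 _

/-- The gradient on `L²(0,T; V)`. -/
def DX (T : ℝ) : XT V T →L[ℝ] XT H T := E.D.compLpL 2 _

theorem ιX_ae (z : XT V T) : ∀ᵐ t ∂volume.restrict (Ioo (0 : ℝ) T), E.ιX T z t = E.ι (z t) :=
  E.ι.coeFn_compLpL z

theorem DX_ae (z : XT V T) : ∀ᵐ t ∂volume.restrict (Ioo (0 : ℝ) T), E.DX T z t = E.D (z t) :=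
  E.D.coeFn_compLpL z

variable {E} in
theorem IsWeakSol.ιX_ae {f : XT H T} {u₀ : H} {u : ℝ → H} {z : XT V T}
    (hu : E.IsWeakSol T f u₀ u z) :
    ∀ᵐ t ∂volume.restrict (Ioo (0 : ℝ) T), E.ιX T z t = u t := by
  filter_upwards [E.ιX_ae z, hu.mem] with t h1 h2
  rw [h1, h2]

variable [CompleteSpace H] [CompleteSpace V]

/-- The time derivative of `R n u` for a weak solution `u`. -/
def rate (n : ℕ) (f : XT H T) (z : XT V T) : XT H T :=
  (E.R n).compLpL 2 _ f - (E.D ∘L E.J n).adjoint.compLpL 2 _ (E.DX T z)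

theorem rate_ae (n : ℕ) (f : XT H T) (z : XT V T) :
    ∀ᵐ t ∂volume.restrict (Ioo (0 : ℝ) T), ∀ h, inner ℝ (E.rate n f z t) h
      = inner ℝ (f t) (E.R n h) - inner ℝ (E.D (z t)) (E.D (E.J n h)) := by
  filter_upwards [Lp.coeFn_sub ((E.R n).compLpL 2 _ f)
    ((E.D ∘L E.J n).adjoint.compLpL 2 _ (E.DX T z)), (E.R n).coeFn_compLpL f,
    (E.D ∘L E.J n).adjoint.coeFn_compLpL (E.DX T z), E.DX_ae z] with t h1 h2 h3 h4 h
  rw [rate, h1, Pi.sub_apply, h2, h3, h4, inner_sub_left, E.R_symm,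
    ContinuousLinearMap.adjoint_inner_left]
  rfl

theorem inner_integral_rate (n : ℕ) (f : XT H T) (z : XT V T) {t : ℝ} (ht : t ∈ Icc 0 T) (h : H) :
    inner ℝ (∫ r in (0 : ℝ)..t, E.rate n f z r) h
      = ∫ r in (0 : ℝ)..t, (inner ℝ (f r) (E.R n h) - inner ℝ (E.D (z r)) (E.D (E.J n h))) := by
  have h0 : (0 : ℝ) ∈ Icc 0 T := ⟨le_rfl, ht.1.trans ht.2⟩
  have h1 := (innerSL ℝ h).intervalIntegral_comp_comm ((E.rate n f z).intervalIntegrable h0 ht)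
  simp only [innerSL_apply_apply] at h1
  rw [real_inner_comm, ← h1]
  refine XT.interval_congr ?_ h0 ht
  filter_upwards [E.rate_ae n f z] with r hr
  rw [real_inner_comm, hr]

variable {E}

/-- The regularised solution `R n u` is a primitive in the pivot space. -/
theorem IsWeakSol.R_eq {f : XT H T} {u₀ : H} {u : ℝ → H} {z : XT V T}
    (hu : E.IsWeakSol T f u₀ u z) (n : ℕ) {t : ℝ} (ht : t ∈ Icc 0 T) :
    E.R n (u t) = E.R n u₀ + ∫ r in (0 : ℝ)..t, E.rate n f z r := by
  refine ext_inner_right ℝ fun h => ?_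
  rw [inner_add_left, E.inner_integral_rate n f z ht, E.R_symm, E.R_symm, ← E.ι_J]
  exact hu.weak (E.J n h) t ht

/-- Duality between a forward solution and the time reversal of another one. -/
theorem IsWeakSol.duality (hT : 0 ≤ T) {f g : XT H T} {u₀ v₀ : H} {u v : ℝ → H} {z y : XT V T}
    (hu : E.IsWeakSol T f u₀ u z) (hv : E.IsWeakSol T g v₀ v y) :
    inner ℝ (u T) v₀ - inner ℝ u₀ (v T)
      = inner ℝ f (XT.rev (E.ιX T y)) - inner ℝ (E.ιX T z) (XT.rev g) := by
  have h0 : (0 : ℝ) ∈ Icc 0 T := ⟨le_rfl, hT⟩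
  have hTm : T ∈ Icc 0 T := ⟨hT, le_rfl⟩
  have hn : ∀ n, inner ℝ (E.R n (u T)) (E.R n v₀) - inner ℝ (E.R n u₀) (E.R n (v T))
      = inner ℝ ((E.R n).compLpL 2 _ f) ((E.R n).compLpL 2 _ (XT.rev (E.ιX T y)))
        - inner ℝ ((E.R n).compLpL 2 _ (E.ιX T z)) ((E.R n).compLpL 2 _ (XT.rev g)) := by
    intro n
    -- Both regularised solutions are primitives, so integration by parts applies to them.
    set a := E.rate n f z
    set b := E.rate n g y
    have ha := a.intervalIntegrable h0 hTm
    have hb : IntervalIntegrable (fun s => -b (T - s)) volume 0 T := by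
      have := ((b.intervalIntegrable hTm h0).comp_sub_left T).neg
      simp only [sub_self, sub_zero] at this
      exact this
    have hv' : ∀ t ∈ Icc 0 T, E.R n (v (T - t))
        = E.R n (v T) + ∫ s in (0 : ℝ)..t, -b (T - s) := by
      intro t ht
      have ht' : T - t ∈ Icc 0 T := ⟨by linarith [ht.2], by linarith [ht.1]⟩
      rw [hv.R_eq n ht', hv.R_eq n hTm, intervalIntegral.integral_neg,
        intervalIntegral.integral_comp_sub_left (fun s => b s) T, sub_zero,
        ← intervalIntegral.integral_add_adjacent_intervals (b.intervalIntegrable h0 ht')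
          (b.intervalIntegrable ht' hTm)]
      abel
    have key := inner_primitive hT ha hb (E.R n u₀) (E.R n (v T))
    rw [← hu.R_eq n hTm, ← hv' T hTm, sub_self, hv.init] at key
    rw [← key, XT.inner_eq hT, XT.inner_eq hT, ← intervalIntegral.integral_sub]
    · refine XT.interval_congr ?_ h0 hTm
      filter_upwards [ae_restrict_mem measurableSet_Ioo, E.rate_ae n f z,
        XT.ae_reflect (E.rate_ae n g y), hu.mem, XT.ae_reflect hv.mem,
        (E.R n).coeFn_compLpL f, (E.R n).coeFn_compLpL (XT.rev (E.ιX T y)),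
        (E.R n).coeFn_compLpL (E.ιX T z), (E.R n).coeFn_compLpL (XT.rev g),
        XT.rev_ae g, XT.rev_ae (E.ιX T y), XT.ae_reflect hv.ιX_ae, hu.ιX_ae]
        with t ht e1 e2 e3 e4 e5 e6 e7 e8 e9 e10 e11 e12
      have ht' := Ioo_subset_Icc_self ht
      have q1 := E.R_symm n (f t) (E.R n (E.ι (y (T - t))))
      have q2 := E.R_symm n (g (T - t)) (E.R n (E.ι (z t)))
      have q3 : inner ℝ (E.D (z t)) (E.D (E.J n (E.R n (E.ι (y (T - t))))))
          = inner ℝ (E.D (y (T - t))) (E.D (E.J n (E.R n (E.ι (z t))))) := by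
        rw [← E.ι_S, ← E.ι_S, E.J_ι, E.J_ι, ← E.D_S_symm, real_inner_comm, E.D_S_symm]
      rw [← hv' t ht', ← hu.R_eq n ht', inner_neg_right, real_inner_comm (b (T - t)), e1, e2, e5,
        e6, e7, e8, e9, e10, e11, e12, e3, e4, real_inner_comm (E.R n (g (T - t))), q1, q2, q3]
      ring
    · exact XT.intervalIntegrable_of_integrable (L2.integrable_inner _ _) h0 hTm
    · exact XT.intervalIntegrable_of_integrable (L2.integrable_inner _ _) h0 hTm
  have c : ∀ x : XT H T, Tendsto (fun n => (E.R n).compLpL 2 _ x) atTop (𝓝 x) :=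
    tendsto_compLpL E.norm_R_le E.tendsto_R
  have l1 := ((E.tendsto_R (u T)).inner (𝕜 := ℝ) (E.tendsto_R v₀)).sub
    ((E.tendsto_R u₀).inner (𝕜 := ℝ) (E.tendsto_R (v T)))
  have l2 := ((c f).inner (𝕜 := ℝ) (c (XT.rev (E.ιX T y)))).sub
    ((c (E.ιX T z)).inner (𝕜 := ℝ) (c (XT.rev g)))
  simp_rw [hn] at l1
  exact tendsto_nhds_unique l1 l2

end EnergySpace

/-! ### Test pairs for the weak evolution equation -/

section Weight

variable {H : Type*} [NormedAddCommGroup H] [InnerProductSpace ℝ H] {T : ℝ}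

/-- The tail primitive `∫_t^T g` in terms of the primitive from `0`. -/
theorem integral_tail_eq (g : XT H T) {t : ℝ} (ht : t ∈ Icc 0 T) :
    ∫ r in t..T, g r = (∫ r in (0 : ℝ)..T, g r) + ∫ r in (0 : ℝ)..t, -g r := by
  have h0 : (0 : ℝ) ∈ Icc 0 T := ⟨le_rfl, ht.1.trans ht.2⟩
  have hT : T ∈ Icc 0 T := ⟨h0.2, le_rfl⟩
  rw [intervalIntegral.integral_neg, ← intervalIntegral.integral_add_adjacent_intervals
    (g.intervalIntegrable h0 ht) (g.intervalIntegrable ht hT)]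
  abel

theorem continuousOn_tail (hT : 0 ≤ T) (g : XT H T) :
    ContinuousOn (fun t => ∫ r in t..T, g r) (Icc 0 T) := by
  have : ContinuousOn (fun t => (∫ r in (0 : ℝ)..T, g r) - ∫ r in (0 : ℝ)..t, g r) (Icc 0 T) :=
    continuousOn_const.sub (g.continuousOn_primitive hT)
  refine this.congr fun t ht => ?_
  simp only [integral_tail_eq g ht, intervalIntegral.integral_neg, sub_eq_add_neg]

/-- The weighted energy identity for the tail primitive of `g`. -/
theorem integral_exp_mul_inner_tail [CompleteSpace H] (hT : 0 ≤ T) (l : ℝ) (g : XT H T) :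
    ∫ t in (0 : ℝ)..T, Real.exp (2 * l * t) * inner ℝ (∫ r in t..T, g r) (g t)
      = ‖∫ r in (0 : ℝ)..T, g r‖ ^ 2 / 2
        + l * ∫ t in (0 : ℝ)..T, Real.exp (2 * l * t) * ‖∫ r in t..T, g r‖ ^ 2 := by
  have h0 : (0 : ℝ) ∈ Icc 0 T := ⟨le_rfl, hT⟩
  have hTm : T ∈ Icc 0 T := ⟨hT, le_rfl⟩
  set Θ : ℝ → H := fun t => ∫ r in t..T, g r with hΘ
  set e : ℝ → ℝ := fun t => Real.exp (2 * l * t) with he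
  have cΘ : ContinuousOn Θ (Icc 0 T) := continuousOn_tail hT g
  have ce : Continuous e := by fun_prop
  have hg := g.intervalIntegrable h0 hTm
  have hng : IntervalIntegrable (fun s => -g s) volume 0 T := hg.neg
  have hΘ' : ∀ t ∈ Icc 0 T, Θ t = Θ 0 + ∫ r in (0 : ℝ)..t, -g r := fun t ht =>
    integral_tail_eq g ht
  have hde : ∀ t, e t = 1 + ∫ r in (0 : ℝ)..t, 2 * l * e r := by
    intro t
    have hd : ∀ x ∈ uIcc 0 t, HasDerivAt e (2 * l * e x) x := by
      intro x _
      have h1 : HasDerivAt (fun t : ℝ => 2 * l * t) (2 * l) x := by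
        simpa using (hasDerivAt_id x).const_mul (2 * l)
      have := h1.exp
      rwa [mul_comm (Real.exp _)] at this
    rw [intervalIntegral.integral_eq_sub_of_hasDerivAt hd
      (Continuous.intervalIntegrable (by fun_prop) _ _)]
    simp [he]
  -- `k` is the derivative of `e Θ`.
  set k : ℝ → H := fun s => (2 * l * e s) • Θ s - e s • g s with hk
  have hki : IntervalIntegrable k volume 0 T := by
    refine IntervalIntegrable.sub ?_ ?_
    · refine ContinuousOn.intervalIntegrable ?_
      rw [uIcc_of_le hT]
      exact (Continuous.continuousOn (by fun_prop)).smul cΘ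
    · exact hg.continuousOn_smul ce.continuousOn
  have heΘ : ∀ t ∈ Icc 0 T, e t • Θ t = Θ 0 + ∫ s in (0 : ℝ)..t, k s := by
    intro t ht
    have key := bilin_primitive (ContinuousLinearMap.lsmul ℝ ℝ (E := H)) ht.1
      (f := fun r => 2 * l * e r) (g := fun s => -g s)
      (Continuous.intervalIntegrable (by fun_prop) _ _)
      (g.intervalIntegrable h0 ht).neg 1 (Θ 0)
    simp only [ContinuousLinearMap.lsmul_apply, ← hde, ← hΘ' t ht, one_smul] at key
    rw [← sub_eq_iff_eq_add', ← key]
    refine intervalIntegral.integral_congr fun s hs => ?_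
    rw [uIcc_of_le ht.1] at hs
    simp only [hk, smul_neg]
    rw [← hΘ' s ⟨hs.1, hs.2.trans ht.2⟩, sub_eq_add_neg]
  have key := inner_primitive hT hki hng (Θ 0) (Θ 0)
  have hT0 : Θ T = 0 := by simp [hΘ]
  rw [← heΘ T hTm, ← hΘ' T hTm, hT0, inner_zero_right, zero_sub, real_inner_self_eq_norm_sq] at key
  have i1 : IntervalIntegrable (fun t => e t * inner ℝ (Θ t) (g t)) volume 0 T := by
    have c1 : ContinuousOn (fun t => e t • Θ t) (Icc 0 T) := ce.continuousOn.smul cΘ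
    have := XT.intervalIntegrable_of_integrable (T := T) (L2.integrable_inner (𝕜 := ℝ)
      (XT.memLp_of_continuousOn c1).toLp g) h0 hTm
    refine this.congr_ae ?_
    refine XT.ae_of_ae_Ioo ?_ h0 hTm
    filter_upwards [(XT.memLp_of_continuousOn c1).coeFn_toLp] with t ht
    rw [ht, real_inner_smul_left]
  have i2 : IntervalIntegrable (fun t => e t * ‖Θ t‖ ^ 2) volume 0 T := by
    refine ContinuousOn.intervalIntegrable ?_
    rw [uIcc_of_le hT]
    exact ce.continuousOn.mul (cΘ.norm.pow 2)
  have hcongr : ∫ s in (0 : ℝ)..T, (inner ℝ (k s) (Θ 0 + ∫ r in (0 : ℝ)..s, -g r)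
      + inner ℝ (Θ 0 + ∫ r in (0 : ℝ)..s, k r) (-g s))
      = ∫ s in (0 : ℝ)..T, (2 * l * (e s * ‖Θ s‖ ^ 2) - 2 * (e s * inner ℝ (Θ s) (g s))) := by
    refine intervalIntegral.integral_congr fun s hs => ?_
    rw [uIcc_of_le hT] at hs
    rw [← hΘ' s hs, ← heΘ s hs]
    simp only [hk, inner_sub_left, real_inner_smul_left, inner_neg_right,
      real_inner_self_eq_norm_sq]
    rw [real_inner_comm (Θ s)]
    ring
  rw [hcongr, intervalIntegral.integral_sub (i2.const_mul _) (i1.const_mul _),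
    intervalIntegral.integral_const_mul, intervalIntegral.integral_const_mul] at key
  linarith

/-- Multiplication by the weight `exp (2 l t)`. -/
theorem exists_exp_smul {l : ℝ} (hl : 0 ≤ l) (x : XT H T) : ∃ y : XT H T,
    (∀ᵐ t ∂volume.restrict (Ioo (0 : ℝ) T), y t = Real.exp (2 * l * t) • x t) ∧
      ‖y‖ ≤ Real.exp (2 * l * T) * ‖x‖ := by
  have hb : ∀ᵐ t ∂volume.restrict (Ioo (0 : ℝ) T),
      ‖Real.exp (2 * l * t) • x t‖ ≤ Real.exp (2 * l * T) * ‖x t‖ := by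
    filter_upwards [ae_restrict_mem measurableSet_Ioo] with t ht
    rw [norm_smul, Real.norm_of_nonneg (Real.exp_nonneg _)]
    gcongr
    exact ht.2.le
  have hm : MemLp (fun t => Real.exp (2 * l * t) • x t) 2 (volume.restrict (Ioo 0 T)) := by
    refine MemLp.of_le_mul (Lp.memLp x) ?_ hb
    exact (Continuous.aestronglyMeasurable (by fun_prop)).smul (Lp.aestronglyMeasurable x)
  refine ⟨hm.toLp, hm.coeFn_toLp, ?_⟩
  refine Lp.norm_le_mul_norm_of_ae_le_mul ?_
  filter_upwards [hb, hm.coeFn_toLp] with t h1 h2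
  rwa [h2]

end Weight

namespace EnergySpace

variable {H V : Type*} [NormedAddCommGroup H] [InnerProductSpace ℝ H]
  [NormedAddCommGroup V] [InnerProductSpace ℝ V] (E : EnergySpace H V) {T : ℝ}

/-- Pairs `(g, θ)` such that `θ` is the tail primitive of `g` and takes values in the energy
space. -/
def testPairs (T : ℝ) : Submodule ℝ (XT H T × XT V T) where
  carrier := {p | ∀ᵐ t ∂volume.restrict (Ioo (0 : ℝ) T), E.ι (p.2 t) = ∫ r in t..T, p.1 r}
  zero_mem' := by
    have h1 : ∀ᵐ t ∂volume.restrict (Ioo (0 : ℝ) T), (0 : XT H T) t = 0 := Lp.coeFn_zero _ _ _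
    filter_upwards [ae_restrict_mem measurableSet_Ioo,
      Lp.coeFn_zero V 2 (volume.restrict (Ioo 0 T))] with t ht h2
    have hT : 0 < T := ht.1.trans ht.2
    rw [Prod.snd_zero, Prod.fst_zero, h2, Pi.zero_apply, map_zero,
      XT.interval_congr h1 ⟨ht.1.le, ht.2.le⟩ ⟨hT.le, le_rfl⟩, intervalIntegral.integral_zero]
  add_mem' := by
    rintro ⟨g, θ⟩ ⟨g', θ'⟩ h h'
    have h1 := Lp.coeFn_add g g'
    filter_upwards [ae_restrict_mem measurableSet_Ioo, h, h', Lp.coeFn_add θ θ'] with t ht a b c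
    have hT : 0 < T := ht.1.trans ht.2
    have ht1 : t ∈ Icc 0 T := ⟨ht.1.le, ht.2.le⟩
    have ht2 : T ∈ Icc 0 T := ⟨hT.le, le_rfl⟩
    simp only [Prod.mk_add_mk] at a b ⊢
    rw [c, Pi.add_apply, map_add, a, b, ← intervalIntegral.integral_add
      (g.intervalIntegrable ht1 ht2) (g'.intervalIntegrable ht1 ht2)]
    exact (XT.interval_congr h1 ht1 ht2).symm
  smul_mem' := by
    rintro r ⟨g, θ⟩ h
    have h1 := Lp.coeFn_smul r g
    filter_upwards [ae_restrict_mem measurableSet_Ioo, h, Lp.coeFn_smul r θ] with t ht a c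
    have hT : 0 < T := ht.1.trans ht.2
    have ht1 : t ∈ Icc 0 T := ⟨ht.1.le, ht.2.le⟩
    have ht2 : T ∈ Icc 0 T := ⟨hT.le, le_rfl⟩
    simp only [Prod.smul_mk] at a ⊢
    rw [c, Pi.smul_apply, map_smul, a, ← intervalIntegral.integral_smul]
    exact (XT.interval_congr h1 ht1 ht2).symm

/-- The total integral as a linear map. -/
def totalIntegral (hT : 0 ≤ T) : XT H T →ₗ[ℝ] H where
  toFun g := ∫ r in (0 : ℝ)..T, g r
  map_add' g g' := by
    have h0 : (0 : ℝ) ∈ Icc 0 T := ⟨le_rfl, hT⟩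
    have hTm : T ∈ Icc 0 T := ⟨hT, le_rfl⟩
    rw [← intervalIntegral.integral_add
      (g.intervalIntegrable h0 hTm) (g'.intervalIntegrable h0 hTm)]
    exact XT.interval_congr (Lp.coeFn_add g g') h0 hTm
  map_smul' r g := by
    have h0 : (0 : ℝ) ∈ Icc 0 T := ⟨le_rfl, hT⟩
    have hTm : T ∈ Icc 0 T := ⟨hT, le_rfl⟩
    rw [RingHom.id_apply, ← intervalIntegral.integral_smul]
    exact XT.interval_congr (Lp.coeFn_smul r g) h0 hTm

theorem norm_sq_XT (θ : XT V T) : ‖θ‖ ^ 2 = ‖E.ιX T θ‖ ^ 2 + ‖E.DX T θ‖ ^ 2 := by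
  rw [norm_sq_eq_integral, norm_sq_eq_integral, norm_sq_eq_integral,
    ← integral_add (integrable_norm_sq _) (integrable_norm_sq _)]
  refine integral_congr_ae ?_
  filter_upwards [E.ιX_ae θ, E.DX_ae θ] with t h1 h2
  rw [h1, h2, E.norm_sq_eq]

variable [CompleteSpace H] [CompleteSpace V]

/-- The operator that represents the space-time bilinear form of Lions' method: pairing `z` with it
gives `⟪z, g⟫ + ⟪D z, D θ⟫ + ⟪N z, θ⟫`, where `g = -θ'`. -/
def testOp (N : XT H T →L[ℝ] XT H T) : XT H T × XT V T →ₗ[ℝ] XT V T :=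
  ((E.ιX T).adjoint ∘L ContinuousLinearMap.fst ℝ _ _ + ((E.DX T).adjoint ∘L E.DX T
    + (E.ιX T).adjoint ∘L N.adjoint ∘L E.ιX T) ∘L ContinuousLinearMap.snd ℝ _ _ :
      XT H T × XT V T →L[ℝ] XT V T)

theorem inner_testOp (N : XT H T →L[ℝ] XT H T) (z : XT V T) (p : XT H T × XT V T) :
    inner ℝ z (E.testOp N p) = inner ℝ (E.ιX T z) p.1 + inner ℝ (E.DX T z) (E.DX T p.2)
      + inner ℝ (N (E.ιX T z)) (E.ιX T p.2) := by
  simp [testOp, inner_add_right, ContinuousLinearMap.adjoint_inner_right]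
  ring

/-- Coercivity in Lions' method: testing with the weight `exp (2 l t)` absorbs the potential. -/
theorem testOp_coercive (hT : 0 ≤ T) (N : XT H T →L[ℝ] XT H T) {C : ℝ} (hC : 0 ≤ C)
    (hN : ∀ x, ∀ᵐ t ∂volume.restrict (Ioo (0 : ℝ) T), ‖N x t‖ ≤ C * ‖x t‖)
    (p : XT H T × XT V T) (hp : p ∈ E.testPairs T) :
    ‖p.2‖ ^ 2 + ‖∫ r in (0 : ℝ)..T, p.1 r‖ ^ 2 / 2
      ≤ Real.exp (2 * (C + 1) * T) * ‖p.2‖ * ‖E.testOp N p‖ := by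
  obtain ⟨g, θ⟩ := p
  simp only
  have hl : 0 ≤ C + 1 := by linarith
  -- `y = exp (2 (C + 1) t) θ`; the rate `C + 1` leaves one copy of `‖θ‖²` after the potential term.
  obtain ⟨y, hy, hyn⟩ := exists_exp_smul hl θ
  have h0 : (0 : ℝ) ∈ Icc 0 T := ⟨le_rfl, hT⟩
  have hTm : T ∈ Icc 0 T := ⟨hT, le_rfl⟩
  have h1 : inner ℝ y (E.testOp N (g, θ))
      ≤ Real.exp (2 * (C + 1) * T) * ‖θ‖ * ‖E.testOp N (g, θ)‖ :=
    (real_inner_le_norm _ _).trans (by gcongr)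
  refine le_trans ?_ h1
  rw [inner_testOp]
  simp only
  have hid := integral_exp_mul_inner_tail hT (C + 1) g
  set Θ : ℝ → H := fun t => ∫ r in t..T, g r with hΘ
  have cΘ : ContinuousOn Θ (Icc 0 T) := continuousOn_tail hT g
  have hp' : ∀ᵐ t ∂volume.restrict (Ioo (0 : ℝ) T), E.ι (θ t) = Θ t := hp
  have e1 : inner ℝ (E.ιX T y) g
      = ∫ t in (0 : ℝ)..T, Real.exp (2 * (C + 1) * t) * inner ℝ (Θ t) (g t) := by
    rw [XT.inner_eq hT]
    refine XT.interval_congr ?_ h0 hTm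
    filter_upwards [E.ιX_ae y, hy, hp'] with t a b c
    rw [a, b, map_smul, c, real_inner_smul_left]
  have i2 : IntervalIntegrable (fun t => Real.exp (2 * (C + 1) * t) * ‖Θ t‖ ^ 2) volume 0 T := by
    refine ContinuousOn.intervalIntegrable ?_
    rw [uIcc_of_le hT]
    exact (Continuous.continuousOn (by fun_prop)).mul (cΘ.norm.pow 2)
  have key : ‖θ‖ ^ 2 ≤ (C + 1) * (∫ t in (0 : ℝ)..T, Real.exp (2 * (C + 1) * t) * ‖Θ t‖ ^ 2)
      + inner ℝ (E.DX T y) (E.DX T θ) + inner ℝ (N (E.ιX T y)) (E.ιX T θ) := by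
    rw [norm_sq_eq_integral, XT.integral_Ioo hT, XT.inner_eq hT, XT.inner_eq hT,
      ← intervalIntegral.integral_const_mul,
      ← intervalIntegral.integral_add (i2.const_mul _) (XT.intervalIntegrable_of_integrable
        (L2.integrable_inner _ _) h0 hTm), ← intervalIntegral.integral_add
        ((i2.const_mul _).add (XT.intervalIntegrable_of_integrable
        (L2.integrable_inner _ _) h0 hTm)) (XT.intervalIntegrable_of_integrable
        (L2.integrable_inner _ _) h0 hTm)]
    refine intervalIntegral.integral_mono_ae_restrict hT
      (XT.intervalIntegrable_of_integrable (integrable_norm_sq θ) h0 hTm)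
      (((i2.const_mul _).add (XT.intervalIntegrable_of_integrable
        (L2.integrable_inner _ _) h0 hTm)).add (XT.intervalIntegrable_of_integrable
        (L2.integrable_inner _ _) h0 hTm)) ?_
    rw [← Measure.restrict_congr_set Ioo_ae_eq_Icc]
    filter_upwards [ae_restrict_mem measurableSet_Ioo, E.ιX_ae y, hy, hp', E.DX_ae y, E.DX_ae θ,
      E.ιX_ae θ, hN (E.ιX T y)] with t ht a b c d e f k
    have he : 1 ≤ Real.exp (2 * (C + 1) * t) := Real.one_le_exp (by have := ht.1; positivity)
    rw [d, e, f, b, map_smul, real_inner_smul_left, real_inner_self_eq_norm_sq, E.norm_sq_eq, c]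
    rw [a, b, map_smul, norm_smul, c, Real.norm_of_nonneg (Real.exp_nonneg _)] at k
    have h2 := neg_le_of_abs_le ((abs_real_inner_le_norm (N (E.ιX T y) t) (Θ t)).trans
      (mul_le_mul_of_nonneg_right k (norm_nonneg _)))
    have h3 := mul_le_mul_of_nonneg_right he (sq_nonneg ‖Θ t‖)
    have h4 := mul_le_mul_of_nonneg_right he (sq_nonneg ‖E.D (θ t)‖)
    nlinarith
  rw [e1, hid]
  linarith

/-- Lions' method: a solution in the distributional sense. -/
theorem exists_distributional (hT : 0 ≤ T) (N : XT H T →L[ℝ] XT H T) {C : ℝ} (hC : 0 ≤ C)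
    (hN : ∀ x, ∀ᵐ t ∂volume.restrict (Ioo (0 : ℝ) T), ‖N x t‖ ≤ C * ‖x t‖)
    (f : XT H T) (u₀ : H) : ∃ z : XT V T, ∀ p ∈ E.testPairs T,
      inner ℝ (E.ιX T z) p.1 + inner ℝ (E.DX T z) (E.DX T p.2)
        + inner ℝ (N (E.ιX T z)) (E.ιX T p.2)
      = inner ℝ f (E.ιX T p.2) + inner ℝ u₀ (∫ r in (0 : ℝ)..T, p.1 r) := by
  let L : XT H T × XT V T →ₗ[ℝ] ℝ :=
    (innerSL ℝ f : XT H T →ₗ[ℝ] ℝ) ∘ₗ (E.ιX T : XT V T →ₗ[ℝ] XT H T) ∘ₗ LinearMap.snd ℝ _ _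
      + (innerSL ℝ u₀ : H →ₗ[ℝ] ℝ) ∘ₗ totalIntegral hT ∘ₗ LinearMap.fst ℝ _ _
  have hL : ∀ p, L p = inner ℝ f (E.ιX T p.2) + inner ℝ u₀ (∫ r in (0 : ℝ)..T, p.1 r) :=
    fun p => rfl
  set M := Real.exp (2 * (C + 1) * T) with hM
  have hM0 : 0 < M := Real.exp_pos _
  obtain ⟨z, -, hz⟩ := exists_inner_eq_of_le (E.testOp N ∘ₗ (E.testPairs T).subtype)
    (L ∘ₗ (E.testPairs T).subtype) (C := ‖f‖ * M + ‖u₀‖ * (2 * M)) (by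
      rintro ⟨p, hp⟩
      have h1 := E.testOp_coercive hT N hC hN p hp
      rw [← hM] at h1
      simp only [LinearMap.comp_apply, Submodule.subtype_apply, hL]
      set k := ‖E.testOp N p‖
      have hk : 0 ≤ k := norm_nonneg _
      set I := ∫ r in (0 : ℝ)..T, p.1 r
      have a1 : ‖p.2‖ ≤ M * k := by
        by_contra hc
        push Not at hc
        have : 0 < ‖p.2‖ := lt_of_le_of_lt (by positivity) hc
        nlinarith [sq_nonneg ‖I‖]
      have a2 : ‖I‖ ≤ 2 * M * k := by
        have h2 : ‖I‖ ^ 2 ≤ (2 * M * k) ^ 2 := by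
          have h3 : M * ‖p.2‖ * k ≤ M * (M * k) * k := by gcongr
          nlinarith [sq_nonneg ‖p.2‖, sq_nonneg (M * k)]
        exact (sq_le_sq₀ (norm_nonneg _) (by positivity)).mp h2
      have a3 : ‖E.ιX T p.2‖ ≤ ‖p.2‖ := by
        rw [← sq_le_sq₀ (norm_nonneg _) (norm_nonneg _), E.norm_sq_XT p.2]
        nlinarith [sq_nonneg ‖E.DX T p.2‖]
      calc |inner ℝ f (E.ιX T p.2) + inner ℝ u₀ I|
          ≤ |inner ℝ f (E.ιX T p.2)| + |inner ℝ u₀ I| := abs_add_le _ _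
        _ ≤ ‖f‖ * ‖E.ιX T p.2‖ + ‖u₀‖ * ‖I‖ :=
          add_le_add (abs_real_inner_le_norm _ _) (abs_real_inner_le_norm _ _)
        _ ≤ ‖f‖ * (M * k) + ‖u₀‖ * (2 * M * k) := by
          gcongr
          exact a3.trans a1
        _ = _ := by ring)
  refine ⟨z, fun p hp => ?_⟩
  have := hz ⟨p, hp⟩
  simp only [LinearMap.comp_apply, Submodule.subtype_apply, inner_testOp, hL] at this
  exact this

end EnergySpace

/-! ### Existence of weak solutions -/

namespace EnergySpace

variable {H V : Type*} [NormedAddCommGroup H] [InnerProductSpace ℝ H] [CompleteSpace H]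
  [NormedAddCommGroup V] [InnerProductSpace ℝ V] [CompleteSpace V] (E : EnergySpace H V) {T : ℝ}

/-- The primitive that represents `R n u`. -/
def regularized (n : ℕ) (F : XT H T) (u₀ : H) (z : XT V T) (t : ℝ) : H :=
  E.R n u₀ + ∫ r in (0 : ℝ)..t, E.rate n F z r

theorem continuousOn_regularized (hT : 0 ≤ T) (n : ℕ) (F : XT H T) (u₀ : H) (z : XT V T) :
    ContinuousOn (E.regularized n F u₀ z) (Icc 0 T) :=
  continuousOn_const.add ((E.rate n F z).continuousOn_primitive hT)

/-- Regularising a distributional solution in space makes it absolutely continuous in time. -/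
theorem R_eq_regularized (hT : 0 ≤ T) (F : XT H T) (u₀ : H) (z : XT V T)
    (hz : ∀ p ∈ E.testPairs T, inner ℝ (E.ιX T z) p.1 + inner ℝ (E.DX T z) (E.DX T p.2)
      = inner ℝ F (E.ιX T p.2) + inner ℝ u₀ (∫ r in (0 : ℝ)..T, p.1 r)) (n : ℕ) :
    ∀ᵐ t ∂volume.restrict (Ioo (0 : ℝ) T), E.R n (E.ι (z t)) = E.regularized n F u₀ z t := by
  have h0 : (0 : ℝ) ∈ Icc 0 T := ⟨le_rfl, hT⟩
  have hTm : T ∈ Icc 0 T := ⟨hT, le_rfl⟩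
  have hW := XT.memLp_of_continuousOn (E.continuousOn_regularized hT n F u₀ z)
  set W : XT H T := hW.toLp with hWdef
  have key : ∀ k : XT H T, inner ℝ ((E.R n).compLpL 2 _ (E.ιX T z)) k = inner ℝ W k := by
    intro k
    have hK := XT.memLp_of_continuousOn (continuousOn_tail hT k)
    set KX : XT H T := hK.toLp
    -- The test pair is the regularisation of `k` and of its tail primitive.
    set θ : XT V T := (E.J n).compLpL 2 _ KX
    set Rk : XT H T := (E.R n).compLpL 2 _ k
    have hRint : ∀ t ∈ Icc 0 T, ∫ r in t..T, Rk r = E.R n (∫ r in t..T, k r) := by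
      intro t ht
      rw [← (E.R n).intervalIntegral_comp_comm (k.intervalIntegrable ht hTm)]
      exact XT.interval_congr ((E.R n).coeFn_compLpL k) ht hTm
    have hp : (Rk, θ) ∈ E.testPairs T := by
      change ∀ᵐ t ∂volume.restrict (Ioo (0 : ℝ) T), E.ι (θ t) = ∫ r in t..T, Rk r
      filter_upwards [ae_restrict_mem measurableSet_Ioo, (E.J n).coeFn_compLpL KX, hK.coeFn_toLp]
        with t ht a b
      rw [hRint t (Ioo_subset_Icc_self ht), a, b, E.ι_J]
    have h1 := hz _ hp
    simp only at h1
    rw [hRint 0 h0, ← E.R_symm] at h1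
    have h2 := inner_primitive hT ((E.rate n F z).intervalIntegrable h0 hTm)
      (k.intervalIntegrable h0 hTm).neg (E.R n u₀) (∫ r in (0 : ℝ)..T, k r)
    have h3 : (∫ r in (0 : ℝ)..T, k r) + ∫ r in (0 : ℝ)..T, -k r = 0 := by
      rw [← integral_tail_eq k hTm, intervalIntegral.integral_same]
    simp only [Pi.neg_apply] at h2
    rw [h3, inner_zero_right, zero_sub] at h2
    have i1 := XT.intervalIntegrable_of_integrable
      (L2.integrable_inner (𝕜 := ℝ) (E.rate n F z) KX) h0 hTm
    have i2 := XT.intervalIntegrable_of_integrable (L2.integrable_inner (𝕜 := ℝ) W k) h0 hTm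
    have h4 : inner ℝ (E.rate n F z) KX - inner ℝ W k
        = -inner ℝ (E.R n u₀) (∫ r in (0 : ℝ)..T, k r) := by
      rw [← h2, XT.inner_eq hT, XT.inner_eq hT, ← intervalIntegral.integral_sub i1 i2]
      refine XT.interval_congr ?_ h0 hTm
      filter_upwards [ae_restrict_mem measurableSet_Ioo, hK.coeFn_toLp, hW.coeFn_toLp] with t ht a b
      rw [a, b, integral_tail_eq k (Ioo_subset_Icc_self ht), inner_neg_right, sub_eq_add_neg]
      rfl
    have h5 : inner ℝ (E.rate n F z) KX
        = inner ℝ F (E.ιX T θ) - inner ℝ (E.DX T z) (E.DX T θ) := by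
      rw [L2.inner_def, L2.inner_def, L2.inner_def, ← integral_sub (L2.integrable_inner _ _)
        (L2.integrable_inner _ _)]
      refine integral_congr_ae ?_
      filter_upwards [E.rate_ae n F z, E.ιX_ae θ, E.DX_ae θ, E.DX_ae z, (E.J n).coeFn_compLpL KX]
        with t a b c d e
      rw [a, b, c, d, e, E.ι_J]
    have h6 : inner ℝ ((E.R n).compLpL 2 _ (E.ιX T z)) k = inner ℝ (E.ιX T z) Rk := by
      rw [L2.inner_def, L2.inner_def]
      refine integral_congr_ae ?_
      filter_upwards [(E.R n).coeFn_compLpL (E.ιX T z), (E.R n).coeFn_compLpL k] with t a b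
      rw [a, b, E.R_symm]
    linarith
  have h7 : (E.R n).compLpL 2 _ (E.ιX T z) = W := ext_inner_right ℝ key
  filter_upwards [(E.R n).coeFn_compLpL (E.ιX T z), E.ιX_ae z, hW.coeFn_toLp] with t a b c
  rw [← b, ← a, h7, hWdef, c]

/-- The energy estimate which makes the regularisations a Cauchy sequence, uniformly in time. -/
theorem norm_regularized_sub_le (hT : 0 ≤ T) (F : XT H T) (u₀ : H) (z : XT V T) {n m : ℕ}
    (hn : ∀ᵐ t ∂volume.restrict (Ioo (0 : ℝ) T), E.R n (E.ι (z t)) = E.regularized n F u₀ z t)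
    (hm : ∀ᵐ t ∂volume.restrict (Ioo (0 : ℝ) T), E.R m (E.ι (z t)) = E.regularized m F u₀ z t)
    {t : ℝ} (ht : t ∈ Icc 0 T) :
    ‖E.regularized n F u₀ z t - E.regularized m F u₀ z t‖ ^ 2
      ≤ ‖E.R n u₀ - E.R m u₀‖ ^ 2 + (4 * ‖F‖ + 4 * ‖z‖)
        * ‖(E.S n).compLpL 2 _ z - (E.S m).compLpL 2 _ z‖ := by
  have h0 : (0 : ℝ) ∈ Icc 0 T := ⟨le_rfl, hT⟩
  set y : XT V T := (E.S n).compLpL 2 _ z - (E.S m).compLpL 2 _ z with hy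
  set d : XT H T := E.rate n F z - E.rate m F z with hd
  have hda : ∀ᵐ r ∂volume.restrict (Ioo (0 : ℝ) T), d r = E.rate n F z r - E.rate m F z r :=
    Lp.coeFn_sub _ _
  have hdiff : ∀ s ∈ Icc 0 T, E.regularized n F u₀ z s - E.regularized m F u₀ z s
      = (E.R n u₀ - E.R m u₀) + ∫ r in (0 : ℝ)..s, d r := by
    intro s hs
    rw [XT.interval_congr hda h0 hs, intervalIntegral.integral_sub
      ((E.rate n F z).intervalIntegrable h0 hs) ((E.rate m F z).intervalIntegrable h0 hs)]
    simp only [regularized]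
    abel
  have hid := inner_primitive ht.1 (d.intervalIntegrable h0 ht) (d.intervalIntegrable h0 ht)
    (E.R n u₀ - E.R m u₀) (E.R n u₀ - E.R m u₀)
  rw [← hdiff t ht, real_inner_self_eq_norm_sq, real_inner_self_eq_norm_sq] at hid
  have hya : ∀ᵐ s ∂volume.restrict (Ioo (0 : ℝ) T), y s = E.S n (z s) - E.S m (z s) := by
    filter_upwards [Lp.coeFn_sub ((E.S n).compLpL 2 _ z) ((E.S m).compLpL 2 _ z),
      (E.S n).coeFn_compLpL z, (E.S m).coeFn_compLpL z] with s a b c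
    rw [hy, a, Pi.sub_apply, b, c]
  have hpt : ∀ᵐ s ∂volume.restrict (Ioo (0 : ℝ) T),
      inner ℝ (d s) ((E.R n u₀ - E.R m u₀) + ∫ r in (0 : ℝ)..s, d r)
        + inner ℝ ((E.R n u₀ - E.R m u₀) + ∫ r in (0 : ℝ)..s, d r) (d s)
      ≤ 4 * (‖F s‖ * ‖y s‖) + 4 * (‖z s‖ * ‖y s‖) := by
    filter_upwards [ae_restrict_mem measurableSet_Ioo, hda, hya, hn, hm, E.rate_ae n F z,
      E.rate_ae m F z] with s hs a b c e f g
    rw [← hdiff s (Ioo_subset_Icc_self hs), ← c, ← e, ← E.ι_S, ← E.ι_S, ← map_sub, ← b,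
      real_inner_comm, a, inner_sub_right, real_inner_comm, real_inner_comm (E.rate m F z s), f, g,
      ← E.ι_S, ← E.ι_S, E.J_ι, E.J_ι]
    have nι : ∀ v, ‖E.ι v‖ ≤ ‖v‖ := fun v => by
      rw [← sq_le_sq₀ (norm_nonneg _) (norm_nonneg _), E.norm_sq_eq]
      nlinarith [sq_nonneg ‖E.D v‖]
    have nD : ∀ v, ‖E.D v‖ ≤ ‖v‖ := fun v => by
      rw [← sq_le_sq₀ (norm_nonneg _) (norm_nonneg _), E.norm_sq_eq]
      nlinarith [sq_nonneg ‖E.ι v‖]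
    have nS : ∀ k v, ‖E.S k v‖ ≤ ‖v‖ := fun k v => by
      simpa using (E.S k).le_of_opNorm_le (E.norm_S_le k) v
    have b1 : ∀ k, |inner ℝ (F s) (E.ι (E.S k (y s)))| ≤ ‖F s‖ * ‖y s‖ := fun k =>
      (abs_real_inner_le_norm _ _).trans (by gcongr; exact (nι _).trans (nS _ _))
    have b2 : ∀ k, |inner ℝ (E.D (z s)) (E.D (E.S k (y s)))| ≤ ‖z s‖ * ‖y s‖ := fun k =>
      (abs_real_inner_le_norm _ _).trans
        (mul_le_mul (nD _) ((nD _).trans (nS _ _)) (norm_nonneg _) (norm_nonneg _))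
    have c1 := abs_le.mp (b1 n)
    have c2 := abs_le.mp (b1 m)
    have c3 := abs_le.mp (b2 n)
    have c4 := abs_le.mp (b2 m)
    linarith [c1.1, c1.2, c2.1, c2.2, c3.1, c3.2, c4.1, c4.2]
  have iF := integrable_norm_mul_norm F y
  have iz := integrable_norm_mul_norm z y
  have hint := ((iF.const_mul 4).add (iz.const_mul 4))
  have hcd : ContinuousOn (fun s => (E.R n u₀ - E.R m u₀) + ∫ r in (0 : ℝ)..s, d r) (Icc 0 T) :=
    continuousOn_const.add (d.continuousOn_primitive hT)
  have hcL := (XT.memLp_of_continuousOn hcd).coeFn_toLp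
  have iL : Integrable (fun s => inner ℝ (d s) ((E.R n u₀ - E.R m u₀) + ∫ r in (0 : ℝ)..s, d r)
        + inner ℝ ((E.R n u₀ - E.R m u₀) + ∫ r in (0 : ℝ)..s, d r) (d s))
        (volume.restrict (Ioo (0 : ℝ) T)) := by
    refine ((L2.integrable_inner (𝕜 := ℝ) d (XT.memLp_of_continuousOn hcd).toLp).add
      (L2.integrable_inner (𝕜 := ℝ) (XT.memLp_of_continuousOn hcd).toLp d)).congr ?_
    filter_upwards [hcL] with s a
    rw [Pi.add_apply, a]
  have hle : ∫ s in (0 : ℝ)..t, (inner ℝ (d s) ((E.R n u₀ - E.R m u₀) + ∫ r in (0 : ℝ)..s, d r)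
        + inner ℝ ((E.R n u₀ - E.R m u₀) + ∫ r in (0 : ℝ)..s, d r) (d s))
      ≤ 4 * (‖F‖ * ‖y‖) + 4 * (‖z‖ * ‖y‖) := by
    calc _ ≤ ∫ s in (0 : ℝ)..t, (4 * (‖F s‖ * ‖y s‖) + 4 * (‖z s‖ * ‖y s‖)) := by
          rw [intervalIntegral.integral_of_le ht.1, intervalIntegral.integral_of_le ht.1,
            ← uIoc_of_le ht.1]
          refine integral_mono_ae ?_ ?_ (XT.ae_of_ae_Ioo hpt h0 ht)
          · have := XT.intervalIntegrable_of_integrable iL h0 ht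
            rwa [intervalIntegrable_iff] at this
          · have := XT.intervalIntegrable_of_integrable hint h0 ht
            rwa [intervalIntegrable_iff] at this
      _ ≤ ∫ s in (0 : ℝ)..T, (4 * (‖F s‖ * ‖y s‖) + 4 * (‖z s‖ * ‖y s‖)) := by
          refine intervalIntegral.integral_mono_interval le_rfl ht.1 ht.2
            (Eventually.of_forall fun s => by positivity)
            (XT.intervalIntegrable_of_integrable hint h0 ⟨hT, le_rfl⟩)
      _ ≤ _ := by
          rw [← XT.integral_Ioo hT, integral_add (iF.const_mul 4) (iz.const_mul 4),
            integral_const_mul, integral_const_mul]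
          gcongr
          · exact integral_norm_mul_norm_le F y
          · exact integral_norm_mul_norm_le z y
  rw [hid] at hle
  linarith

/-- Existence of weak solutions, with a bounded zeroth order perturbation `N` that is local in
time. -/
theorem exists_isWeakSol (hT : 0 ≤ T) (N : XT H T →L[ℝ] XT H T) {C : ℝ} (hC : 0 ≤ C)
    (hN : ∀ x, ∀ᵐ t ∂volume.restrict (Ioo (0 : ℝ) T), ‖N x t‖ ≤ C * ‖x t‖)
    (f : XT H T) (u₀ : H) : ∃ u z, E.IsWeakSol T (f - N (E.ιX T z)) u₀ u z := by
  have h0 : (0 : ℝ) ∈ Icc 0 T := ⟨le_rfl, hT⟩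
  obtain ⟨z, hz⟩ := E.exists_distributional hT N hC hN f u₀
  set F := f - N (E.ιX T z) with hF
  have hR := E.R_eq_regularized hT F u₀ z (fun p hp => by
    have := hz p hp
    rw [hF, inner_sub_left]
    linarith)
  set U : ℕ → ℝ → H := fun n => E.regularized n F u₀ z with hU
  have hzS := tendsto_compLpL E.norm_S_le E.tendsto_S z
  have hbound : UniformCauchySeqOn U atTop (Icc 0 T) := by
    rw [Metric.uniformCauchySeqOn_iff]
    intro ε hε
    have c1 : Tendsto (fun p : ℕ × ℕ => ‖E.R p.1 u₀ - E.R p.2 u₀‖ ^ 2 + (4 * ‖F‖ + 4 * ‖z‖)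
        * ‖(E.S p.1).compLpL 2 _ z - (E.S p.2).compLpL 2 _ z‖) (atTop ×ˢ atTop) (𝓝 0) := by
      have d1 := ((E.tendsto_R u₀).comp tendsto_fst).sub ((E.tendsto_R u₀).comp
        (tendsto_snd (f := (atTop : Filter ℕ)) (g := (atTop : Filter ℕ))))
      have d2 := (hzS.comp tendsto_fst).sub (hzS.comp
        (tendsto_snd (f := (atTop : Filter ℕ)) (g := (atTop : Filter ℕ))))
      have := (d1.norm.pow 2).add (d2.norm.const_mul (4 * ‖F‖ + 4 * ‖z‖))
      simpa using this
    rw [prod_atTop_atTop_eq] at c1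
    obtain ⟨⟨a, b⟩, hab⟩ := eventually_atTop.mp
      (c1.eventually (gt_mem_nhds (show 0 < ε ^ 2 by positivity)))
    refine ⟨max a b, fun m hm n hn t ht => ?_⟩
    have h1 := hab (m, n) ⟨(le_max_left _ _).trans hm, (le_max_right _ _).trans hn⟩
    have h2 := E.norm_regularized_sub_le hT F u₀ z (hR m) (hR n) ht
    rw [dist_eq_norm]
    exact lt_of_pow_lt_pow_left₀ 2 hε.le (lt_of_le_of_lt h2 h1)
  have hlim : ∀ t, ∃ l, t ∈ Icc 0 T → Tendsto (fun n => U n t) atTop (𝓝 l) := by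
    intro t
    by_cases ht : t ∈ Icc 0 T
    · obtain ⟨l, hl⟩ := cauchySeq_tendsto_of_complete (hbound.cauchySeq ht)
      exact ⟨l, fun _ => hl⟩
    · exact ⟨0, fun h => absurd h ht⟩
  choose u hu using hlim
  have hunif := hbound.tendstoUniformlyOn_of_tendsto hu
  have hU0 : ∀ n, U n 0 = E.R n u₀ := fun n => by simp [hU, regularized]
  refine ⟨u, z, ⟨?_, ?_, ?_, ?_⟩⟩
  · exact hunif.continuousOn (Eventually.of_forall fun n =>
      E.continuousOn_regularized hT n F u₀ z).frequently
  · have := hu 0 h0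
    simp_rw [hU0] at this
    exact tendsto_nhds_unique this (E.tendsto_R u₀)
  · filter_upwards [ae_restrict_mem measurableSet_Ioo, ae_all_iff.mpr hR] with t ht a
    have h1 := hu t (Ioo_subset_Icc_self ht)
    have h2 := E.tendsto_R (E.ι (z t))
    simp_rw [a] at h2
    exact tendsto_nhds_unique h1 h2
  · intro v t ht
    have iF := F.intervalIntegrable h0 ht
    have iD := (E.DX T z).intervalIntegrable h0 ht
    have hform : ∀ k : H, ∀ l : V,
        ∫ r in (0 : ℝ)..t, (inner ℝ (F r) k - inner ℝ (E.D (z r)) (E.D l))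
        = inner ℝ (∫ r in (0 : ℝ)..t, F r) k - inner ℝ (∫ r in (0 : ℝ)..t, E.DX T z r) (E.D l) := by
      intro k l
      have h1 := (innerSL ℝ k).intervalIntegral_comp_comm iF
      have h2 := (innerSL ℝ (E.D l)).intervalIntegral_comp_comm iD
      simp only [innerSL_apply_apply] at h1 h2
      have j1 : IntervalIntegrable (fun r => inner ℝ k (F r)) volume 0 t :=
        ⟨(innerSL ℝ k).integrable_comp iF.1, (innerSL ℝ k).integrable_comp iF.2⟩
      have j2 : IntervalIntegrable (fun r => inner ℝ (E.D l) (E.DX T z r)) volume 0 t :=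
        ⟨(innerSL ℝ (E.D l)).integrable_comp iD.1, (innerSL ℝ (E.D l)).integrable_comp iD.2⟩
      rw [real_inner_comm, ← h1, real_inner_comm (E.D l), ← h2,
        ← intervalIntegral.integral_sub j1 j2]
      refine XT.interval_congr ?_ h0 ht
      filter_upwards [E.DX_ae z] with r hr
      rw [hr, real_inner_comm, real_inner_comm (E.D l)]
    have h1 : ∀ n, inner ℝ (U n t) (E.ι v) = inner ℝ u₀ (E.R n (E.ι v))
        + (inner ℝ (∫ r in (0 : ℝ)..t, F r) (E.R n (E.ι v))
          - inner ℝ (∫ r in (0 : ℝ)..t, E.DX T z r) (E.D (E.S n v))) := by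
      intro n
      rw [← hform, ← E.J_ι, ← E.inner_integral_rate n F z ht, ← E.R_symm, ← inner_add_left]
      rfl
    have h2 : Tendsto (fun n => inner ℝ (U n t) (E.ι v)) atTop (𝓝 (inner ℝ (u t) (E.ι v))) :=
      (hu t ht).inner tendsto_const_nhds
    have h3 : Tendsto (fun n => inner ℝ u₀ (E.R n (E.ι v))
        + (inner ℝ (∫ r in (0 : ℝ)..t, F r) (E.R n (E.ι v))
          - inner ℝ (∫ r in (0 : ℝ)..t, E.DX T z r) (E.D (E.S n v)))) atTop
        (𝓝 (inner ℝ u₀ (E.ι v) + (inner ℝ (∫ r in (0 : ℝ)..t, F r) (E.ι v)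
          - inner ℝ (∫ r in (0 : ℝ)..t, E.DX T z r) (E.D v)))) := by
      have a1 := E.tendsto_R (E.ι v)
      have a2 := (E.D.continuous.tendsto v).comp (E.tendsto_S v)
      exact (tendsto_const_nhds.inner a1).add
        ((tendsto_const_nhds.inner a1).sub (tendsto_const_nhds.inner a2))
    simp_rw [h1] at h2
    rw [hform]
    exact tendsto_nhds_unique h2 h3

end EnergySpace

/-! ### Duality, uniqueness and the coupled systems -/

/-- A bounded symmetric zeroth order term on `L²(0,T; H)` that acts pointwise in time; locality is
encoded by the pointwise bound. -/
structure Potential (H : Type*) [NormedAddCommGroup H] [InnerProductSpace ℝ H] (T : ℝ) where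
  /-- the operator -/
  op : XT H T →L[ℝ] XT H T
  /-- the bound -/
  bound : ℝ
  bound_nonneg : 0 ≤ bound
  norm_le : ∀ x, ∀ᵐ t ∂volume.restrict (Ioo (0 : ℝ) T), ‖op x t‖ ≤ bound * ‖x t‖
  symm : ∀ x y, inner ℝ (op x) y = inner ℝ x (op y)

/-- The time reversal of a potential. -/
def Potential.reverse {H : Type*} [NormedAddCommGroup H] [InnerProductSpace ℝ H] {T : ℝ}
    (N : Potential H T) : Potential H T where
  op := XT.rev ∘L N.op ∘L XT.rev
  bound := N.bound
  bound_nonneg := N.bound_nonneg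
  norm_le x := by
    filter_upwards [XT.rev_ae (N.op (XT.rev x)), XT.ae_reflect (N.norm_le (XT.rev x)),
      XT.ae_reflect (XT.rev_ae x)] with t a b c
    rw [c, sub_sub_cancel] at b
    simpa [a] using b
  symm x y := by
    simp only [ContinuousLinearMap.comp_apply]
    rw [XT.inner_rev_left, N.symm, XT.inner_rev_left]

namespace EnergySpace

variable {H V : Type*} [NormedAddCommGroup H] [InnerProductSpace ℝ H]
  [NormedAddCommGroup V] [InnerProductSpace ℝ V] (E : EnergySpace H V) {T : ℝ}

/-- `u` is the weak solution of `u' + D*D u + N u = f`, `u(0) = u₀`, and `U` is its class in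
`L²(0,T; H)`. -/
def Fwd (N : Potential H T) (f : XT H T) (u₀ : H) (u : ℝ → H) (U : XT H T) : Prop :=
  ∃ z, E.ιX T z = U ∧ E.IsWeakSol T (f - N.op U) u₀ u z

/-- `p` is the weak solution of `-p' + D*D p + N p = k`, `p(T) = p_T`, and `P` is its class in
`L²(0,T; H)`. -/
def Bwd (N : Potential H T) (k : XT H T) (pT : H) (p : ℝ → H) (P : XT H T) : Prop :=
  E.Fwd N.reverse (XT.rev k) pT (fun t => p (T - t)) (XT.rev P)

variable {E} {N : Potential H T}

theorem Fwd.ae {f : XT H T} {u₀ : H} {u : ℝ → H} {U : XT H T} (h : E.Fwd N f u₀ u U) :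
    ∀ᵐ t ∂volume.restrict (Ioo (0 : ℝ) T), U t = u t := by
  obtain ⟨z, rfl, hz⟩ := h
  exact hz.ιX_ae

theorem Bwd.ae {f : XT H T} {u₀ : H} {u : ℝ → H} {U : XT H T} (h : E.Bwd N f u₀ u U) :
    ∀ᵐ t ∂volume.restrict (Ioo (0 : ℝ) T), U t = u t := by
  filter_upwards [XT.ae_reflect (Fwd.ae h), XT.ae_reflect (XT.rev_ae U)] with t a b
  rw [b] at a
  simpa using a

variable [CompleteSpace H] [CompleteSpace V]

theorem duality (hT : 0 ≤ T) {f k : XT H T} {u₀ pT : H} {u p : ℝ → H} {U P : XT H T}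
    (hu : E.Fwd N f u₀ u U) (hp : E.Bwd N k pT p P) :
    inner ℝ (u T) pT - inner ℝ u₀ (p 0) = inner ℝ f P - inner ℝ U k := by
  obtain ⟨z, rfl, hz⟩ := hu
  obtain ⟨y, hy, hy'⟩ := hp
  have h := hz.duality hT hy'
  simp only [sub_self] at h
  rw [h, hy, XT.rev_rev, map_sub, XT.rev_rev]
  simp only [Potential.reverse, ContinuousLinearMap.comp_apply, XT.rev_rev]
  rw [inner_sub_left, inner_sub_right, N.symm]
  ring

variable (E N)

theorem exists_fwd (hT : 0 ≤ T) (f : XT H T) (u₀ : H) : ∃ u U, E.Fwd N f u₀ u U := by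
  obtain ⟨u, z, h⟩ := E.exists_isWeakSol hT N.op N.bound_nonneg N.norm_le f u₀
  exact ⟨u, _, z, rfl, h⟩

theorem exists_bwd (hT : 0 ≤ T) (k : XT H T) (pT : H) : ∃ p P, E.Bwd N k pT p P := by
  obtain ⟨u, U, h⟩ := E.exists_fwd N.reverse hT (XT.rev k) pT
  refine ⟨fun t => u (T - t), XT.rev U, ?_⟩
  unfold Bwd
  simpa [XT.rev_rev] using h

variable {E N}

/-- Uniqueness of weak solutions, from the solvability of the dual problem. -/
theorem Fwd.unique_class (hT : 0 ≤ T) {f : XT H T} {u₀ : H} {u u' : ℝ → H} {U U' : XT H T}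
    (h : E.Fwd N f u₀ u U) (h' : E.Fwd N f u₀ u' U') : U = U' := by
  refine ext_inner_right ℝ fun k => ?_
  obtain ⟨p, P, hp⟩ := E.exists_bwd N hT k 0
  have h1 := duality hT h hp
  have h2 := duality hT h' hp
  rw [inner_zero_right] at h1 h2
  linarith

theorem Fwd.unique (hT : 0 < T) {f : XT H T} {u₀ : H} {u u' : ℝ → H} {U U' : XT H T}
    (h : E.Fwd N f u₀ u U) (h' : E.Fwd N f u₀ u' U') : EqOn u u' (Icc 0 T) := by
  have hU := h.unique_class hT.le h'
  subst hU
  have ha := h.ae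
  have ha' := h'.ae
  obtain ⟨z, -, hz⟩ := h
  obtain ⟨z', -, hz'⟩ := h'
  refine Measure.eqOn_Icc_of_ae_eq volume hT.ne ?_ hz.cont hz'.cont
  rw [← Measure.restrict_congr_set Ioo_ae_eq_Icc]
  filter_upwards [ha, ha'] with t a b
  rw [← a, b]

theorem Bwd.unique (hT : 0 < T) {f : XT H T} {u₀ : H} {u u' : ℝ → H} {U U' : XT H T}
    (h : E.Bwd N f u₀ u U) (h' : E.Bwd N f u₀ u' U') : EqOn u u' (Icc 0 T) := by
  intro t ht
  have := Fwd.unique hT h h' (show T - t ∈ Icc 0 T from ⟨by linarith [ht.2], by linarith [ht.1]⟩)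
  simpa using this

theorem Fwd.class_eq_zero (hT : 0 ≤ T) {u : ℝ → H} {U : XT H T} (h : E.Fwd N 0 0 u U) :
    U = 0 := by
  refine ext_inner_right ℝ fun k => ?_
  obtain ⟨p, P, hp⟩ := E.exists_bwd N hT k 0
  have h1 := duality hT h hp
  simp only [inner_zero_right, inner_zero_left] at h1 ⊢
  linarith

theorem Bwd.class_eq_zero (hT : 0 ≤ T) {u : ℝ → H} {U : XT H T} (h : E.Bwd N 0 0 u U) :
    U = 0 := by
  unfold Bwd at h
  rw [map_zero] at h
  rw [← XT.rev_rev U, h.class_eq_zero hT, map_zero]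

variable (E N)

/-- The solution operator with zero initial datum; its adjoint is the solution operator of the
backward problem with zero final datum. -/
theorem exists_solutionOperator (hT : 0 ≤ T) : ∃ S : XT H T →L[ℝ] XT H T,
    (∀ {f f' u₀ u u' U U'}, E.Fwd N f u₀ u U → E.Fwd N f' u₀ u' U' → U = S (f - f') + U') ∧
    (∀ {k k' pT p p' P P'}, E.Bwd N k pT p P → E.Bwd N k' pT p' P' →
      P = S.adjoint (k - k') + P') := by
  choose u U hU using fun f => E.exists_fwd N hT f 0
  choose p P hP using fun k => E.exists_bwd N hT k 0
  have hd : ∀ f k, inner ℝ (U f) k = inner ℝ f (P k) := by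
    intro f k
    have := duality hT (hU f) (hP k)
    rw [inner_zero_right, inner_zero_left] at this
    linarith
  let S₀ : XT H T →ₗ[ℝ] XT H T :=
    { toFun := U
      map_add' := fun f g => ext_inner_right ℝ fun k => by
        rw [inner_add_left, hd, hd, hd, inner_add_left]
      map_smul' := fun r f => ext_inner_right ℝ fun k => by
        rw [RingHom.id_apply, real_inner_smul_left, hd, hd, real_inner_smul_left] }
  -- Having an adjoint, `S₀` has a closed graph.
  have hc : Continuous S₀ := by
    refine LinearMap.continuous_of_seq_closed_graph _ fun f x y hf hy => ?_
    refine ext_inner_right ℝ fun k => ?_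
    have h1 : Tendsto (fun n => inner ℝ (U (f n)) k) atTop (𝓝 (inner ℝ y k)) :=
      Filter.Tendsto.inner hy tendsto_const_nhds
    have h2 : Tendsto (fun n => inner ℝ (f n) (P k)) atTop (𝓝 (inner ℝ x (P k))) :=
      hf.inner tendsto_const_nhds
    simp_rw [hd] at h1
    rw [tendsto_nhds_unique h1 h2]
    exact (hd x k).symm
  have hS : ∀ f k, inner ℝ ((⟨S₀, hc⟩ : XT H T →L[ℝ] XT H T) f) k = inner ℝ f (P k) := hd
  refine ⟨⟨S₀, hc⟩, fun {f f' u₀ u u' V V'} h h' => ?_, fun {k k' pT p p' V V'} h h' => ?_⟩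
  · refine ext_inner_right ℝ fun k => ?_
    have h1 := duality hT h (hP k)
    have h2 := duality hT h' (hP k)
    rw [inner_zero_right] at h1 h2
    rw [inner_add_left, hS, inner_sub_left]
    linarith
  · refine ext_inner_left ℝ fun f => ?_
    have h1 := duality hT (hU f) h
    have h2 := duality hT (hU f) h'
    rw [inner_zero_left] at h1 h2
    rw [inner_add_right, ContinuousLinearMap.adjoint_inner_right, inner_sub_right]
    change inner ℝ f V = (inner ℝ (U f) k - inner ℝ (U f) k') + _
    have h3 : inner ℝ (u f T) pT = inner ℝ f V - inner ℝ (U f) k := by linarith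
    linarith

end EnergySpace

/-- The zeroth order operators that couple the equations of the optimality system: `χ` is the
restriction to the observation region of the followers and `ρ i` is multiplication by
`σ⁻² χ_{ω_i} / μ_i`. -/
structure Coupling (H : Type*) [NormedAddCommGroup H] [InnerProductSpace ℝ H] (T : ℝ) where
  /-- the potential -/
  N : Potential H T
  /-- the restriction to the observation region -/
  χ : XT H T →L[ℝ] XT H T
  /-- the feedback of the followers -/
  ρ : Fin 2 → XT H T →L[ℝ] XT H T
  /-- the weights of the observations -/
  α : Fin 2 → ℝ
  α_nonneg : ∀ i, 0 ≤ α i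
  χ_symm : ∀ x y, inner ℝ (χ x) y = inner ℝ x (χ y)
  χ_idem : ∀ x, χ (χ x) = χ x
  ρ_symm : ∀ i x y, inner ℝ (ρ i x) y = inner ℝ x (ρ i y)
  ρ_nonneg : ∀ i x, 0 ≤ inner ℝ (ρ i x) x

namespace Coupling

variable {H V : Type*} [NormedAddCommGroup H] [InnerProductSpace ℝ H]
  [NormedAddCommGroup V] [InnerProductSpace ℝ V] {T : ℝ}
  (A : Coupling H T) (E : EnergySpace H V)

/-- The abstract adjoint system. -/
structure IsAdjoint (φT : H) (φ : ℝ → H) (Φ : XT H T) (ψ : Fin 2 → ℝ → H) (Ψ : Fin 2 → XT H T) :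
    Prop where
  backward : E.Bwd A.N (A.χ (∑ i, A.α i • Ψ i)) φT φ Φ
  forward : ∀ i, E.Fwd A.N (-A.ρ i Φ) 0 (ψ i) (Ψ i)

/-- The abstract optimality system. -/
structure IsOptimality (y₀ : H) (yd : Fin 2 → XT H T) (f : XT H T) (y : ℝ → H) (Y : XT H T)
    (q : Fin 2 → ℝ → H) (Q : Fin 2 → XT H T) : Prop where
  state : E.Fwd A.N (f - ∑ i, A.ρ i (Q i)) y₀ y Y
  costate : ∀ i, E.Bwd A.N (A.α i • (A.χ Y - yd i)) 0 (q i) (Q i)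

/-- The total feedback `∑ α_i ρ_i`. -/
def fb : XT H T →L[ℝ] XT H T := ∑ i, A.α i • A.ρ i

theorem fb_apply (x : XT H T) : A.fb x = ∑ i, A.α i • A.ρ i x := by
  simp [fb]

theorem fb_nonneg (x : XT H T) : 0 ≤ inner ℝ (A.fb x) x := by
  rw [fb_apply, sum_inner]
  refine Finset.sum_nonneg fun i _ => ?_
  rw [real_inner_smul_left]
  exact mul_nonneg (A.α_nonneg i) (A.ρ_nonneg i x)

variable [CompleteSpace H]

/-- The coupled systems reduce to an equation for a function `u` supported in the observation
region, with the operator `1 + χ S ρ S* χ`; it is coercive because `ρ` is nonnegative. -/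
theorem exists_solve (S : XT H T →L[ℝ] XT H T) (g : XT H T) :
    ∃ u, A.χ u = u ∧ u + A.χ (S (A.fb (S.adjoint u))) = A.χ g := by
  let Q : XT H T →L[ℝ] XT H T :=
    ContinuousLinearMap.id ℝ _ + A.χ ∘L S ∘L A.fb ∘L S.adjoint ∘L A.χ
  have hQ : ∀ v, Q v = v + A.χ (S (A.fb (S.adjoint (A.χ v)))) := fun v => rfl
  obtain ⟨R, hR⟩ := exists_inverse_of_coercive Q one_pos fun v => by
    rw [hQ, inner_add_left, A.χ_symm, ← ContinuousLinearMap.adjoint_inner_right,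
      real_inner_self_eq_norm_sq]
    have := A.fb_nonneg (S.adjoint (A.χ v))
    linarith
  have h1 := hR (A.χ g)
  rw [hQ] at h1
  have h2 : A.χ (R (A.χ g)) = R (A.χ g) := by
    have e := eq_sub_of_add_eq h1
    rw [e]
    simp only [map_sub, A.χ_idem]
  refine ⟨_, h2, ?_⟩
  rw [h2] at h1
  exact h1

variable {A E} [CompleteSpace V]

/-- Transposition of the optimality system against the adjoint system. -/
theorem inner_final_eq (hT : 0 ≤ T) {y₀ φT : H} {yd : Fin 2 → XT H T} {f Y Φ : XT H T}
    {y φ : ℝ → H} {q ψ : Fin 2 → ℝ → H} {Q Ψ : Fin 2 → XT H T}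
    (ho : A.IsOptimality E y₀ yd f y Y q Q) (ha : A.IsAdjoint E φT φ Φ ψ Ψ) :
    inner ℝ (y T) φT = inner ℝ y₀ (φ 0) + inner ℝ f Φ - ∑ i, A.α i * inner ℝ (yd i) (Ψ i) := by
  have h1 := EnergySpace.duality hT ho.state ha.backward
  have h2 := fun i => EnergySpace.duality hT (ha.forward i) (ho.costate i)
  simp only [inner_zero_right, inner_zero_left, sub_self, inner_neg_left, real_inner_smul_right,
    inner_sub_right] at h2
  rw [inner_sub_left, sum_inner, ← A.χ_symm, inner_sum] at h1
  simp only [real_inner_smul_right] at h1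
  have h3 : ∀ i, inner ℝ (A.ρ i (Q i)) Φ + A.α i * inner ℝ (A.χ Y) (Ψ i)
      = A.α i * inner ℝ (yd i) (Ψ i) := by
    intro i
    have := h2 i
    rw [A.ρ_symm, real_inner_comm, real_inner_comm (Ψ i), real_inner_comm (Ψ i) (yd i)]
    linarith
  have h4 : ∑ i, inner ℝ (A.ρ i (Q i)) Φ + ∑ i, A.α i * inner ℝ (A.χ Y) (Ψ i)
      = ∑ i, A.α i * inner ℝ (yd i) (Ψ i) := by
    rw [← Finset.sum_add_distrib]
    exact Finset.sum_congr rfl fun i _ => h3 i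
  linarith

variable (A E)

theorem exists_isAdjoint (hT : 0 ≤ T) (φT : H) : ∃ φ Φ ψ Ψ, A.IsAdjoint E φT φ Φ ψ Ψ := by
  obtain ⟨S, hS, hS'⟩ := E.exists_solutionOperator A.N hT
  obtain ⟨φ₀, Φ₀, h₀⟩ := E.exists_bwd A.N hT 0 φT
  obtain ⟨z, Z, hz⟩ := E.exists_fwd A.N hT 0 0
  have hZ : Z = 0 := hz.class_eq_zero hT
  -- `u` stands for the source `χ (∑ α_i ψ_i)` of the backward equation.
  obtain ⟨u, hu, hu'⟩ := A.exists_solve S (-S (A.fb Φ₀))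
  obtain ⟨φ, Φ, h⟩ := E.exists_bwd A.N hT u φT
  choose ψ Ψ hΨ using fun i => E.exists_fwd A.N hT (-A.ρ i Φ) 0
  refine ⟨φ, Φ, ψ, Ψ, ?_, hΨ⟩
  have hΦ : Φ = S.adjoint u + Φ₀ := by simpa using hS' h h₀
  have hΨ' : ∀ i, Ψ i = -S (A.ρ i Φ) := fun i => by simpa [hZ] using hS (hΨ i) hz
  have e : A.χ (∑ i, A.α i • Ψ i) = u := by
    have e1 : ∑ i, A.α i • Ψ i = -S (A.fb Φ) := by
      simp only [hΨ', smul_neg, Finset.sum_neg_distrib, fb_apply, map_sum, map_smul]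
    rw [e1, hΦ, map_add, map_add, neg_add, map_add, ← hu', map_neg]
    abel
  rw [e]
  exact h

theorem exists_isOptimality (hT : 0 ≤ T) (y₀ : H) (yd : Fin 2 → XT H T) (f : XT H T) :
    ∃ y Y q Q, A.IsOptimality E y₀ yd f y Y q Q := by
  obtain ⟨S, hS, hS'⟩ := E.exists_solutionOperator A.N hT
  obtain ⟨y₁, Y₁, h₁⟩ := E.exists_fwd A.N hT 0 y₀
  obtain ⟨z, Z, hz⟩ := E.exists_bwd A.N hT 0 0
  have hZ : Z = 0 := hz.class_eq_zero hT
  set d : XT H T := ∑ i, A.α i • A.ρ i (S.adjoint (yd i)) with hd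
  -- `u` stands for the observed state `χ Y`.
  obtain ⟨u, hu, hu'⟩ := A.exists_solve S (S (f + d) + Y₁)
  obtain ⟨y, Y, h⟩ := E.exists_fwd A.N hT (f + d - A.fb (S.adjoint u)) y₀
  choose q Q hQ using fun i => E.exists_bwd A.N hT (A.α i • (u - yd i)) 0
  have hQ' : ∀ i, Q i = A.α i • (S.adjoint u - S.adjoint (yd i)) := fun i => by
    simpa [hZ] using hS' (hQ i) hz
  have hY : A.χ Y = u := by
    have := hS h h₁
    rw [this, sub_zero, map_sub, sub_add_eq_add_sub, map_sub, ← hu']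
    abel
  refine ⟨y, Y, q, Q, ?_, fun i => ?_⟩
  · have e : f - ∑ i, A.ρ i (Q i) = f + d - A.fb (S.adjoint u) := by
      simp only [hQ', map_smul, map_sub, smul_sub, Finset.sum_sub_distrib, fb_apply, hd]
      abel
    rw [e]
    exact h
  · rw [hY]
    exact hQ i

variable {A E}

theorem IsAdjoint.unique (hT : 0 < T) {φT : H} {Φ Φ' : XT H T} {φ φ' : ℝ → H}
    {ψ ψ' : Fin 2 → ℝ → H} {Ψ Ψ' : Fin 2 → XT H T}
    (h : A.IsAdjoint E φT φ Φ ψ Ψ) (h' : A.IsAdjoint E φT φ' Φ' ψ' Ψ') :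
    EqOn φ' φ (Icc 0 T) ∧ ∀ i, EqOn (ψ' i) (ψ i) (Icc 0 T) := by
  obtain ⟨S, hS, hS'⟩ := E.exists_solutionOperator A.N hT.le
  obtain ⟨z, Z, hz⟩ := E.exists_fwd A.N hT.le 0 0
  set D := Φ - Φ' with hD
  set Δ := ∑ i, A.α i • Ψ i - ∑ i, A.α i • Ψ' i with hΔ
  have h1 : D = S.adjoint (A.χ Δ) := by
    rw [hD, hS' h.backward h'.backward, hΔ, map_sub A.χ, add_sub_cancel_right]
  have h2 : Δ = -S (A.fb D) := by
    have e : ∀ i, Ψ i - Ψ' i = -S (A.ρ i D) := fun i => by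
      rw [hS (h.forward i) hz, hS (h'.forward i) hz, hD]
      simp only [map_sub, map_neg, sub_zero]
      abel
    rw [hΔ, ← Finset.sum_sub_distrib, fb_apply, map_sum, ← Finset.sum_neg_distrib]
    refine Finset.sum_congr rfl fun i _ => ?_
    rw [← smul_sub, e, map_smul, smul_neg]
  -- `‖χ Δ‖² = -⟪ρ D, D⟫ ≤ 0`.
  have h3 : A.χ Δ = 0 := by
    have e1 : inner ℝ (A.χ Δ) (A.χ Δ) = -inner ℝ (A.fb D) D := by
      rw [A.χ_symm, A.χ_idem]
      nth_rw 1 [h2]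
      rw [inner_neg_left, ← ContinuousLinearMap.adjoint_inner_right, ← h1]
    have e2 := A.fb_nonneg D
    have e3 := real_inner_self_nonneg (x := A.χ Δ)
    exact inner_self_eq_zero.mp (le_antisymm (by linarith) e3)
  have h4 : Φ = Φ' := by
    rw [← sub_eq_zero, ← hD, h1, h3, map_zero]
  have h5 : A.χ (∑ i, A.α i • Ψ i) = A.χ (∑ i, A.α i • Ψ' i) := by
    rw [← sub_eq_zero, ← map_sub, ← hΔ, h3]
  refine ⟨EnergySpace.Bwd.unique hT h'.backward (h5 ▸ h.backward), fun i => ?_⟩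
  exact EnergySpace.Fwd.unique hT (h'.forward i) (h4 ▸ h.forward i)

end Coupling

/-! ### The degenerate coefficient -/

theorem restrict_Ioo_diff_singleton (x₀ : ℝ) :
    (volume : Measure ℝ).restrict (Ioo 0 1 \ {x₀}) = volume.restrict (Ioo 0 1) :=
  Measure.restrict_congr_set (sdiff_null_ae_eq_self (measure_singleton x₀))

theorem ae_mem_Ioo_diff (x₀ : ℝ) :
    ∀ᵐ x ∂volume.restrict (Ioo (0 : ℝ) 1), x ∈ Ioo (0 : ℝ) 1 \ {x₀} := by
  rw [← restrict_Ioo_diff_singleton x₀]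
  exact ae_restrict_mem (measurableSet_Ioo.diff (measurableSet_singleton x₀))

theorem isOpen_Ioo_diff (x₀ : ℝ) : IsOpen (Ioo (0 : ℝ) 1 \ {x₀}) :=
  isOpen_Ioo.sdiff isClosed_singleton

/-- A differential inequality `y b' ≤ K b` bounds `b` from below by a power. -/
theorem rpow_le_of_slope {b b' : ℝ → ℝ} {L K : ℝ} (hL : 0 < L) (hc : ContinuousOn b (Ioc 0 L))
    (hd : ∀ y ∈ Ioo 0 L, HasDerivAt b (b' y) y) (hs : ∀ y ∈ Ioo 0 L, y * b' y ≤ K * b y)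
    {y : ℝ} (hy : y ∈ Ioc 0 L) : L ^ (-K) * b L * y ^ K ≤ b y := by
  have hanti : AntitoneOn (fun y => y ^ (-K) * b y) (Ioc 0 L) := by
    have hder : ∀ y ∈ Ioo 0 L, HasDerivAt (fun y => y ^ (-K) * b y)
        ((-K) * y ^ (-K - 1) * b y + y ^ (-K) * b' y) y := fun y hy =>
      (Real.hasDerivAt_rpow_const (Or.inl hy.1.ne')).mul (hd y hy)
    refine antitoneOn_of_deriv_nonpos (convex_Ioc 0 L) ?_ ?_ ?_
    · refine ContinuousOn.mul (fun y hy => ?_) hc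
      exact (Real.continuousAt_rpow_const _ _ (Or.inl hy.1.ne')).continuousWithinAt
    · rw [interior_Ioc]
      exact fun y hy => (hder y hy).differentiableAt.differentiableWithinAt
    · rw [interior_Ioc]
      intro y hy
      rw [(hder y hy).deriv]
      have e : y ^ (-K) = y ^ (-K - 1) * y := by
        rw [← Real.rpow_add_one hy.1.ne']; ring_nf
      have h1 := hs y hy
      have h2 : 0 ≤ y ^ (-K - 1) := Real.rpow_nonneg hy.1.le _
      rw [e]
      nlinarith
  have h1 := hanti hy ⟨hL, le_rfl⟩ hy.2
  simp only at h1
  have h2 : 0 < y ^ K := Real.rpow_pos_of_pos hy.1 K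
  rw [Real.rpow_neg hy.1.le] at h1
  calc L ^ (-K) * b L * y ^ K ≤ ((y ^ K)⁻¹ * b y) * y ^ K := by gcongr
    _ = b y := by field_simp

namespace IsDegenerate

variable {d : Degeneracy} {a : ℝ → ℝ} {x₀ K : ℝ}

theorem continuousOn (h : IsDegenerate d a x₀ K) : ContinuousOn a (Icc 0 1 \ {x₀}) :=
  h.contDiffOn.continuousOn

theorem nonneg (h : IsDegenerate d a x₀ K) {x : ℝ} (hx : x ∈ Icc (0 : ℝ) 1) : 0 ≤ a x := by
  by_cases hx' : x = x₀
  · rw [hx', h.zero]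
  · exact (h.pos x ⟨hx, hx'⟩).le

theorem hasDerivAt (h : IsDegenerate d a x₀ K) {x : ℝ} (hx : x ∈ Ioo (0 : ℝ) 1 \ {x₀}) :
    HasDerivAt a (derivWithin a (Icc 0 1) x) x := by
  have hn : Icc (0 : ℝ) 1 \ {x₀} ∈ 𝓝 x :=
    mem_of_superset ((isOpen_Ioo_diff x₀).mem_nhds hx)
      (sdiff_subset_sdiff_left Ioo_subset_Icc_self)
  have hd : DifferentiableAt ℝ a x := (h.contDiffOn.contDiffAt hn).differentiableAt (by simp)
  rw [derivWithin_of_mem_nhds (mem_of_superset hn sdiff_subset)]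
  exact hd.hasDerivAt

theorem aestronglyMeasurable_inv_sqrt (h : IsDegenerate d a x₀ K) :
    AEStronglyMeasurable (fun y => (√(a y))⁻¹) (volume.restrict (Ioo (0 : ℝ) 1)) := by
  rw [← restrict_Ioo_diff_singleton x₀]
  refine ContinuousOn.aestronglyMeasurable ?_ (isOpen_Ioo_diff x₀).measurableSet
  refine ContinuousOn.inv₀ (h.continuousOn.mono
    (sdiff_subset_sdiff_left Ioo_subset_Icc_self)).sqrt fun x hx => ?_
  exact (Real.sqrt_pos.mpr (h.pos x ⟨Ioo_subset_Icc_self hx.1, hx.2⟩)).ne'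

/-- Away from the degeneracy point, `1 / √a` is bounded. -/
theorem memLp_inv_sqrt_indicator (h : IsDegenerate d a x₀ K) {c e : ℝ}
    (hs : Icc c e ⊆ Icc 0 1 \ {x₀}) :
    MemLp ((Ioc c e).indicator fun y => (√(a y))⁻¹) 2 (volume.restrict (Ioo (0 : ℝ) 1)) := by
  have hc : ContinuousOn (fun y => (√(a y))⁻¹) (Icc c e) :=
    ContinuousOn.inv₀ (h.continuousOn.mono hs).sqrt fun x hx =>
      (Real.sqrt_pos.mpr (h.pos x (hs hx))).ne'
  obtain ⟨C, hC⟩ := isCompact_Icc.exists_bound_of_continuousOn hc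
  refine MemLp.of_bound (h.aestronglyMeasurable_inv_sqrt.indicator measurableSet_Ioc) (max C 0)
    (Eventually.of_forall fun x => ?_)
  by_cases hx : x ∈ Ioc c e
  · rw [indicator_of_mem hx]
    exact (hC x (Ioc_subset_Icc_self hx)).trans (le_max_left _ _)
  · rw [indicator_of_notMem hx, norm_zero]
    exact le_max_right _ _

/-- In the weakly degenerate case, `1 / a` is integrable, since `a` is bounded from below by a
multiple of `|x - x₀| ^ K` with `K < 1`. -/
theorem intervalIntegrable_inv (h : IsDegenerate .weak a x₀ K) :
    IntervalIntegrable (fun y => (a y)⁻¹) volume 0 1 := by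
  obtain ⟨hx0, hx1⟩ := h.point_mem
  obtain ⟨hK0, hK1⟩ := h.exponent
  have hmeas : ∀ c e, 0 ≤ c → e ≤ 1 → c ≤ e →
      AEStronglyMeasurable (fun y => (a y)⁻¹) (volume.restrict (uIoc c e)) := by
    intro c e hc he hce
    rw [uIoc_of_le hce, ← restrict_Ioo_eq_restrict_Ioc]
    refine AEStronglyMeasurable.mono_measure ?_
      (Measure.restrict_mono (Ioo_subset_Ioo hc he) le_rfl)
    rw [← restrict_Ioo_diff_singleton x₀]
    refine ContinuousOn.aestronglyMeasurable ?_ (isOpen_Ioo_diff x₀).measurableSet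
    refine ContinuousOn.inv₀ (h.continuousOn.mono
      (sdiff_subset_sdiff_left Ioo_subset_Icc_self)) fun x hx => ?_
    exact (h.pos x ⟨Ioo_subset_Icc_self hx.1, hx.2⟩).ne'
  have inv_bound : ∀ {m r b : ℝ}, 0 < m → 0 < r → m * r ^ K ≤ b → ‖b⁻¹‖ ≤ m⁻¹ * r ^ (-K) := by
    intro m r b hm hr hb
    have h1 : 0 < r ^ K := Real.rpow_pos_of_pos hr K
    have h2 : 0 < b := lt_of_lt_of_le (by positivity) hb
    rw [norm_inv, Real.norm_of_nonneg h2.le, Real.rpow_neg hr.le, ← mul_inv]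
    exact inv_anti₀ (by positivity) hb
  have left : IntervalIntegrable (fun y => (a y)⁻¹) volume 0 x₀ := by
    set m := x₀ ^ (-K) * a 0 with hm
    have ha0 : 0 < a 0 := h.pos 0 ⟨⟨le_rfl, zero_le_one⟩, hx0.ne⟩
    have hmp : 0 < m := mul_pos (Real.rpow_pos_of_pos hx0 _) ha0
    have hint : IntervalIntegrable (fun y => m⁻¹ * (x₀ - y) ^ (-K)) volume 0 x₀ := by
      have := (intervalIntegral.intervalIntegrable_rpow' (a := x₀) (b := 0)
        (r := -K) (by linarith)).comp_sub_left x₀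
      simp only [sub_self, sub_zero] at this
      exact this.const_mul _
    refine hint.mono_fun' (hmeas _ _ le_rfl hx1.le hx0.le) ?_
    rw [uIoc_of_le hx0.le, ← restrict_Ioo_eq_restrict_Ioc]
    filter_upwards [ae_restrict_mem measurableSet_Ioo] with x hx
    refine inv_bound hmp (by linarith [hx.2]) ?_
    have := rpow_le_of_slope (b := fun y => a (x₀ - y))
      (b' := fun y => -derivWithin a (Icc 0 1) (x₀ - y)) (K := K) hx0 ?_ ?_ ?_
      (y := x₀ - x) ⟨by linarith [hx.2], by linarith [hx.1]⟩
    · simpa using this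
    · refine h.continuousOn.comp (by fun_prop) fun y hy => ?_
      exact ⟨⟨by linarith [hy.2], by linarith [hy.1]⟩, by simp [hy.1.ne']⟩
    · intro y hy
      have h1 := h.hasDerivAt (x := x₀ - y) ⟨⟨by linarith [hy.2], by linarith [hy.1]⟩,
        by simp [hy.1.ne']⟩
      have h2 := h1.comp y ((hasDerivAt_id y).const_sub x₀)
      rwa [mul_neg, mul_one] at h2
    · intro y hy
      have h1 := h.slope (x₀ - y) ⟨⟨by linarith [hy.2], by linarith [hy.1]⟩,
        by simp [hy.1.ne']⟩
      linarith
  have right : IntervalIntegrable (fun y => (a y)⁻¹) volume x₀ 1 := by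
    set m := (1 - x₀) ^ (-K) * a 1 with hm
    have ha1 : 0 < a 1 := h.pos 1 ⟨⟨zero_le_one, le_rfl⟩, hx1.ne'⟩
    have hL : 0 < 1 - x₀ := by linarith
    have hmp : 0 < m := mul_pos (Real.rpow_pos_of_pos hL _) ha1
    have hint : IntervalIntegrable (fun y => m⁻¹ * (y - x₀) ^ (-K)) volume x₀ 1 := by
      have := (intervalIntegral.intervalIntegrable_rpow' (a := 0) (b := 1 - x₀)
        (r := -K) (by linarith)).comp_sub_right x₀
      simp only [zero_add, sub_add_cancel] at this
      exact this.const_mul _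
    refine hint.mono_fun' (hmeas _ _ hx0.le le_rfl hx1.le) ?_
    rw [uIoc_of_le hx1.le, ← restrict_Ioo_eq_restrict_Ioc]
    filter_upwards [ae_restrict_mem measurableSet_Ioo] with x hx
    refine inv_bound hmp (by linarith [hx.1]) ?_
    have := rpow_le_of_slope (b := fun y => a (x₀ + y))
      (b' := fun y => derivWithin a (Icc 0 1) (x₀ + y)) (K := K) hL ?_ ?_ ?_
      (y := x - x₀) ⟨by linarith [hx.1], by linarith [hx.2]⟩
    · simpa using this
    · refine h.continuousOn.comp (by fun_prop) fun y hy => ?_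
      exact ⟨⟨by linarith [hy.1], by linarith [hy.2]⟩, by simp [hy.1.ne']⟩
    · intro y hy
      have h1 := h.hasDerivAt (x := x₀ + y) ⟨⟨by linarith [hy.1], by linarith [hy.2]⟩,
        by simp [hy.1.ne']⟩
      have h2 := h1.comp y ((hasDerivAt_id y).const_add x₀)
      rwa [mul_one] at h2
    · intro y hy
      have h1 := h.slope (x₀ + y) ⟨⟨by linarith [hy.1], by linarith [hy.2]⟩,
        by simp [hy.1.ne']⟩
      rwa [add_sub_cancel_left] at h1
  exact left.trans right

theorem memLp_inv_sqrt (h : IsDegenerate .weak a x₀ K) :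
    MemLp ((Ioc 0 1).indicator fun y => (√(a y))⁻¹) 2 (volume.restrict (Ioo (0 : ℝ) 1)) := by
  have hm := h.aestronglyMeasurable_inv_sqrt.indicator (s := Ioc (0 : ℝ) 1) measurableSet_Ioc
  rw [memLp_two_iff_integrable_sq hm]
  have h1 := h.intervalIntegrable_inv
  rw [intervalIntegrable_iff_integrableOn_Ioo_of_le zero_le_one] at h1
  refine Integrable.congr h1 ?_
  filter_upwards [ae_restrict_mem measurableSet_Ioo] with x hx
  rw [indicator_of_mem (Ioo_subset_Ioc_self hx), inv_pow,
    Real.sq_sqrt (h.nonneg (Ioo_subset_Icc_self hx))]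

end IsDegenerate

/-- The function `1 / √a` restricted to a set, as an element of `L²(0,1)`; zero where this makes no
sense. -/
def invSqrtOn (a : ℝ → ℝ) (s : Set ℝ) : L2I :=
  open Classical in
  if hm : MemLp (s.indicator fun y => (√(a y))⁻¹) 2 (volume.restrict (Ioo (0 : ℝ) 1)) then
    hm.toLp else 0

theorem invSqrtOn_ae {a : ℝ → ℝ} {s : Set ℝ}
    (hm : MemLp (s.indicator fun y => (√(a y))⁻¹) 2 (volume.restrict (Ioo (0 : ℝ) 1))) :
    ∀ᵐ x ∂volume.restrict (Ioo (0 : ℝ) 1),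
      invSqrtOn a s x = s.indicator (fun y => (√(a y))⁻¹) x := by
  rw [invSqrtOn, dif_pos hm]
  exact hm.coeFn_toLp

/-- Integrability of `g / √a`, and its integral as an inner product. -/
theorem inner_invSqrtOn {a : ℝ → ℝ} {c e : ℝ} (hc : 0 ≤ c) (hce : c ≤ e) (he : e ≤ 1)
    (hm : MemLp ((Ioc c e).indicator fun y => (√(a y))⁻¹) 2 (volume.restrict (Ioo (0 : ℝ) 1)))
    (g : L2I) : IntervalIntegrable (fun y => (√(a y))⁻¹ * g y) volume c e ∧
      inner ℝ (invSqrtOn a (Ioc c e)) g = ∫ y in c..e, (√(a y))⁻¹ * g y := by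
  have hi := L2.integrable_inner (𝕜 := ℝ) (invSqrtOn a (Ioc c e)) g
  have hcongr : (fun x => inner ℝ (invSqrtOn a (Ioc c e) x) (g x))
      =ᵐ[volume.restrict (Ioo (0 : ℝ) 1)]
      (Ioc c e).indicator fun y => (√(a y))⁻¹ * g y := by
    filter_upwards [invSqrtOn_ae hm] with x hx
    rw [hx, indicator_mul_left]
    simp [mul_comm]
  have hsub : volume.restrict (Ioc c e) = (volume.restrict (Ioo (0 : ℝ) 1)).restrict (Ioc c e) := by
    rw [restrict_Ioo_eq_restrict_Ioc, Measure.restrict_restrict measurableSet_Ioc,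
      inter_eq_left.mpr (Ioc_subset_Ioc hc he)]
  constructor
  · rw [intervalIntegrable_iff_integrableOn_Ioc_of_le hce, IntegrableOn, hsub]
    have := hi.congr hcongr
    rwa [integrable_indicator_iff measurableSet_Ioc] at this
  · rw [L2.inner_def, integral_congr_ae hcongr, integral_indicator measurableSet_Ioc, ← hsub,
      intervalIntegral.integral_of_le hce]

/-! ### The degenerate energy space -/

theorem absolutelyContinuousOnInterval_congr {f g : ℝ → ℝ} {c e : ℝ}
    (hf : AbsolutelyContinuousOnInterval f c e) (hfg : EqOn f g (uIcc c e)) :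
    AbsolutelyContinuousOnInterval g c e := by
  rw [absolutelyContinuousOnInterval_iff] at hf ⊢
  intro ε hε
  obtain ⟨δ, hδ, h⟩ := hf ε hε
  refine ⟨δ, hδ, fun E hE hlt => ?_⟩
  rw [← Finset.sum_congr rfl fun i hi => ?_]
  · exact h E hE hlt
  · rw [hfg (hE.1 i hi).1, hfg (hE.1 i hi).2]

theorem ACRegular.left {d : Degeneracy} {x₀ : ℝ} {w : ℝ → ℝ} (h : ACRegular d x₀ w)
    (hx₀ : x₀ ∈ Ioo (0 : ℝ) 1) {x : ℝ} (hx : x ∈ Ico 0 x₀) :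
    AbsolutelyContinuousOnInterval w 0 x := by
  cases d with
  | weak =>
    refine AbsolutelyContinuousOnInterval.mono h ?_
    rw [uIcc_of_le hx.1, uIcc_of_le zero_le_one]
    exact Icc_subset_Icc_right (hx.2.le.trans hx₀.2.le)
  | strong => exact h.1 x hx

theorem ACRegular.right {d : Degeneracy} {x₀ : ℝ} {w : ℝ → ℝ} (h : ACRegular d x₀ w)
    (hx₀ : x₀ ∈ Ioo (0 : ℝ) 1) {x : ℝ} (hx : x ∈ Ioc x₀ 1) :
    AbsolutelyContinuousOnInterval w x 1 := by
  cases d with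
  | weak =>
    refine AbsolutelyContinuousOnInterval.mono h ?_
    rw [uIcc_of_le hx.2, uIcc_of_le zero_le_one]
    exact Icc_subset_Icc_left (hx₀.1.le.trans hx.1.le)
  | strong => exact h.2 x hx

/-- The representing vector of the evaluation `g ↦ w(x)`, where `w` vanishes at `0` and `1` and
`√a w' = g`; the integral of `w'` is taken from the end point on the same side of `x₀` as `x`. -/
def evalKernel (a : ℝ → ℝ) (x₀ x : ℝ) : L2I :=
  if x < x₀ then invSqrtOn a (Ioc 0 x) else -invSqrtOn a (Ioc x 1)

namespace IsDegenerate

variable {d : Degeneracy} {a : ℝ → ℝ} {x₀ K : ℝ}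

theorem left_subset (h : IsDegenerate d a x₀ K) {x : ℝ} (hx : x ∈ Ico 0 x₀) :
    Icc 0 x ⊆ Icc 0 1 \ {x₀} := fun _ hy =>
  ⟨⟨hy.1, hy.2.trans (hx.2.le.trans h.point_mem.2.le)⟩, (hy.2.trans_lt hx.2).ne⟩

theorem right_subset (h : IsDegenerate d a x₀ K) {x : ℝ} (hx : x ∈ Ioc x₀ 1) :
    Icc x 1 ⊆ Icc 0 1 \ {x₀} := fun _ hy =>
  ⟨⟨h.point_mem.1.le.trans (hx.1.le.trans hy.1), hy.2⟩, (hx.1.trans_le hy.1).ne'⟩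

theorem evalKernel_left (h : IsDegenerate d a x₀ K) {x : ℝ} (hx : x ∈ Ico 0 x₀) (g : L2I) :
    IntervalIntegrable (fun y => (√(a y))⁻¹ * g y) volume 0 x ∧
      inner ℝ (evalKernel a x₀ x) g = ∫ y in (0 : ℝ)..x, (√(a y))⁻¹ * g y := by
  rw [evalKernel, if_pos hx.2]
  exact inner_invSqrtOn le_rfl hx.1 (hx.2.le.trans h.point_mem.2.le)
    (h.memLp_inv_sqrt_indicator (h.left_subset hx)) g

theorem evalKernel_right (h : IsDegenerate d a x₀ K) {x : ℝ} (hx : x ∈ Ioc x₀ 1) (g : L2I) :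
    IntervalIntegrable (fun y => (√(a y))⁻¹ * g y) volume x 1 ∧
      inner ℝ (evalKernel a x₀ x) g = -∫ y in x..1, (√(a y))⁻¹ * g y := by
  rw [evalKernel, if_neg hx.1.le.not_gt, inner_neg_left]
  have := inner_invSqrtOn (h.point_mem.1.le.trans hx.1.le) hx.2 le_rfl
    (h.memLp_inv_sqrt_indicator (h.right_subset hx)) g
  exact ⟨this.1, by rw [this.2]⟩

theorem evalKernel_one (h : IsDegenerate .weak a x₀ K) (g : L2I) :
    IntervalIntegrable (fun y => (√(a y))⁻¹ * g y) volume 0 1 ∧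
      inner ℝ (invSqrtOn a (Ioc 0 1)) g = ∫ y in (0 : ℝ)..1, (√(a y))⁻¹ * g y :=
  inner_invSqrtOn le_rfl zero_le_one le_rfl h.memLp_inv_sqrt g

theorem sub_eq_integral (h : IsDegenerate d a x₀ K) {w : ℝ → ℝ} {g : L2I}
    (hg : ∀ᵐ x ∂volume.restrict (Ioo (0 : ℝ) 1), g x = √(a x) * deriv w x) {c e : ℝ}
    (hc : 0 ≤ c) (hce : c ≤ e) (he : e ≤ 1) (hw : AbsolutelyContinuousOnInterval w c e) :
    w e - w c = ∫ y in c..e, (√(a y))⁻¹ * g y := by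
  rw [← hw.integral_deriv_eq_sub]
  refine XT.interval_congr (T := 1) ?_ ⟨hc, hce.trans he⟩ ⟨hc.trans hce, he⟩
  filter_upwards [hg, ae_mem_Ioo_diff x₀] with x hx hx'
  have := Real.sqrt_pos.mpr (h.pos x ⟨Ioo_subset_Icc_self hx'.1, hx'.2⟩)
  rw [hx, inv_mul_cancel_left₀ this.ne']

theorem flux_eq (h : IsDegenerate d a x₀ K) {w : ℝ → ℝ} {g : L2I}
    (hw : ∀ᵐ x ∂volume.restrict (Ioo (0 : ℝ) 1), HasDerivAt w ((√(a x))⁻¹ * g x) x) :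
    ∀ᵐ x ∂volume.restrict (Ioo (0 : ℝ) 1), g x = √(a x) * deriv w x := by
  filter_upwards [hw, ae_mem_Ioo_diff x₀] with x hx hx'
  have := Real.sqrt_pos.mpr (h.pos x ⟨Ioo_subset_Icc_self hx'.1, hx'.2⟩)
  rw [hx.deriv, mul_inv_cancel_left₀ this.ne']

/-- Membership in `H¹_a` and the flux, in terms of bounded functionals of the flux. Integrating
`w' = g / √a` from the nearer of the end points `0` and `1` gives `w` off `x₀`; in the weakly
degenerate case the two primitives have to match at `x₀`, which is the second condition. -/
theorem hasSqrtFlux_iff (h : IsDegenerate d a x₀ K) (z g : L2I) :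
    HasSqrtFlux d a x₀ z g ↔
      (∀ᵐ x ∂volume.restrict (Ioo (0 : ℝ) 1), z x = inner ℝ (evalKernel a x₀ x) g) ∧
        (d = .weak → inner ℝ (invSqrtOn a (Ioc 0 1)) g = 0) := by
  have hx₀ := h.point_mem
  constructor
  · rintro ⟨w, hz, hac, hw0, hw1, hg⟩
    constructor
    · filter_upwards [hz, ae_mem_Ioo_diff x₀] with x hx hx'
      rw [hx]
      rcases lt_or_gt_of_ne (show x ≠ x₀ from hx'.2) with hlt | hgt
      · have hm : x ∈ Ico 0 x₀ := ⟨hx'.1.1.le, hlt⟩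
        rw [(h.evalKernel_left hm g).2,
          ← h.sub_eq_integral hg le_rfl hm.1 hx'.1.2.le (hac.left hx₀ hm), hw0, sub_zero]
      · have hm : x ∈ Ioc x₀ 1 := ⟨hgt, hx'.1.2.le⟩
        rw [(h.evalKernel_right hm g).2,
          ← h.sub_eq_integral hg hx'.1.1.le hm.2 le_rfl (hac.right hx₀ hm), hw1, zero_sub, neg_neg]
    · rintro rfl
      rw [(h.evalKernel_one g).2, ← h.sub_eq_integral hg le_rfl zero_le_one le_rfl hac, hw0, hw1,
        sub_zero]
  · rintro ⟨hz, hone⟩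
    cases d with
    | weak =>
      obtain ⟨hi, he⟩ := h.evalKernel_one g
      rw [hone rfl] at he
      refine ⟨fun x => ∫ y in (0 : ℝ)..x, (√(a y))⁻¹ * g y, ?_,
        hi.absolutelyContinuousOnInterval_intervalIntegral left_mem_uIcc,
        intervalIntegral.integral_same, he.symm, ?_⟩
      · filter_upwards [hz, ae_mem_Ioo_diff x₀] with x hx hx'
        rw [hx]
        rcases lt_or_gt_of_ne (show x ≠ x₀ from hx'.2) with hlt | hgt
        · rw [(h.evalKernel_left ⟨hx'.1.1.le, hlt⟩ g).2]
        · rw [(h.evalKernel_right ⟨hgt, hx'.1.2.le⟩ g).2, neg_eq_iff_add_eq_zero, add_comm,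
            intervalIntegral.integral_add_adjacent_intervals, ← he]
          · refine hi.mono_set ?_
            rw [uIcc_of_le hx'.1.1.le, uIcc_of_le zero_le_one]
            exact Icc_subset_Icc_right hx'.1.2.le
          · exact (h.evalKernel_right ⟨hgt, hx'.1.2.le⟩ g).1
      · refine h.flux_eq ?_
        have := hi.ae_hasDerivAt_integral
        filter_upwards [ae_restrict_of_ae this, ae_restrict_mem measurableSet_Ioo] with x hx hx'
        rw [uIcc_of_le zero_le_one] at hx
        exact hx (Ioo_subset_Icc_self hx') 0 ⟨le_rfl, zero_le_one⟩
    | strong =>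
      set w : ℝ → ℝ := fun x => if x < x₀ then ∫ y in (0 : ℝ)..x, (√(a y))⁻¹ * g y
        else ∫ y in (1 : ℝ)..x, (√(a y))⁻¹ * g y with hw
      have wl : ∀ {x}, x < x₀ → w x = ∫ y in (0 : ℝ)..x, (√(a y))⁻¹ * g y := fun hx => if_pos hx
      have wr : ∀ {x}, x₀ < x → w x = ∫ y in (1 : ℝ)..x, (√(a y))⁻¹ * g y :=
        fun hx => if_neg hx.not_gt
      refine ⟨w, ?_, ⟨fun x hx => ?_, fun x hx => ?_⟩, ?_, ?_, h.flux_eq ?_⟩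
      · filter_upwards [hz, ae_mem_Ioo_diff x₀] with x hx hx'
        rw [hx]
        rcases lt_or_gt_of_ne (show x ≠ x₀ from hx'.2) with hlt | hgt
        · rw [(h.evalKernel_left ⟨hx'.1.1.le, hlt⟩ g).2, wl hlt]
        · rw [(h.evalKernel_right ⟨hgt, hx'.1.2.le⟩ g).2, wr hgt,
            intervalIntegral.integral_symm, neg_neg]
      · refine absolutelyContinuousOnInterval_congr
          ((h.evalKernel_left hx g).1.absolutelyContinuousOnInterval_intervalIntegral left_mem_uIcc)
          fun y hy => ?_
        rw [uIcc_of_le hx.1] at hy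
        exact (wl (hy.2.trans_lt hx.2)).symm
      · refine absolutelyContinuousOnInterval_congr
          ((h.evalKernel_right hx g).1.absolutelyContinuousOnInterval_intervalIntegral
            right_mem_uIcc) fun y hy => ?_
        rw [uIcc_of_le hx.2] at hy
        exact (wr (hx.1.trans_le hy.1)).symm
      · rw [wl hx₀.1, intervalIntegral.integral_same]
      · rw [wr hx₀.2, intervalIntegral.integral_same]
      -- The primitives are differentiable a.e. on each `[0,q]` and `[q,1]` with `q` rational, and
      -- these intervals exhaust `[0,1] \ {x₀}`.
      · have hl : ∀ᵐ x : ℝ, ∀ q : ℚ, (q : ℝ) ∈ Ico 0 x₀ → x ∈ Icc 0 (q : ℝ) →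
            HasDerivAt (fun x => ∫ y in (0 : ℝ)..x, (√(a y))⁻¹ * g y) ((√(a x))⁻¹ * g x) x := by
          refine ae_all_iff.mpr fun q => ?_
          by_cases hq : (q : ℝ) ∈ Ico 0 x₀
          · filter_upwards [(h.evalKernel_left hq g).1.ae_hasDerivAt_integral] with x hx _ hxq
            rw [uIcc_of_le hq.1] at hx
            exact hx hxq 0 (left_mem_Icc.mpr hq.1)
          · exact Eventually.of_forall fun x hq' => absurd hq' hq
        have hr : ∀ᵐ x : ℝ, ∀ q : ℚ, (q : ℝ) ∈ Ioc x₀ 1 → x ∈ Icc (q : ℝ) 1 →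
            HasDerivAt (fun x => ∫ y in (1 : ℝ)..x, (√(a y))⁻¹ * g y) ((√(a x))⁻¹ * g x) x := by
          refine ae_all_iff.mpr fun q => ?_
          by_cases hq : (q : ℝ) ∈ Ioc x₀ 1
          · filter_upwards [(h.evalKernel_right hq g).1.ae_hasDerivAt_integral] with x hx _ hxq
            rw [uIcc_of_le hq.2] at hx
            exact hx hxq 1 (right_mem_Icc.mpr hq.2)
          · exact Eventually.of_forall fun x hq' => absurd hq' hq
        filter_upwards [ae_restrict_of_ae hl, ae_restrict_of_ae hr, ae_mem_Ioo_diff x₀]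
          with x hxl hxr hx'
        rcases lt_or_gt_of_ne (show x ≠ x₀ from hx'.2) with hlt | hgt
        · obtain ⟨q, hq1, hq2⟩ := exists_rat_btwn hlt
          refine (hxl q ⟨hx'.1.1.le.trans hq1.le, hq2⟩
            ⟨hx'.1.1.le, hq1.le⟩).congr_of_eventuallyEq ?_
          filter_upwards [Iio_mem_nhds hlt] with y hy using wl hy
        · obtain ⟨q, hq1, hq2⟩ := exists_rat_btwn hgt
          refine (hxr q ⟨hq1, hq2.le.trans hx'.1.2.le⟩
            ⟨hq2.le, hx'.1.2.le⟩).congr_of_eventuallyEq ?_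
          filter_upwards [Ioi_mem_nhds hgt] with y hy using wr hy

/-- The graph of `z ↦ √a z_x` on `H¹_a(0,1)`. -/
def graph (h : IsDegenerate d a x₀ K) : Submodule ℝ (WithLp 2 (L2I × L2I)) where
  carrier := {p | HasSqrtFlux d a x₀ p.fst p.snd}
  zero_mem' := by
    rw [mem_ofPred_eq, h.hasSqrtFlux_iff]
    simp only [WithLp.zero_fst, WithLp.zero_snd, inner_zero_right, implies_true, and_true]
    exact Lp.coeFn_zero _ _ _
  add_mem' := by
    intro p q hp hq
    rw [mem_ofPred_eq, h.hasSqrtFlux_iff] at hp hq ⊢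
    refine ⟨?_, fun hd => ?_⟩
    · filter_upwards [hp.1, hq.1, Lp.coeFn_add p.fst q.fst] with x a b c
      rw [WithLp.add_fst, WithLp.add_snd, c, Pi.add_apply, a, b, inner_add_right]
    · rw [WithLp.add_snd, inner_add_right, hp.2 hd, hq.2 hd, add_zero]
  smul_mem' := by
    intro r p hp
    rw [mem_ofPred_eq, h.hasSqrtFlux_iff] at hp ⊢
    refine ⟨?_, fun hd => ?_⟩
    · filter_upwards [hp.1, Lp.coeFn_smul r p.fst] with x a b
      rw [WithLp.smul_fst, WithLp.smul_snd, b, Pi.smul_apply, a, real_inner_smul_right, smul_eq_mul]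
    · rw [WithLp.smul_snd, real_inner_smul_right, hp.2 hd, mul_zero]

theorem isClosed_graph (h : IsDegenerate d a x₀ K) :
    IsClosed (h.graph : Set (WithLp 2 (L2I × L2I))) := by
  refine IsSeqClosed.isClosed fun p q hp hpq => ?_
  have hf : Tendsto (fun n => (p n).fst) atTop (𝓝 q.fst) :=
    ((WithLp.fstL 2 ℝ L2I L2I).continuous.tendsto q).comp hpq
  have hs : Tendsto (fun n => (p n).snd) atTop (𝓝 q.snd) :=
    ((WithLp.sndL 2 ℝ L2I L2I).continuous.tendsto q).comp hpq
  have hp' := fun n => (h.hasSqrtFlux_iff _ _).mp (hp n)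
  refine (h.hasSqrtFlux_iff _ _).mpr ⟨?_, fun hd => ?_⟩
  · obtain ⟨ns, hns, hae⟩ := (tendstoInMeasure_of_tendsto_Lp hf).exists_seq_tendsto_ae
    filter_upwards [hae, ae_all_iff.mpr fun n => (hp' n).1] with x hx hx'
    simp_rw [hx'] at hx
    refine tendsto_nhds_unique hx ?_
    exact tendsto_const_nhds.inner (hs.comp hns.tendsto_atTop)
  · have h1 : Tendsto (fun n => inner ℝ (invSqrtOn a (Ioc 0 1)) (p n).snd) atTop
        (𝓝 (inner ℝ (invSqrtOn a (Ioc 0 1)) q.snd)) := tendsto_const_nhds.inner hs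
    simp_rw [fun n => (hp' n).2 hd] at h1
    exact (tendsto_nhds_unique h1 tendsto_const_nhds)

/-- The flux is determined by the function. -/
theorem flux_eq_zero (h : IsDegenerate d a x₀ K) {g : L2I} (hg : HasSqrtFlux d a x₀ 0 g) :
    g = 0 := by
  obtain ⟨w, hz, hac, -, -, hg⟩ := hg
  have hx₀ := h.point_mem
  have hcont : ContinuousOn w (Ioo 0 1 \ {x₀}) := by
    intro x hx
    refine ContinuousAt.continuousWithinAt ?_
    rcases lt_or_gt_of_ne (show x ≠ x₀ from hx.2) with hlt | hgt
    · obtain ⟨q, hq1, hq2⟩ := exists_between hlt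
      have := (hac.left hx₀ ⟨hx.1.1.le.trans hq1.le, hq2⟩).continuousOn
      rw [uIcc_of_le (hx.1.1.le.trans hq1.le)] at this
      exact this.continuousAt (Icc_mem_nhds hx.1.1 hq1)
    · obtain ⟨q, hq1, hq2⟩ := exists_between hgt
      have := (hac.right hx₀ ⟨hq1, hq2.le.trans hx.1.2.le⟩).continuousOn
      rw [uIcc_of_le (hq2.le.trans hx.1.2.le)] at this
      exact this.continuousAt (Icc_mem_nhds hq2 hx.1.2)
  -- `w` vanishes a.e. and is continuous off `x₀`, so it vanishes there and so does its derivative.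
  have hw : EqOn w 0 (Ioo 0 1 \ {x₀}) := by
    refine Measure.eqOn_open_of_ae_eq (μ := volume) ?_ (isOpen_Ioo_diff x₀) hcont continuousOn_const
    rw [restrict_Ioo_diff_singleton]
    filter_upwards [hz, Lp.coeFn_zero ℝ 2 (volume.restrict (Ioo (0 : ℝ) 1))] with x a b
    rw [← a, b]
  refine Lp.ext ?_
  filter_upwards [hg, ae_mem_Ioo_diff x₀, Lp.coeFn_zero ℝ 2 (volume.restrict (Ioo (0 : ℝ) 1))]
    with x a b c
  have : w =ᶠ[𝓝 x] 0 := hw.eventuallyEq_of_mem ((isOpen_Ioo_diff x₀).mem_nhds b)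
  rw [a, c, this.deriv_eq]
  simp

/-- Smooth functions with compact support off the degeneracy point belong to `H¹_a`. -/
theorem hasSqrtFlux_of_contDiff (h : IsDegenerate d a x₀ K) {v : ℝ → ℝ} (hv : ContDiff ℝ 1 v)
    (hc : HasCompactSupport v) (hs : tsupport v ⊆ Ioo 0 1 \ {x₀}) :
    ∃ z g : L2I, HasSqrtFlux d a x₀ z g ∧ ∀ᵐ x ∂volume.restrict (Ioo (0 : ℝ) 1), z x = v x := by
  have hz : MemLp v 2 (volume.restrict (Ioo (0 : ℝ) 1)) :=
    (hv.continuous.memLp_of_hasCompactSupport hc).restrict _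
  have hdc : Continuous (deriv v) := hv.continuous_deriv le_rfl
  have hac : ContinuousOn (fun x => √(a x) * deriv v x) (Ioo 0 1 \ {x₀}) :=
    (h.continuousOn.mono (sdiff_subset_sdiff_left Ioo_subset_Icc_self)).sqrt.mul hdc.continuousOn
  have hg : MemLp (fun x => √(a x) * deriv v x) 2 (volume.restrict (Ioo (0 : ℝ) 1)) := by
    obtain ⟨C, hC⟩ := IsCompact.exists_bound_of_continuousOn hc (hac.mono hs)
    refine MemLp.of_bound ?_ (max C 0) (Eventually.of_forall fun x => ?_)
    · rw [← restrict_Ioo_diff_singleton x₀]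
      exact hac.aestronglyMeasurable (isOpen_Ioo_diff x₀).measurableSet
    · by_cases hx : x ∈ tsupport v
      · exact (hC x hx).trans (le_max_left _ _)
      · have : deriv v x = 0 := by
          by_contra hne
          exact hx (support_deriv_subset hne)
        rw [this, mul_zero, norm_zero]
        exact le_max_right _ _
  have h0 : ∀ x, x ∉ Ioo (0 : ℝ) 1 \ {x₀} → v x = 0 := fun x hx =>
    image_eq_zero_of_notMem_tsupport fun hx' => hx (hs hx')
  refine ⟨hz.toLp, hg.toLp, ⟨v, hz.coeFn_toLp, ?_, h0 0 (by simp), h0 1 (by simp), hg.coeFn_toLp⟩,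
    hz.coeFn_toLp⟩
  cases d with
  | weak => exact hv.contDiffOn.absolutelyContinuousOnInterval
  | strong => exact ⟨fun x _ => hv.contDiffOn.absolutelyContinuousOnInterval,
      fun x _ => hv.contDiffOn.absolutelyContinuousOnInterval⟩

instance (h : IsDegenerate d a x₀ K) : CompleteSpace h.graph := h.isClosed_graph.completeSpace_coe

/-- The energy space `H¹_a(0,1)`, realised as the graph of `z ↦ √a z_x`. -/
def energySpace (h : IsDegenerate d a x₀ K) : EnergySpace L2I h.graph where
  ι := WithLp.fstL 2 ℝ L2I L2I ∘L h.graph.subtypeL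
  D := WithLp.sndL 2 ℝ L2I L2I ∘L h.graph.subtypeL
  inner_eq v w := WithLp.prod_inner_apply v.1 w.1
  inj := by
    intro p q hpq
    have h1 : (p - q).1.fst = 0 := sub_eq_zero.mpr hpq
    have h2 : HasSqrtFlux d a x₀ (p - q).1.fst (p - q).1.snd := (p - q).2
    rw [h1] at h2
    have h3 := h.flux_eq_zero h2
    have h4 : (p - q).1 = 0 := WithLp.ofLp_injective 2 (Prod.ext h1 h3)
    exact sub_eq_zero.mp (Subtype.ext h4)
  dense := by
    set ι : h.graph →L[ℝ] L2I := WithLp.fstL 2 ℝ L2I L2I ∘L h.graph.subtypeL with hι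
    change Dense ((LinearMap.range (ι : h.graph →ₗ[ℝ] L2I) : Submodule ℝ L2I) : Set L2I)
    rw [Submodule.dense_iff_topologicalClosure_eq_top, Submodule.topologicalClosure_eq_top_iff,
      Submodule.eq_bot_iff]
    intro z hz
    have key : ∀ᵐ x, x ∈ Ioo (0 : ℝ) 1 \ {x₀} → z x = 0 := by
      refine (isOpen_Ioo_diff x₀).ae_eq_zero_of_integral_contDiff_smul_eq_zero ?_ ?_
      · have : IntegrableOn z (Ioo 0 1) := (Lp.memLp z).integrable one_le_two
        exact (this.mono_set sdiff_subset).locallyIntegrableOn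
      · intro v hv hvc hvs
        obtain ⟨y, g, hyg, hy⟩ := h.hasSqrtFlux_of_contDiff (hv.of_le (by simp)) hvc hvs
        have h1 : inner ℝ y z = 0 :=
          (Submodule.mem_orthogonal _ _).mp hz _ ⟨⟨WithLp.toLp 2 (y, g), hyg⟩, rfl⟩
        rw [L2.inner_def] at h1
        refine Eq.trans ?_ h1
        rw [← setIntegral_eq_integral_of_forall_compl_eq_zero (μ := volume) (s := Ioo (0 : ℝ) 1)
          (f := fun x => v x • z x)]
        · refine integral_congr_ae ?_
          filter_upwards [hy] with x hx
          rw [hx]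
          simp [mul_comm]
        · intro x hx
          rw [image_eq_zero_of_notMem_tsupport fun hx' => hx (hvs hx').1, zero_smul]
    refine Lp.ext ?_
    filter_upwards [ae_restrict_of_ae key, ae_mem_Ioo_diff x₀,
      Lp.coeFn_zero ℝ 2 (volume.restrict (Ioo (0 : ℝ) 1))] with x a b c
    rw [a b, c, Pi.zero_apply]

end IsDegenerate

/-! ### Functions of two variables as functions into `L²` -/

/-- In a separable Hilbert space weak measurability implies strong measurability. -/
theorem aestronglyMeasurable_of_inner {β : Type*} [MeasurableSpace β] {ν : Measure β}
    {H : Type*} [NormedAddCommGroup H] [InnerProductSpace ℝ H]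
    [TopologicalSpace.SeparableSpace H] {u : β → H}
    (hu : ∀ w, AEStronglyMeasurable (fun t => inner ℝ w (u t)) ν) : AEStronglyMeasurable u ν := by
  let U : ℕ → Submodule ℝ H := fun n => Submodule.span ℝ (TopologicalSpace.denseSeq H '' Iic n)
  have hfin : ∀ n, FiniteDimensional ℝ (U n) := fun n =>
    FiniteDimensional.span_of_finite ℝ ((finite_Iic n).image _)
  have hmono : Monotone U := fun m n hmn =>
    Submodule.span_mono (image_mono (Iic_subset_Iic.mpr hmn))
  have hdense : ⊤ ≤ (⨆ n, U n).topologicalClosure := by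
    intro x _
    have hx : x ∈ closure (range (TopologicalSpace.denseSeq H)) :=
      TopologicalSpace.denseRange_denseSeq H x
    refine closure_mono ?_ hx
    rintro _ ⟨n, rfl⟩
    exact Submodule.mem_iSup_of_mem n (Submodule.subset_span ⟨n, self_mem_Iic, rfl⟩)
  refine aestronglyMeasurable_of_tendsto_ae atTop (f := fun n t => (U n).starProjection (u t))
    (fun n => ?_) (Eventually.of_forall fun t =>
      Submodule.starProjection_tendsto_self U hmono (u t) hdense)
  simp_rw [(stdOrthonormalBasis ℝ (U n)).starProjection_eq_sum_rankOne, _root_.sum_apply,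
    InnerProductSpace.rankOne_apply]
  refine Finset.aestronglyMeasurable_fun_sum _ fun i _ => ?_
  exact (hu _).smul_const _

section Curry

variable {α β : Type*} [MeasurableSpace α] [MeasurableSpace β] {μ : Measure α} {ν : Measure β}

/-- Slices determine an element of a Bochner space. -/
theorem ext_slices {G K : Lp (Lp ℝ 2 μ) 2 ν} (h : ∀ᵐ t ∂ν, ∀ᵐ x ∂μ, G t x = K t x) : G = K :=
  Lp.ext (h.mono fun _ ht => Lp.ext ht)

theorem ae_norm_le_norm {γ : Type*} [MeasurableSpace γ] {ρ : Measure γ} (m : Lp ℝ ⊤ ρ) :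
    ∀ᵐ z ∂ρ, ‖m z‖ ≤ ‖m‖ := by
  filter_upwards [ae_le_eLpNormEssSup (f := m) (μ := ρ)] with z hz
  rw [Lp.norm_def, eLpNorm_exponent_top]
  have hfin : eLpNormEssSup m (ρ) ≠ ⊤ := by
    rw [← eLpNorm_exponent_top]
    exact Lp.eLpNorm_ne_top m
  have := ENNReal.toReal_mono hfin hz
  simpa using this

variable [SFinite μ] [SFinite ν]

theorem ae_ae_of_ae_prod_swap {p : α × β → Prop} (h : ∀ᵐ z ∂μ.prod ν, p z) :
    ∀ᵐ t ∂ν, ∀ᵐ x ∂μ, p (x, t) :=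
  Measure.ae_ae_of_ae_prod (Measure.measurePreserving_swap.quasiMeasurePreserving.ae h)

theorem memLp_slice (g : Lp ℝ 2 (μ.prod ν)) : ∀ᵐ t ∂ν, MemLp (fun x => g (x, t)) 2 μ := by
  filter_upwards [(Lp.memLp g).integrable_sq.prod_left_ae] with t ht
  refine (memLp_two_iff_integrable_sq ?_).mpr ht
  exact ((Lp.stronglyMeasurable g).comp_measurable measurable_prodMk_right).aestronglyMeasurable

/-- The slices of a square integrable function form a square integrable function of the second
variable. -/
theorem exists_curry [TopologicalSpace.SeparableSpace (Lp ℝ 2 μ)] (g : Lp ℝ 2 (μ.prod ν)) :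
    ∃ G : Lp (Lp ℝ 2 μ) 2 ν, ∀ᵐ t ∂ν, ∀ᵐ x ∂μ, G t x = g (x, t) := by
  classical
  set G₀ : β → Lp ℝ 2 μ := fun t =>
    if h : MemLp (fun x => g (x, t)) 2 μ then h.toLp else 0 with hG₀
  have hG : ∀ᵐ t ∂ν, ∀ᵐ x ∂μ, G₀ t x = g (x, t) := by
    filter_upwards [memLp_slice g] with t ht
    simp only [hG₀, dif_pos ht]
    exact ht.coeFn_toLp
  have hm : AEStronglyMeasurable G₀ ν := by
    refine aestronglyMeasurable_of_inner fun w => ?_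
    have h1 : StronglyMeasurable fun z : α × β => g z * w z.1 :=
      (Lp.stronglyMeasurable g).mul ((Lp.stronglyMeasurable w).comp_measurable measurable_fst)
    refine (h1.integral_prod_left' (μ := μ)).aestronglyMeasurable.congr ?_
    filter_upwards [hG] with t ht
    rw [L2.inner_def]
    refine integral_congr_ae ?_
    filter_upwards [ht] with x hx
    rw [hx]
    rfl
  have hsq : ∀ᵐ t ∂ν, ∫ x, g (x, t) ^ 2 ∂μ = ‖G₀ t‖ ^ 2 := by
    filter_upwards [hG] with t ht
    rw [norm_sq_eq_integral]
    refine integral_congr_ae ?_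
    filter_upwards [ht] with x hx
    rw [hx, Real.norm_eq_abs, sq_abs]
  have hL : MemLp G₀ 2 ν := by
    rw [memLp_two_iff_integrable_sq_norm hm]
    exact (Lp.memLp g).integrable_sq.integral_prod_right.congr hsq
  refine ⟨hL.toLp, ?_⟩
  filter_upwards [hL.coeFn_toLp, hG] with t h1 h2
  rw [h1]
  exact h2

/-- Functions of two variables with equal slices have equal inner products. -/
theorem inner_eq_of_slices {g k : Lp ℝ 2 (μ.prod ν)} {G K : Lp (Lp ℝ 2 μ) 2 ν}
    (hg : ∀ᵐ t ∂ν, ∀ᵐ x ∂μ, G t x = g (x, t)) (hk : ∀ᵐ t ∂ν, ∀ᵐ x ∂μ, K t x = k (x, t)) :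
    inner ℝ G K = inner ℝ g k := by
  rw [L2.inner_def, L2.inner_def, integral_prod_symm _ (L2.integrable_inner g k)]
  refine integral_congr_ae ?_
  filter_upwards [hg, hk] with t h1 h2
  rw [L2.inner_def]
  refine integral_congr_ae ?_
  filter_upwards [h1, h2] with x h3 h4
  rw [h3, h4]

theorem inner_eq_integral_slices {ρ : Measure (α × β)} (hρ : ρ = μ.prod ν) (g k : Lp ℝ 2 ρ) :
    inner ℝ g k = ∫ t, ∫ x, g (x, t) * k (x, t) ∂μ ∂ν := by
  subst hρ
  rw [L2.inner_def, integral_prod_symm _ (L2.integrable_inner g k)]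
  simp only [RCLike.inner_apply, conj_trivial, mul_comm]

variable [TopologicalSpace.SeparableSpace (Lp ℝ 2 μ)]

/-- The isometry `L²(μ × ν) → L²(ν; L²(μ))` that sends `g` to `t ↦ g(·,t)`. -/
def curryIsometry (μ : Measure α) (ν : Measure β) [SFinite μ] [SFinite ν]
    [TopologicalSpace.SeparableSpace (Lp ℝ 2 μ)] :
    Lp ℝ 2 (μ.prod ν) →ₗᵢ[ℝ] Lp (Lp ℝ 2 μ) 2 ν where
  toFun g := (exists_curry g).choose
  map_add' g k := by
    refine ext_slices ?_
    filter_upwards [(exists_curry (g + k)).choose_spec, (exists_curry g).choose_spec,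
      (exists_curry k).choose_spec, ae_ae_of_ae_prod_swap (Lp.coeFn_add g k),
      Lp.coeFn_add (exists_curry g).choose (exists_curry k).choose] with t h1 h2 h3 h4 h5
    rw [h5, Pi.add_apply]
    filter_upwards [h1, h2, h3, h4, Lp.coeFn_add ((exists_curry g).choose t)
      ((exists_curry k).choose t)] with x k1 k2 k3 k4 k5
    rw [k1, k4, k5, Pi.add_apply, Pi.add_apply, k2, k3]
  map_smul' r g := by
    refine ext_slices ?_
    filter_upwards [(exists_curry (r • g)).choose_spec, (exists_curry g).choose_spec,
      ae_ae_of_ae_prod_swap (Lp.coeFn_smul r g),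
      Lp.coeFn_smul r (exists_curry g).choose] with t h1 h2 h4 h5
    rw [RingHom.id_apply, h5, Pi.smul_apply]
    filter_upwards [h1, h2, h4, Lp.coeFn_smul r ((exists_curry g).choose t)] with x k1 k2 k4 k5
    rw [k1, k4, k5, Pi.smul_apply, Pi.smul_apply, k2]
  norm_map' g := by
    have := inner_eq_of_slices (exists_curry g).choose_spec (exists_curry g).choose_spec
    rw [real_inner_self_eq_norm_sq, real_inner_self_eq_norm_sq] at this
    exact (sq_eq_sq₀ (norm_nonneg _) (norm_nonneg _)).mp this

theorem curryIsometry_ae (g : Lp ℝ 2 (μ.prod ν)) :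
    ∀ᵐ t ∂ν, ∀ᵐ x ∂μ, curryIsometry μ ν g t x = g (x, t) :=
  (exists_curry g).choose_spec

theorem curryIsometry_surjective : Function.Surjective (curryIsometry μ ν) := by
  have hcl : IsClosed (range (curryIsometry μ ν)) :=
    (curryIsometry μ ν).isometry.isClosedEmbedding.isClosed_range
  intro G
  refine Lp.induction (p := 2) (by norm_num) (fun G => G ∈ range (curryIsometry μ ν))
    ?_ ?_ hcl G
  · intro c s hs hν
    set k := Lp.simpleFunc.indicatorConst 2 hs hν.ne c with hk
    have h1 : ∀ᵐ t ∂ν, (k : Lp (Lp ℝ 2 μ) 2 ν) t = s.indicator (fun _ => c) t := by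
      rw [hk, Lp.simpleFunc.coe_indicatorConst]
      exact indicatorConstLp_coeFn
    set g : α × β → ℝ := fun z => c z.1 * s.indicator (fun _ => 1) z.2 with hg
    have hgm : StronglyMeasurable g :=
      ((Lp.stronglyMeasurable c).comp_measurable measurable_fst).mul
        ((stronglyMeasurable_const.indicator hs).comp_measurable measurable_snd)
    have hgL : MemLp g 2 (μ.prod ν) := by
      rw [memLp_two_iff_integrable_sq hgm.aestronglyMeasurable]
      have h2 : Integrable (s.indicator fun _ => (1 : ℝ)) ν :=
        (integrable_indicator_iff hs).mpr (integrableOn_const hν.ne)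
      refine ((Lp.memLp c).integrable_sq.mul_prod h2).congr (Eventually.of_forall fun z => ?_)
      simp only [hg, mul_pow]
      by_cases hz : z.2 ∈ s <;> simp [hz]
    refine ⟨hgL.toLp, ext_slices ?_⟩
    filter_upwards [curryIsometry_ae hgL.toLp, ae_ae_of_ae_prod_swap hgL.coeFn_toLp, h1]
      with t k1 k2 k3
    rw [k3]
    filter_upwards [k1, k2, Lp.coeFn_zero ℝ 2 μ] with x a b e
    rw [a, b, hg]
    by_cases ht : t ∈ s
    · simp [ht]
    · simpa [ht] using e.symm
  · rintro f g hf hg - ⟨x, hx⟩ ⟨y, hy⟩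
    exact ⟨x + y, by rw [map_add, hx, hy]⟩

/-- The isometric isomorphism `L²(μ × ν) ≃ L²(ν; L²(μ))`. -/
def curryEquiv (μ : Measure α) (ν : Measure β) [SFinite μ] [SFinite ν]
    [TopologicalSpace.SeparableSpace (Lp ℝ 2 μ)] :
    Lp ℝ 2 (μ.prod ν) ≃ₗᵢ[ℝ] Lp (Lp ℝ 2 μ) 2 ν :=
  LinearIsometryEquiv.ofSurjective (curryIsometry μ ν) curryIsometry_surjective

theorem curryEquiv_ae (g : Lp ℝ 2 (μ.prod ν)) :
    ∀ᵐ t ∂ν, ∀ᵐ x ∂μ, curryEquiv μ ν g t x = g (x, t) :=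
  curryIsometry_ae g

theorem curryEquiv_symm_ae (G : Lp (Lp ℝ 2 μ) 2 ν) :
    ∀ᵐ t ∂ν, ∀ᵐ x ∂μ, (curryEquiv μ ν).symm G (x, t) = G t x := by
  filter_upwards [curryEquiv_ae ((curryEquiv μ ν).symm G)] with t ht
  filter_upwards [ht] with x hx
  rw [← hx, LinearIsometryEquiv.apply_symm_apply]

/-- Multiplication by a bounded function of two variables, as an operator on `L²(ν; L²(μ))`. -/
def mulOp (m : Lp ℝ ⊤ (μ.prod ν)) : Lp (Lp ℝ 2 μ) 2 ν →L[ℝ] Lp (Lp ℝ 2 μ) 2 ν :=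
  (curryEquiv μ ν : Lp ℝ 2 (μ.prod ν) →L[ℝ] Lp (Lp ℝ 2 μ) 2 ν) ∘L
    ((ContinuousLinearMap.mul ℝ ℝ).holderL (μ.prod ν) ⊤ 2 2 m) ∘L
    ((curryEquiv μ ν).symm : Lp (Lp ℝ 2 μ) 2 ν →L[ℝ] Lp ℝ 2 (μ.prod ν))

theorem mulOp_ae (m : Lp ℝ ⊤ (μ.prod ν)) (G : Lp (Lp ℝ 2 μ) 2 ν) :
    ∀ᵐ t ∂ν, ∀ᵐ x ∂μ, mulOp m G t x = m (x, t) * G t x := by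
  set g := (curryEquiv μ ν).symm G with hg
  have h1 : mulOp m G
      = curryEquiv μ ν ((ContinuousLinearMap.mul ℝ ℝ).holderL (μ.prod ν) ⊤ 2 2 m g) := rfl
  have h2 : ∀ᵐ z ∂μ.prod ν, (ContinuousLinearMap.mul ℝ ℝ).holderL (μ.prod ν) ⊤ 2 2 m g z
      = m z * g z := (ContinuousLinearMap.mul ℝ ℝ).coeFn_holder m g
  filter_upwards [curryEquiv_ae ((ContinuousLinearMap.mul ℝ ℝ).holderL (μ.prod ν) ⊤ 2 2 m g),
    ae_ae_of_ae_prod_swap h2, curryEquiv_symm_ae G] with t a b e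
  filter_upwards [a, b, e] with x a b e
  rw [h1, a, b, ← e]

theorem mulOp_symm (m : Lp ℝ ⊤ (μ.prod ν)) (G K : Lp (Lp ℝ 2 μ) 2 ν) :
    inner ℝ (mulOp m G) K = inner ℝ G (mulOp m K) := by
  rw [L2.inner_def, L2.inner_def]
  refine integral_congr_ae ?_
  filter_upwards [mulOp_ae m G, mulOp_ae m K] with t a b
  rw [L2.inner_def, L2.inner_def]
  refine integral_congr_ae ?_
  filter_upwards [a, b] with x a b
  rw [a, b]
  simp only [RCLike.inner_apply, conj_trivial]
  ring

theorem mulOp_nonneg (m : Lp ℝ ⊤ (μ.prod ν)) (hm : ∀ᵐ z ∂μ.prod ν, 0 ≤ m z)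
    (G : Lp (Lp ℝ 2 μ) 2 ν) : 0 ≤ inner ℝ (mulOp m G) G := by
  rw [L2.inner_def]
  refine integral_nonneg_of_ae ?_
  filter_upwards [mulOp_ae m G, ae_ae_of_ae_prod_swap hm] with t a b
  rw [L2.inner_def]
  refine integral_nonneg_of_ae ?_
  filter_upwards [a, b] with x a b
  rw [a]
  simp only [RCLike.inner_apply, conj_trivial, Pi.zero_apply]
  nlinarith [mul_nonneg b (sq_nonneg (G t x))]

theorem mulOp_norm_le (m : Lp ℝ ⊤ (μ.prod ν)) (G : Lp (Lp ℝ 2 μ) 2 ν) :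
    ∀ᵐ t ∂ν, ‖mulOp m G t‖ ≤ ‖m‖ * ‖G t‖ := by
  filter_upwards [mulOp_ae m G, ae_ae_of_ae_prod_swap (ae_norm_le_norm m)] with t a b
  refine Lp.norm_le_mul_norm_of_ae_le_mul ?_
  filter_upwards [a, b] with x a b
  rw [a, norm_mul]
  gcongr

theorem mulOp_toLp_ae {m : α × β → ℝ} (hm : MemLp m ⊤ (μ.prod ν)) (G : Lp (Lp ℝ 2 μ) 2 ν) :
    ∀ᵐ t ∂ν, ∀ᵐ x ∂μ, mulOp hm.toLp G t x = m (x, t) * G t x := by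
  filter_upwards [mulOp_ae hm.toLp G, ae_ae_of_ae_prod_swap hm.coeFn_toLp] with t a b
  filter_upwards [a, b] with x a b
  rw [a, b]

theorem eq_of_slices {ρ : Measure (α × β)} (hρ : ρ = μ.prod ν) {g k : Lp ℝ 2 ρ}
    (h : ∀ᵐ t ∂ν, ∀ᵐ x ∂μ, g (x, t) = k (x, t)) : g = k := by
  subst hρ
  refine (curryIsometry μ ν).injective (ext_slices ?_)
  filter_upwards [curryIsometry_ae g, curryIsometry_ae k, h] with t a b e
  filter_upwards [a, b, e] with x a b e
  rw [a, b, e]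

/-- Extension by zero of a function on `D × β`. -/
theorem exists_extension {ρ : Measure (α × β)} {D : Set α} (hD : MeasurableSet D)
    (hρ : ρ = (μ.restrict D).prod ν) (g : Lp ℝ 2 ρ) :
    ∃ G : Lp (Lp ℝ 2 μ) 2 ν, ∀ᵐ t ∂ν, ∀ᵐ x ∂μ, G t x = D.indicator (fun x => g (x, t)) x := by
  subst hρ
  have e : (μ.restrict D).prod ν = (μ.prod ν).restrict (D ×ˢ univ) := by
    rw [← Measure.prod_restrict, Measure.restrict_univ]
  have h1 : MemLp ((D ×ˢ univ).indicator g) 2 (μ.prod ν) := by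
    rw [memLp_indicator_iff_restrict (hD.prod MeasurableSet.univ), ← e]
    exact Lp.memLp g
  refine ⟨curryEquiv μ ν h1.toLp, ?_⟩
  filter_upwards [curryEquiv_ae h1.toLp, ae_ae_of_ae_prod_swap h1.coeFn_toLp] with t a b
  filter_upwards [a, b] with x a b
  rw [a, b]
  by_cases hx : x ∈ D <;> simp [hx]

/-- Restriction to `D × β`. -/
theorem exists_restriction {ρ : Measure (α × β)} {D : Set α}
    (hρ : ρ = (μ.restrict D).prod ν) (G : Lp (Lp ℝ 2 μ) 2 ν) :
    ∃ g : Lp ℝ 2 ρ, ∀ᵐ t ∂ν, ∀ᵐ x ∂μ.restrict D, g (x, t) = G t x := by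
  subst hρ
  have e : (μ.restrict D).prod ν = (μ.prod ν).restrict (D ×ˢ univ) := by
    rw [← Measure.prod_restrict, Measure.restrict_univ]
  have h1 : MemLp ((curryEquiv μ ν).symm G) 2 ((μ.restrict D).prod ν) := by
    rw [e]
    exact (Lp.memLp _).restrict _
  refine ⟨h1.toLp, ?_⟩
  filter_upwards [curryEquiv_symm_ae G, ae_ae_of_ae_prod_swap h1.coeFn_toLp] with t a b
  filter_upwards [ae_restrict_of_ae a, b] with x a b
  rw [b, a]

end Curry

/-! ### Weak solutions of the degenerate equations -/

namespace EnergySpace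

variable {H V : Type*} [NormedAddCommGroup H] [InnerProductSpace ℝ H]
  [NormedAddCommGroup V] [InnerProductSpace ℝ V] {E : EnergySpace H V} {T : ℝ}
  {N : Potential H T}

theorem fwd_iff {f : XT H T} {u₀ : H} {u : ℝ → H} {U : XT H T} :
    E.Fwd N f u₀ u U ↔ ContinuousOn u (Icc 0 T) ∧ u 0 = u₀ ∧
      (∀ᵐ t ∂volume.restrict (Ioo (0 : ℝ) T), U t = u t) ∧
      ∃ z : XT V T, (∀ᵐ t ∂volume.restrict (Ioo (0 : ℝ) T), u t = E.ι (z t)) ∧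
        ∀ v, ∀ t ∈ Icc 0 T, inner ℝ (u t) (E.ι v) = inner ℝ u₀ (E.ι v) +
          ∫ r in (0 : ℝ)..t, (inner ℝ ((f - N.op U) r) (E.ι v) - inner ℝ (E.D (z r)) (E.D v)) := by
  constructor
  · intro h
    have hU := h.ae
    obtain ⟨z, hz, h1, h2, h3, h4⟩ := h
    exact ⟨h1, h2, hU, z, h3, h4⟩
  · rintro ⟨h1, h2, hU, z, h3, h4⟩
    refine ⟨z, Lp.ext ?_, h1, h2, h3, h4⟩
    filter_upwards [E.ιX_ae z, hU, h3] with t a b c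
    rw [a, b, c]

/-- The weak formulation of the backward problem, without time reversal. -/
theorem bwd_iff {k : XT H T} {pT : H} {p : ℝ → H} {P : XT H T} :
    E.Bwd N k pT p P ↔ ContinuousOn p (Icc 0 T) ∧ p T = pT ∧
      (∀ᵐ t ∂volume.restrict (Ioo (0 : ℝ) T), P t = p t) ∧
      ∃ z : XT V T, (∀ᵐ t ∂volume.restrict (Ioo (0 : ℝ) T), p t = E.ι (z t)) ∧
        ∀ v, ∀ t ∈ Icc 0 T, inner ℝ (p t) (E.ι v) = inner ℝ pT (E.ι v) +
          ∫ r in t..T, (inner ℝ ((k - N.op P) r) (E.ι v) - inner ℝ (E.D (z r)) (E.D v)) := by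
  have hmaps : MapsTo (fun t : ℝ => T - t) (Icc 0 T) (Icc 0 T) := fun t ht =>
    ⟨by linarith [ht.2], by linarith [ht.1]⟩
  have hcont : ∀ {g : ℝ → H}, ContinuousOn g (Icc 0 T) →
      ContinuousOn (fun t => g (T - t)) (Icc 0 T) := fun hg =>
    hg.comp (by fun_prop) hmaps
  have hsub : ∀ (z : XT V T) (v : V), ∀ t ∈ Icc 0 T,
      ∫ r in (0 : ℝ)..T - t, (inner ℝ ((XT.rev k - N.reverse.op (XT.rev P)) r) (E.ι v)
          - inner ℝ (E.D (XT.rev z r)) (E.D v))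
        = ∫ r in t..T, (inner ℝ ((k - N.op P) r) (E.ι v) - inner ℝ (E.D (z r)) (E.D v)) := by
    intro z v t ht
    have e : XT.rev k - N.reverse.op (XT.rev P) = XT.rev (k - N.op P) := by
      simp only [Potential.reverse, ContinuousLinearMap.comp_apply, XT.rev_rev, map_sub]
    have := intervalIntegral.integral_comp_sub_left (a := 0) (b := T - t)
      (fun r => inner ℝ ((k - N.op P) r) (E.ι v) - inner ℝ (E.D (z r)) (E.D v)) T
    rw [sub_zero, sub_sub_cancel] at this
    rw [e, ← this]
    refine XT.interval_congr (T := T) ?_ ⟨le_rfl, ht.1.trans ht.2⟩ (hmaps ht)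
    filter_upwards [XT.rev_ae (k - N.op P), XT.rev_ae z] with r a b
    rw [a, b]
  unfold Bwd
  rw [fwd_iff]
  constructor
  · rintro ⟨h1, h2, hU, z, h3, h4⟩
    refine ⟨?_, by simpa using h2, ?_, XT.rev z, ?_, fun v t ht => ?_⟩
    · simpa using hcont h1
    · filter_upwards [XT.ae_reflect hU, XT.ae_reflect (XT.rev_ae P)] with t a b
      rw [b] at a
      simpa using a
    · filter_upwards [XT.ae_reflect h3, XT.rev_ae z] with t a b
      rw [b]
      simpa using a
    · have := h4 v (T - t) (hmaps ht)
      rw [sub_sub_cancel] at this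
      rw [this, ← hsub _ v t ht, XT.rev_rev]
  · rintro ⟨h1, h2, hU, z, h3, h4⟩
    refine ⟨hcont h1, by simpa using h2, ?_, XT.rev z, ?_, fun v t ht => ?_⟩
    · filter_upwards [XT.ae_reflect hU, XT.rev_ae P] with t a b
      rw [b, a]
    · filter_upwards [XT.ae_reflect h3, XT.rev_ae z] with t a b
      rw [b, a]
    · have := hsub z v (T - t) (hmaps ht)
      rw [sub_sub_cancel] at this
      rw [h4 v (T - t) (hmaps ht), this]

end EnergySpace

instance : TopologicalSpace.SeparableSpace L2I := by
  have : Fact ((2 : ENNReal) ≠ ⊤) := ⟨by norm_num⟩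
  infer_instance

theorem inner_L2I (f g : L2I) : inner ℝ f g = ∫ x in Ioo (0 : ℝ) 1, f x * g x := by
  rw [L2.inner_def]
  simp only [RCLike.inner_apply, conj_trivial, mul_comm]

/-- A square integrable function with a square integrable flux is a Bochner function with values in
the energy space; measurability comes from the orthogonal projection to the graph. -/
theorem IsDegenerate.exists_graph_class {d : Degeneracy} {a : ℝ → ℝ} {x₀ K T : ℝ}
    (h : IsDegenerate d a x₀ K) {u G : ℝ → L2I} (hu : MemLp u 2 (volume.restrict (Ioo 0 T)))
    (hG : MemLp G 2 (volume.restrict (Ioo 0 T)))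
    (huG : ∀ᵐ t ∂volume.restrict (Ioo (0 : ℝ) T), HasSqrtFlux d a x₀ (u t) (G t)) :
    ∃ z : XT h.graph T, ∀ᵐ t ∂volume.restrict (Ioo (0 : ℝ) T),
      h.energySpace.ι (z t) = u t ∧ h.energySpace.D (z t) = G t := by
  obtain ⟨L, M, hLM⟩ : ∃ L M : L2I →L[ℝ] h.graph, ∀ g : h.graph, L g.1.fst + M g.1.snd = g := by
    let pr : L2I × L2I →L[ℝ] h.graph := h.graph.orthogonalProjectionOnto ∘L
      ((WithLp.prodContinuousLinearEquiv 2 ℝ L2I L2I).symm : L2I × L2I →L[ℝ] WithLp 2 (L2I × L2I))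
    refine ⟨pr ∘L ContinuousLinearMap.inl ℝ L2I L2I, pr ∘L ContinuousLinearMap.inr ℝ L2I L2I,
      fun g => ?_⟩
    change pr (g.1.fst, 0) + pr (0, g.1.snd) = g
    rw [← map_add, Prod.mk_add_mk, add_zero, zero_add]
    exact h.graph.orthogonalProjectionOnto_mem_subspace_eq_self g
  have h1 : MemLp (fun t => L (u t) + M (G t)) 2 (volume.restrict (Ioo 0 T)) :=
    (L.comp_memLp' hu).add (M.comp_memLp' hG)
  refine ⟨h1.toLp, ?_⟩
  filter_upwards [h1.coeFn_toLp, huG] with t a b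
  have e : h1.toLp (fun t => L (u t) + M (G t)) t
      = (⟨WithLp.toLp 2 (u t, G t), b⟩ : h.graph) := by
    rw [a]
    exact hLM ⟨WithLp.toLp 2 (u t, G t), b⟩
  rw [e]
  exact ⟨rfl, rfl⟩

namespace ControlData

variable (P : ControlData)

/-- The energy space of the problem. -/
abbrev energy : EnergySpace L2I P.degenerate.graph := P.degenerate.energySpace

theorem volume_prod (D : Set ℝ) (T : ℝ) : (volume : Measure (ℝ × ℝ)).restrict (D ×ˢ Ioo 0 T)
    = ((volume : Measure ℝ).restrict D).prod ((volume : Measure ℝ).restrict (Ioo 0 T)) := by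
  rw [Measure.prod_restrict, Measure.volume_eq_prod]

theorem memLp_c : MemLp P.c ⊤ ((volume.restrict (Ioo (0 : ℝ) 1)).prod
    (volume.restrict (Ioo (0 : ℝ) P.T))) := by
  rw [← volume_prod]
  exact P.c_bdd

/-- Multiplication by `c`. -/
def potential : Potential L2I P.T where
  op := mulOp P.memLp_c.toLp
  bound := ‖P.memLp_c.toLp‖
  bound_nonneg := norm_nonneg _
  norm_le := mulOp_norm_le _
  symm := mulOp_symm _

theorem potential_ae (U : XT L2I P.T) : ∀ᵐ t ∂volume.restrict (Ioo (0 : ℝ) P.T),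
    ∀ᵐ x ∂volume.restrict (Ioo (0 : ℝ) 1), P.potential.op U t x = P.c (x, t) * U t x :=
  mulOp_toLp_ae P.memLp_c U

/-- The terms of the weak formulation as inner products. -/
theorem integral_weak_eq {h : ℝ → ℝ → ℝ} {F U : XT L2I P.T} {u G : ℝ → L2I}
    {z : XT P.degenerate.graph P.T}
    (hF : ∀ᵐ t ∂volume.restrict (Ioo (0 : ℝ) P.T), ∀ᵐ x ∂volume.restrict (Ioo (0 : ℝ) 1),
      F t x = h x t)
    (hU : ∀ᵐ t ∂volume.restrict (Ioo (0 : ℝ) P.T), U t = u t)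
    (hz : ∀ᵐ t ∂volume.restrict (Ioo (0 : ℝ) P.T), P.energy.D (z t) = G t) (v Gv : L2I)
    {a b : ℝ} (ha : a ∈ Icc 0 P.T) (hb : b ∈ Icc 0 P.T) :
    ∫ r in a..b, (inner ℝ ((F - P.potential.op U) r) v - inner ℝ (P.energy.D (z r)) Gv)
      = (∫ r in a..b, ∫ x in Ioo (0 : ℝ) 1, h x r * v x)
        - ∫ r in a..b, (inner ℝ (G r) Gv + ∫ x in Ioo (0 : ℝ) 1, P.c (x, r) * u r x * v x) := by
  have e1 : ∫ r in a..b, ∫ x in Ioo (0 : ℝ) 1, h x r * v x = ∫ r in a..b, inner ℝ (F r) v := by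
    refine XT.interval_congr ?_ ha hb
    filter_upwards [hF] with t ht
    rw [inner_L2I]
    refine integral_congr_ae ?_
    filter_upwards [ht] with x hx
    rw [hx]
  have e2 : ∫ r in a..b, (inner ℝ (G r) Gv + ∫ x in Ioo (0 : ℝ) 1, P.c (x, r) * u r x * v x)
      = ∫ r in a..b, (inner ℝ (P.energy.DX P.T z r) Gv + inner ℝ (P.potential.op U r) v) := by
    refine XT.interval_congr ?_ ha hb
    filter_upwards [P.potential_ae U, hU, hz, P.energy.DX_ae z] with t h1 h2 h3 h4
    rw [h4, h3, inner_L2I (P.potential.op U t)]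
    congr 1
    refine integral_congr_ae ?_
    filter_upwards [h1] with x hx
    rw [hx, h2]
  have hi : ∀ (W : XT L2I P.T) (w : L2I),
      IntervalIntegrable (fun r => inner ℝ (W r) w) volume a b := fun W w =>
    XT.intervalIntegrable_of_integrable (W.integrable.inner_const w) ha hb
  rw [e1, e2, ← intervalIntegral.integral_sub (hi F v) ((hi _ Gv).add (hi _ v))]
  refine XT.interval_congr ?_ ha hb
  filter_upwards [Lp.coeFn_sub F (P.potential.op U), P.energy.DX_ae z] with t h1 h2
  rw [h1, Pi.sub_apply, inner_sub_left, h2]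
  ring

theorem isForwardSol_iff {h : ℝ → ℝ → ℝ} {u₀ : L2I} {u : ℝ → L2I} {F : XT L2I P.T}
    (hF : ∀ᵐ t ∂volume.restrict (Ioo (0 : ℝ) P.T), ∀ᵐ x ∂volume.restrict (Ioo (0 : ℝ) 1),
      F t x = h x t) :
    P.IsForwardSol h u₀ u ↔ ∃ U, P.energy.Fwd P.potential F u₀ u U := by
  have hT := P.T_pos.le
  constructor
  · rintro ⟨h1, h2, G, hG, h3, h4⟩
    have hu := XT.memLp_of_continuousOn h1
    obtain ⟨z, hz⟩ := P.degenerate.exists_graph_class hu hG h3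
    refine ⟨hu.toLp, EnergySpace.fwd_iff.mpr ⟨h1, h2, hu.coeFn_toLp, z,
      hz.mono fun t ht => ht.1.symm, fun v t ht => ?_⟩⟩
    rw [P.integral_weak_eq hF hu.coeFn_toLp (hz.mono fun t ht => ht.2) _ _
      (left_mem_Icc.mpr hT) ht]
    have := h4 (P.energy.ι v) (P.energy.D v) v.2 t ht
    linarith
  · rintro ⟨U, hU⟩
    obtain ⟨h1, h2, h3, z, h4, h5⟩ := EnergySpace.fwd_iff.mp hU
    refine ⟨h1, h2, fun t => P.energy.D (z t), ContinuousLinearMap.comp_memLp' _ (Lp.memLp z), ?_,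
      fun v Gv hv t ht => ?_⟩
    · filter_upwards [h4] with t ht
      rw [ht]
      exact (z t).2
    · have e := h5 ⟨WithLp.toLp 2 (v, Gv), hv⟩ t ht
      change inner ℝ (u t) v = inner ℝ u₀ v + ∫ r in (0 : ℝ)..t,
        (inner ℝ ((F - P.potential.op U) r) v - inner ℝ (P.energy.D (z r)) Gv) at e
      have e' := P.integral_weak_eq (z := z) hF h3 (Eventually.of_forall fun _ => rfl) v Gv
        (left_mem_Icc.mpr hT) ht
      linarith

theorem isBackwardSol_iff {h : ℝ → ℝ → ℝ} {uT : L2I} {u : ℝ → L2I} {F : XT L2I P.T}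
    (hF : ∀ᵐ t ∂volume.restrict (Ioo (0 : ℝ) P.T), ∀ᵐ x ∂volume.restrict (Ioo (0 : ℝ) 1),
      F t x = h x t) :
    P.IsBackwardSol h uT u ↔ ∃ U, P.energy.Bwd P.potential F uT u U := by
  have hT := P.T_pos.le
  constructor
  · rintro ⟨h1, h2, G, hG, h3, h4⟩
    have hu := XT.memLp_of_continuousOn h1
    obtain ⟨z, hz⟩ := P.degenerate.exists_graph_class hu hG h3
    refine ⟨hu.toLp, EnergySpace.bwd_iff.mpr ⟨h1, h2, hu.coeFn_toLp, z,
      hz.mono fun t ht => ht.1.symm, fun v t ht => ?_⟩⟩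
    rw [P.integral_weak_eq hF hu.coeFn_toLp (hz.mono fun t ht => ht.2) _ _ ht
      (right_mem_Icc.mpr hT)]
    have := h4 (P.energy.ι v) (P.energy.D v) v.2 t ht
    linarith
  · rintro ⟨U, hU⟩
    obtain ⟨h1, h2, h3, z, h4, h5⟩ := EnergySpace.bwd_iff.mp hU
    refine ⟨h1, h2, fun t => P.energy.D (z t), ContinuousLinearMap.comp_memLp' _ (Lp.memLp z), ?_,
      fun v Gv hv t ht => ?_⟩
    · filter_upwards [h4] with t ht
      rw [ht]
      exact (z t).2
    · have e := h5 ⟨WithLp.toLp 2 (v, Gv), hv⟩ t ht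
      change inner ℝ (u t) v = inner ℝ uT v + ∫ r in t..P.T,
        (inner ℝ ((F - P.potential.op U) r) v - inner ℝ (P.energy.D (z r)) Gv) at e
      have e' := P.integral_weak_eq (z := z) hF h3 (Eventually.of_forall fun _ => rfl) v Gv
        ht (right_mem_Icc.mpr hT)
      linarith

end ControlData

/-! ### The couplings of the control problem -/

section Slices

variable {α β : Type*} [MeasurableSpace α] [MeasurableSpace β] {μ : Measure α} {ν : Measure β}

theorem slices_add (F G : Lp (Lp ℝ 2 μ) 2 ν) :
    ∀ᵐ t ∂ν, ∀ᵐ x ∂μ, (F + G) t x = F t x + G t x := by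
  filter_upwards [Lp.coeFn_add F G] with t ht
  rw [ht]
  exact Lp.coeFn_add (F t) (G t)

theorem slices_sub (F G : Lp (Lp ℝ 2 μ) 2 ν) :
    ∀ᵐ t ∂ν, ∀ᵐ x ∂μ, (F - G) t x = F t x - G t x := by
  filter_upwards [Lp.coeFn_sub F G] with t ht
  rw [ht]
  exact Lp.coeFn_sub (F t) (G t)

theorem slices_neg (F : Lp (Lp ℝ 2 μ) 2 ν) :
    ∀ᵐ t ∂ν, ∀ᵐ x ∂μ, (-F) t x = -F t x := by
  filter_upwards [Lp.coeFn_neg F] with t ht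
  rw [ht]
  exact Lp.coeFn_neg (F t)

theorem slices_smul (r : ℝ) (F : Lp (Lp ℝ 2 μ) 2 ν) :
    ∀ᵐ t ∂ν, ∀ᵐ x ∂μ, (r • F) t x = r * F t x := by
  filter_upwards [Lp.coeFn_smul r F] with t ht
  rw [ht]
  exact Lp.coeFn_smul r (F t)

end Slices

namespace ControlData

variable (P : ControlData)

theorem profile_nonneg (t : ℝ) : 0 ≤ P.profile t := by
  have h : ∀ r : ℝ, 0 ≤ r ^ 4 := fun r => by positivity
  rcases P.profile_eq with e | e <;> rw [e]
  · exact div_nonneg zero_le_one (h _)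
  · unfold eta
    split_ifs
    · have := P.T_pos
      positivity
    · exact div_nonneg zero_le_one (mul_nonneg (h _) (h _))

theorem measurable_profile : Measurable P.profile := by
  rcases P.profile_eq with e | e <;> rw [e]
  · unfold theta
    fun_prop
  · unfold eta
    exact Measurable.ite measurableSet_Iic measurable_const (by fun_prop)

open scoped Pointwise in
theorem σ_eq (t : ℝ) : P.σ t = Real.exp (-P.s * (P.profile t *
    sInf (weightPsi P.a P.x₀ P.c₁ P.c₂ '' Icc 0 1)) / 2) := by
  have e : (fun x => P.profile t * weightPsi P.a P.x₀ P.c₁ P.c₂ x) '' Icc 0 1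
      = P.profile t • (weightPsi P.a P.x₀ P.c₁ P.c₂ '' Icc 0 1) := by
    rw [← image_smul, image_image]
    rfl
  rw [σ, weightSigma, e, Real.sInf_smul_of_nonneg (P.profile_nonneg t), smul_eq_mul]

theorem measurable_σ : Measurable P.σ := by
  have e : P.σ = fun t => Real.exp (-P.s * (P.profile t *
      sInf (weightPsi P.a P.x₀ P.c₁ P.c₂ '' Icc 0 1)) / 2) := funext P.σ_eq
  rw [e]
  have := P.measurable_profile
  fun_prop

/-- The minimum in the definition of `σ` is nonpositive, since the weight is negative at `x₀`. -/
theorem one_le_σ (t : ℝ) : 1 ≤ P.σ t := by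
  have hx₀ := P.degenerate.point_mem
  have hK : P.K < 2 := by
    have := P.degenerate.exponent
    cases hd : P.deg <;> rw [hd] at this
    · exact this.2.trans one_lt_two
    · exact this.2.1
  have hc₂ : 0 < P.c₂ := by
    refine lt_of_le_of_lt ?_ ((le_max_left _ _).trans_lt P.c₂_gt)
    have h1 := P.degenerate.pos 1 ⟨⟨zero_le_one, le_rfl⟩, hx₀.2.ne'⟩
    exact div_nonneg (sq_nonneg _) (mul_nonneg h1.le (sub_nonneg.mpr hK.le))
  have hm : sInf (weightPsi P.a P.x₀ P.c₁ P.c₂ '' Icc 0 1) ≤ 0 := by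
    by_cases hb : BddBelow (weightPsi P.a P.x₀ P.c₁ P.c₂ '' Icc 0 1)
    · refine (csInf_le hb ⟨P.x₀, Ioo_subset_Icc_self hx₀, rfl⟩).trans ?_
      rw [weightPsi, intervalIntegral.integral_same, zero_sub]
      exact mul_nonpos_of_nonneg_of_nonpos P.c₁_pos.le (neg_nonpos.mpr hc₂.le)
    -- The infimum of an unbounded set is `0` by convention.
    · rw [Real.sInf_of_not_bddBelow hb]
  rw [P.σ_eq]
  refine Real.one_le_exp ?_
  have := mul_nonneg P.s_pos.le
    (neg_nonneg.mpr (mul_nonpos_of_nonneg_of_nonpos (P.profile_nonneg t) hm))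
  linarith

/-- The multiplier that restricts to the observation region. -/
def obsMult (z : ℝ × ℝ) : ℝ := P.Od.indicator 1 z.1

/-- The multiplier `σ⁻² χ_{ω_i} / μ_i`. -/
def feedbackMult (i : Fin 2) (z : ℝ × ℝ) : ℝ :=
  1 / P.μ i * (P.σ z.2 ^ 2)⁻¹ * (P.ωf i).indicator 1 z.1

theorem memLp_obsMult : MemLp P.obsMult ⊤ ((volume.restrict (Ioo (0 : ℝ) 1)).prod
    (volume.restrict (Ioo (0 : ℝ) P.T))) := by
  have hm : Measurable P.obsMult := (measurable_one.indicator P.Od_meas).comp measurable_fst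
  refine memLp_top_of_bound hm.aestronglyMeasurable 1 (Eventually.of_forall fun z => ?_)
  by_cases hz : z.1 ∈ P.Od <;> simp [obsMult, hz]

theorem feedbackMult_nonneg (i : Fin 2) (z : ℝ × ℝ) : 0 ≤ P.feedbackMult i z := by
  have := P.μ_pos i
  exact mul_nonneg (by positivity) (indicator_nonneg (fun _ _ => zero_le_one) _)

theorem memLp_feedbackMult (i : Fin 2) : MemLp (P.feedbackMult i) ⊤
    ((volume.restrict (Ioo (0 : ℝ) 1)).prod (volume.restrict (Ioo (0 : ℝ) P.T))) := by
  have hm : Measurable (P.feedbackMult i) :=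
    (measurable_const.mul ((P.measurable_σ.comp measurable_snd).pow_const 2).inv).mul
      ((measurable_one.indicator (P.ωf_open i).measurableSet).comp measurable_fst)
  refine memLp_top_of_bound hm.aestronglyMeasurable (1 / P.μ i) (Eventually.of_forall fun z => ?_)
  have hμ := P.μ_pos i
  have h1 : (P.σ z.2 ^ 2)⁻¹ ≤ 1 := inv_le_one_of_one_le₀ (one_le_pow₀ (P.one_le_σ _))
  have h2 : (P.ωf i).indicator (1 : ℝ → ℝ) z.1 ≤ 1 :=
    indicator_le_self' (fun _ _ => zero_le_one) _
  rw [Real.norm_of_nonneg (P.feedbackMult_nonneg i z), feedbackMult, mul_assoc]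
  refine mul_le_of_le_one_right (by positivity) (mul_le_one₀ h1 ?_ h2)
  exact indicator_nonneg (fun _ _ => zero_le_one) _

theorem obs_ae (U : XT L2I P.T) : ∀ᵐ t ∂volume.restrict (Ioo (0 : ℝ) P.T),
    ∀ᵐ x ∂volume.restrict (Ioo (0 : ℝ) 1),
      mulOp P.memLp_obsMult.toLp U t x = P.Od.indicator (U t) x := by
  filter_upwards [mulOp_toLp_ae P.memLp_obsMult U] with t ht
  filter_upwards [ht] with x hx
  rw [hx]
  by_cases h : x ∈ P.Od <;> simp [obsMult, h]

theorem feedback_ae (i : Fin 2) (U : XT L2I P.T) : ∀ᵐ t ∂volume.restrict (Ioo (0 : ℝ) P.T),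
    ∀ᵐ x ∂volume.restrict (Ioo (0 : ℝ) 1), mulOp (P.memLp_feedbackMult i).toLp U t x
      = 1 / P.μ i * (P.σ t ^ 2)⁻¹ * (P.ωf i).indicator (U t) x := by
  filter_upwards [mulOp_toLp_ae (P.memLp_feedbackMult i) U] with t ht
  filter_upwards [ht] with x hx
  rw [hx]
  by_cases h : x ∈ P.ωf i <;> simp [feedbackMult, h]

/-- The couplings of the optimality and adjoint systems. -/
def coupling : Coupling L2I P.T where
  N := P.potential
  χ := mulOp P.memLp_obsMult.toLp
  ρ i := mulOp (P.memLp_feedbackMult i).toLp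
  α := P.α
  α_nonneg i := (P.α_pos i).le
  χ_symm := mulOp_symm _
  χ_idem U := by
    refine ext_slices ?_
    filter_upwards [P.obs_ae U, P.obs_ae (mulOp P.memLp_obsMult.toLp U)] with t a b
    filter_upwards [a, b] with x a b
    rw [b]
    by_cases h : x ∈ P.Od
    · rw [indicator_of_mem h]
    · rw [indicator_of_notMem h, a, indicator_of_notMem h]
  ρ_symm i := mulOp_symm _
  ρ_nonneg i := mulOp_nonneg _ <| by
    filter_upwards [(P.memLp_feedbackMult i).coeFn_toLp] with z hz
    rw [hz]
    exact P.feedbackMult_nonneg i z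

theorem adjoint_backward_source {ψ : Fin 2 → ℝ → L2I} {Ψ : Fin 2 → XT L2I P.T}
    (h : ∀ i, ∀ᵐ t ∂volume.restrict (Ioo (0 : ℝ) P.T), Ψ i t = ψ i t) :
    ∀ᵐ t ∂volume.restrict (Ioo (0 : ℝ) P.T), ∀ᵐ x ∂volume.restrict (Ioo (0 : ℝ) 1),
      P.coupling.χ (∑ i, P.coupling.α i • Ψ i) t x
        = P.Od.indicator (fun x => ∑ i, P.α i * ψ i t x) x := by
  simp only [Fin.sum_univ_two]
  filter_upwards [P.obs_ae (P.α 0 • Ψ 0 + P.α 1 • Ψ 1), slices_add (P.α 0 • Ψ 0) (P.α 1 • Ψ 1),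
    slices_smul (P.α 0) (Ψ 0), slices_smul (P.α 1) (Ψ 1), h 0, h 1] with t a b c d e f
  filter_upwards [a, b, c, d] with x a b c d
  refine a.trans ?_
  by_cases hx : x ∈ P.Od
  · rw [indicator_of_mem hx, indicator_of_mem hx, b, c, d, e, f]
  · rw [indicator_of_notMem hx, indicator_of_notMem hx]

theorem adjoint_forward_source {φ : ℝ → L2I} {Φ : XT L2I P.T}
    (h : ∀ᵐ t ∂volume.restrict (Ioo (0 : ℝ) P.T), Φ t = φ t) (i : Fin 2) :
    ∀ᵐ t ∂volume.restrict (Ioo (0 : ℝ) P.T), ∀ᵐ x ∂volume.restrict (Ioo (0 : ℝ) 1),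
      (-P.coupling.ρ i Φ) t x
        = -(1 / P.μ i) * (P.σ t ^ 2)⁻¹ * (P.ωf i).indicator (fun x => φ t x) x := by
  filter_upwards [P.feedback_ae i Φ, slices_neg (P.coupling.ρ i Φ), h] with t a b e
  filter_upwards [a, b] with x a b
  rw [e] at a
  rw [b]
  refine (congrArg Neg.neg a).trans ?_
  ring

theorem isAdjointSol_iff {φT : L2I} {φ : ℝ → L2I} {ψ : Fin 2 → ℝ → L2I} :
    P.IsAdjointSol φT φ ψ ↔ ∃ Φ Ψ, P.coupling.IsAdjoint P.energy φT φ Φ ψ Ψ := by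
  constructor
  · rintro ⟨hb, hf⟩
    have hφ := XT.memLp_of_continuousOn hb.1
    have hψ := fun i => XT.memLp_of_continuousOn (hf i).1
    refine ⟨hφ.toLp, fun i => (hψ i).toLp, ?_, fun i => ?_⟩
    · obtain ⟨U, hU⟩ := (P.isBackwardSol_iff
        (P.adjoint_backward_source fun i => (hψ i).coeFn_toLp)).mp hb
      have e : U = hφ.toLp := Lp.ext (EventuallyEq.trans hU.ae hφ.coeFn_toLp.symm)
      exact e ▸ hU
    · obtain ⟨U, hU⟩ := (P.isForwardSol_iff
        (P.adjoint_forward_source hφ.coeFn_toLp i)).mp (hf i)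
      have e : U = (hψ i).toLp := Lp.ext (EventuallyEq.trans hU.ae (hψ i).coeFn_toLp.symm)
      exact e ▸ hU
  · rintro ⟨Φ, Ψ, hb, hf⟩
    exact ⟨(P.isBackwardSol_iff (P.adjoint_backward_source fun i => (hf i).ae)).mpr ⟨Φ, hb⟩,
      fun i => (P.isForwardSol_iff (P.adjoint_forward_source hb.ae i)).mpr ⟨Ψ i, hf i⟩⟩

theorem state_source {f : L2Q P.ω P.T} {f' : XT L2I P.T}
    (hf : ∀ᵐ t ∂volume.restrict (Ioo (0 : ℝ) P.T), ∀ᵐ x ∂volume.restrict (Ioo (0 : ℝ) 1),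
      f' t x = P.ω.indicator (fun x => f (x, t)) x)
    {q : Fin 2 → ℝ → L2I} {Q : Fin 2 → XT L2I P.T}
    (h : ∀ i, ∀ᵐ t ∂volume.restrict (Ioo (0 : ℝ) P.T), Q i t = q i t) :
    ∀ᵐ t ∂volume.restrict (Ioo (0 : ℝ) P.T), ∀ᵐ x ∂volume.restrict (Ioo (0 : ℝ) 1),
      (f' - ∑ i, P.coupling.ρ i (Q i)) t x = P.ω.indicator (fun x => f (x, t)) x
      - ∑ i, 1 / P.μ i * (P.σ t ^ 2)⁻¹ * (P.ωf i).indicator (fun x => q i t x) x := by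
  simp only [Fin.sum_univ_two]
  filter_upwards [hf, P.feedback_ae 0 (Q 0), P.feedback_ae 1 (Q 1),
    slices_sub f' (P.coupling.ρ 0 (Q 0) + P.coupling.ρ 1 (Q 1)),
    slices_add (P.coupling.ρ 0 (Q 0)) (P.coupling.ρ 1 (Q 1)), h 0, h 1] with t a b c d e k l
  filter_upwards [a, b, c, d, e] with x a b c d e
  rw [k] at b
  rw [l] at c
  rw [d, e, a]
  exact congrArg₂ _ rfl (congrArg₂ _ b c)

theorem costate_source {yd : Fin 2 → L2Q P.Od P.T} {yd' : Fin 2 → XT L2I P.T}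
    (hyd : ∀ i, ∀ᵐ t ∂volume.restrict (Ioo (0 : ℝ) P.T), ∀ᵐ x ∂volume.restrict (Ioo (0 : ℝ) 1),
      yd' i t x = P.Od.indicator (fun x => yd i (x, t)) x)
    {y : ℝ → L2I} {Y : XT L2I P.T}
    (h : ∀ᵐ t ∂volume.restrict (Ioo (0 : ℝ) P.T), Y t = y t) (i : Fin 2) :
    ∀ᵐ t ∂volume.restrict (Ioo (0 : ℝ) P.T), ∀ᵐ x ∂volume.restrict (Ioo (0 : ℝ) 1),
      (P.coupling.α i • (P.coupling.χ Y - yd' i)) t x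
        = P.α i * P.Od.indicator (fun x => y t x - yd i (x, t)) x := by
  filter_upwards [hyd i, P.obs_ae Y, slices_sub (P.coupling.χ Y) (yd' i),
    slices_smul (P.coupling.α i) (P.coupling.χ Y - yd' i), h] with t a b c d e
  filter_upwards [a, b, c, d] with x a b c d
  rw [e] at b
  rw [d, c, a]
  refine congrArg₂ _ rfl ((congrArg₂ _ b rfl).trans ?_)
  by_cases hx : x ∈ P.Od <;> simp [hx]

theorem isOptimalitySol_iff {y₀ : L2I} {yd : Fin 2 → L2Q P.Od P.T} {yd' : Fin 2 → XT L2I P.T}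
    (hyd : ∀ i, ∀ᵐ t ∂volume.restrict (Ioo (0 : ℝ) P.T), ∀ᵐ x ∂volume.restrict (Ioo (0 : ℝ) 1),
      yd' i t x = P.Od.indicator (fun x => yd i (x, t)) x)
    {f : L2Q P.ω P.T} {f' : XT L2I P.T}
    (hf : ∀ᵐ t ∂volume.restrict (Ioo (0 : ℝ) P.T), ∀ᵐ x ∂volume.restrict (Ioo (0 : ℝ) 1),
      f' t x = P.ω.indicator (fun x => f (x, t)) x)
    {y : ℝ → L2I} {q : Fin 2 → ℝ → L2I} :
    P.IsOptimalitySol y₀ yd f y q ↔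
      ∃ Y Q, P.coupling.IsOptimality P.energy y₀ yd' f' y Y q Q := by
  constructor
  · rintro ⟨hs, hc⟩
    have hy := XT.memLp_of_continuousOn hs.1
    have hq := fun i => XT.memLp_of_continuousOn (hc i).1
    refine ⟨hy.toLp, fun i => (hq i).toLp, ?_, fun i => ?_⟩
    · obtain ⟨U, hU⟩ := (P.isForwardSol_iff
        (P.state_source hf fun i => (hq i).coeFn_toLp)).mp hs
      have e : U = hy.toLp := Lp.ext (EventuallyEq.trans hU.ae hy.coeFn_toLp.symm)
      exact e ▸ hU
    · obtain ⟨U, hU⟩ := (P.isBackwardSol_iff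
        (P.costate_source hyd hy.coeFn_toLp i)).mp (hc i)
      have e : U = (hq i).toLp := Lp.ext (EventuallyEq.trans hU.ae (hq i).coeFn_toLp.symm)
      exact e ▸ hU
  · rintro ⟨Y, Q, hs, hc⟩
    exact ⟨(P.isForwardSol_iff (P.state_source hf fun i => (hc i).ae)).mpr ⟨Y, hs⟩,
      fun i => (P.isBackwardSol_iff (P.costate_source hyd hs.ae i)).mpr ⟨Q i, hc i⟩⟩

end ControlData

/-! ### The dual functional -/

section QuadraticFunctional

variable {H : Type*} [NormedAddCommGroup H] [InnerProductSpace ℝ H] (r : H)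

/-- The quadratic functional with minimizer `-r`. -/
def quadratic (g : H) : ℝ := 1 / 2 * ‖g‖ ^ 2 + inner ℝ r g

theorem quadratic_eq (g : H) : quadratic r g = 1 / 2 * ‖g + r‖ ^ 2 + quadratic r (-r) := by
  rw [quadratic, quadratic, norm_add_sq_real, norm_neg, inner_neg_right,
    real_inner_self_eq_norm_sq, real_inner_comm]
  ring

theorem quadratic_neg_le (g : H) : quadratic r (-r) ≤ quadratic r g := by
  rw [quadratic_eq r g]
  linarith [sq_nonneg ‖g + r‖]

theorem eq_neg_of_quadratic_le {g : H} (h : quadratic r g ≤ quadratic r (-r)) : g = -r := by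
  rw [quadratic_eq r g] at h
  have h1 : ‖g + r‖ ^ 2 = 0 := le_antisymm (by linarith) (sq_nonneg _)
  exact eq_neg_of_add_eq_zero_left (norm_eq_zero.mp (pow_eq_zero_iff two_ne_zero |>.mp h1))

theorem continuous_quadratic : Continuous (quadratic r) := by
  unfold quadratic
  fun_prop

theorem strictConvexOn_quadratic {s : Set H} (hs : Convex ℝ s) :
    StrictConvexOn ℝ s (quadratic r) := by
  refine ⟨hs, fun x _ y _ hxy a b ha hb hab => ?_⟩
  have h1 : 0 < a * b * ‖x - y‖ ^ 2 := by
    have := norm_pos_iff.mpr (sub_ne_zero.mpr hxy)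
    positivity
  have h2 : ‖a • x + b • y‖ ^ 2
      = a ^ 2 * ‖x‖ ^ 2 + 2 * (a * b * inner ℝ x y) + b ^ 2 * ‖y‖ ^ 2 := by
    rw [norm_add_sq_real, norm_smul, norm_smul, real_inner_smul_left, real_inner_smul_right,
      mul_pow, mul_pow, Real.norm_eq_abs, Real.norm_eq_abs, sq_abs, sq_abs]
    ring
  rw [norm_sub_sq_real] at h1
  simp only [quadratic, smul_eq_mul, h2, inner_add_right, real_inner_smul_right]
  obtain rfl : b = 1 - a := by linarith
  nlinarith

theorem tendsto_quadratic_cobounded : Tendsto (quadratic r) (Bornology.cobounded H) atTop := by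
  refine tendsto_atTop_mono (fun g => ?_) (tendsto_atTop_add_const_right _
    (-(1 / 2 * (‖r‖ + 1) ^ 2)) (tendsto_norm_cobounded_atTop (E := H)))
  have h1 := neg_le_of_abs_le (abs_real_inner_le_norm r g)
  rw [quadratic]
  nlinarith [sq_nonneg (‖g‖ - (‖r‖ + 1))]

end QuadraticFunctional

namespace ControlData

variable (P : ControlData)

theorem volume_prod_of_subset {D : Set ℝ} (hD : D ⊆ Ioo 0 1) (T : ℝ) :
    (volume : Measure (ℝ × ℝ)).restrict (D ×ˢ Ioo 0 T)
      = ((volume.restrict (Ioo (0 : ℝ) 1)).restrict D).prod (volume.restrict (Ioo 0 T)) := by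
  rw [volume_prod, Measure.restrict_restrict_of_subset hD]

theorem inner_extension_eq_integral {D : Set ℝ} (hm : MeasurableSet D) (hD : D ⊆ Ioo 0 1)
    {T : ℝ} (hT : 0 ≤ T) {g : L2Q D T} {F G : XT L2I T} {v : ℝ → L2I}
    (hF : ∀ᵐ t ∂volume.restrict (Ioo (0 : ℝ) T), ∀ᵐ x ∂volume.restrict (Ioo (0 : ℝ) 1),
      F t x = D.indicator (fun x => g (x, t)) x)
    (hG : ∀ᵐ t ∂volume.restrict (Ioo (0 : ℝ) T), G t = v t) :
    inner ℝ F G = ∫ t in (0 : ℝ)..T, ∫ x in D, g (x, t) * v t x := by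
  rw [L2.inner_def, ← XT.integral_Ioo hT]
  refine integral_congr_ae ?_
  filter_upwards [hF, hG] with t a b
  rw [inner_L2I, b, ← Measure.restrict_restrict_of_subset hD, ← integral_indicator hm]
  refine integral_congr_ae ?_
  filter_upwards [a] with x a
  rw [a]
  by_cases hx : x ∈ D <;> simp [hx]

theorem inner_eq_integral_of_slices {D : Set ℝ} {T : ℝ} (hT : 0 ≤ T) {g k : L2Q D T}
    {v : ℝ → L2I}
    (hk : ∀ᵐ t ∂volume.restrict (Ioo (0 : ℝ) T), ∀ᵐ x ∂volume.restrict D, k (x, t) = v t x) :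
    inner ℝ g k = ∫ t in (0 : ℝ)..T, ∫ x in D, g (x, t) * v t x := by
  rw [inner_eq_integral_slices (volume_prod D T), ← XT.integral_Ioo hT]
  refine integral_congr_ae ?_
  filter_upwards [hk] with t a
  refine integral_congr_ae ?_
  filter_upwards [a] with x a
  rw [a]

theorem norm_sq_of_slices {D : Set ℝ} {T : ℝ} (hT : 0 ≤ T) {k : L2Q D T} {v : ℝ → L2I}
    (hk : ∀ᵐ t ∂volume.restrict (Ioo (0 : ℝ) T), ∀ᵐ x ∂volume.restrict D, k (x, t) = v t x) :
    ‖k‖ ^ 2 = ∫ t in (0 : ℝ)..T, ∫ x in D, (v t x) ^ 2 := by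
  rw [← real_inner_self_eq_norm_sq, inner_eq_integral_of_slices hT hk, ← XT.integral_Ioo hT,
    ← XT.integral_Ioo hT]
  refine integral_congr_ae ?_
  filter_upwards [hk] with t a
  refine integral_congr_ae ?_
  filter_upwards [a] with x a
  rw [a, sq]

theorem norm_sq_class {T : ℝ} (hT : 0 ≤ T) {U : XT L2I T} {u : ℝ → L2I}
    (hU : ∀ᵐ t ∂volume.restrict (Ioo (0 : ℝ) T), U t = u t) :
    ‖U‖ ^ 2 = ∫ t in (0 : ℝ)..T, ∫ x in Ioo (0 : ℝ) 1, (u t x) ^ 2 := by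
  rw [norm_sq_eq_integral, ← XT.integral_Ioo hT]
  refine integral_congr_ae ?_
  filter_upwards [hU] with t a
  rw [a, ← real_inner_self_eq_norm_sq, inner_L2I]
  simp only [sq]

theorem adjointWellPosed : P.AdjointWellPosed := by
  intro φT
  obtain ⟨φ, Φ, ψ, Ψ, h⟩ := P.coupling.exists_isAdjoint P.energy P.T_pos.le φT
  refine ⟨φ, ψ, P.isAdjointSol_iff.mpr ⟨Φ, Ψ, h⟩, fun φ' ψ' h' => ?_⟩
  obtain ⟨Φ', Ψ', h''⟩ := P.isAdjointSol_iff.mp h'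
  exact h.unique P.T_pos h''

/-- Every source on `D × (0,T)` extends by zero. -/
theorem exists_ext {D : Set ℝ} (hm : MeasurableSet D) (hD : D ⊆ Ioo 0 1) (g : L2Q D P.T) :
    ∃ F : XT L2I P.T, ∀ᵐ t ∂volume.restrict (Ioo (0 : ℝ) P.T),
      ∀ᵐ x ∂volume.restrict (Ioo (0 : ℝ) 1), F t x = D.indicator (fun x => g (x, t)) x :=
  exists_extension hm (volume_prod_of_subset hD P.T) g

theorem isRestriction_unique {φ : ℝ → L2I} {g k : L2Q P.ω P.T} (hg : P.IsRestriction φ g)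
    (hk : P.IsRestriction φ k) : g = k := by
  have : Fact ((2 : ENNReal) ≠ ⊤) := ⟨by norm_num⟩
  refine eq_of_slices (volume_prod P.ω P.T) ?_
  filter_upwards [hg, hk] with t a b
  filter_upwards [a, b] with x a b
  rw [a, b]

/-- The observation `φ_T ↦ φ χ_ω` is a linear map. -/
theorem exists_observation : ∃ K : L2I →ₗ[ℝ] L2Q P.ω P.T,
    ∀ φT φ ψ, P.IsAdjointSol φT φ ψ → P.IsRestriction φ (K φT) := by
  have hT := P.T_pos.le
  choose φ Φ ψ Ψ hA using P.coupling.exists_isAdjoint P.energy hT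
  choose R hR using fun G : XT L2I P.T =>
    exists_restriction (volume_prod_of_subset P.ω_sub P.T) G
  have hres : ∀ φT, P.IsRestriction (φ φT) (R (Φ φT)) := by
    intro φT
    filter_upwards [hR (Φ φT), (hA φT).backward.ae] with t a b
    rw [Measure.restrict_restrict_of_subset P.ω_sub] at a
    rw [← b]
    exact a
  choose F hF using P.exists_ext P.ω_open.measurableSet P.ω_sub
  choose y Y q Q hO using fun g : L2Q P.ω P.T =>
    P.coupling.exists_isOptimality P.energy hT 0 0 (F g)
  -- Transposition shows that `φ χ_ω` depends linearly on `φ_T`: its pairing with `g` is the pairing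
  -- of `φ_T` with the final state under the control `g` for zero data.
  have key : ∀ g φT, inner ℝ g (R (Φ φT)) = inner ℝ (y g P.T) φT := by
    intro g φT
    have h := Coupling.inner_final_eq hT (hO g) (hA φT)
    simp only [inner_zero_left, Pi.zero_apply, mul_zero, Finset.sum_const_zero, zero_add,
      sub_zero] at h
    rw [h, inner_eq_integral_of_slices hT (hres φT),
      inner_extension_eq_integral P.ω_open.measurableSet P.ω_sub hT (hF g) (hA φT).backward.ae]
  refine ⟨{ toFun := fun φT => R (Φ φT), map_add' := fun a b => ?_, map_smul' := fun c a => ?_ },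
    fun φT φ' ψ' h' => ?_⟩
  · refine ext_inner_left ℝ fun g => ?_
    rw [key, inner_add_right, inner_add_right, key, key]
  · refine ext_inner_left ℝ fun g => ?_
    rw [RingHom.id_apply, key, real_inner_smul_right, real_inner_smul_right, key]
  · obtain ⟨Φ', Ψ', h''⟩ := P.isAdjointSol_iff.mp h'
    have e := ((hA φT).unique P.T_pos h'').1
    filter_upwards [hres φT, ae_restrict_mem measurableSet_Ioo] with t a b
    rw [e (Ioo_subset_Icc_self b)]
    exact a

theorem obsSpace_eq {K : L2I →ₗ[ℝ] L2Q P.ω P.T}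
    (hK : ∀ φT φ ψ, P.IsAdjointSol φT φ ψ → P.IsRestriction φ (K φT)) :
    P.obsSpace = closure (range K) := by
  refine congrArg closure (Subset.antisymm ?_ ?_)
  · rintro g ⟨φT, φ, ψ, h, hg⟩
    exact ⟨φT, P.isRestriction_unique (hK _ _ _ h) hg⟩
  · rintro _ ⟨φT, rfl⟩
    obtain ⟨φ, ψ, h, -⟩ := P.adjointWellPosed φT
    exact ⟨φT, φ, ψ, h, hK _ _ _ h⟩

theorem observability_bound (hobs : P.Observability) {K : L2I →ₗ[ℝ] L2Q P.ω P.T}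
    (hK : ∀ φT φ ψ, P.IsAdjointSol φT φ ψ → P.IsRestriction φ (K φT)) :
    ∃ C : ℝ, 0 ≤ C ∧ ∀ {φT φ Φ ψ Ψ}, P.coupling.IsAdjoint P.energy φT φ Φ ψ Ψ →
      ‖φ 0‖ ≤ C * ‖K φT‖ ∧ ∀ i, ‖Ψ i‖ ≤ C * ‖K φT‖ := by
  have hT := P.T_pos.le
  obtain ⟨C, hC, h⟩ := hobs
  refine ⟨√C, Real.sqrt_nonneg C, fun {φT φ Φ ψ Ψ} hA => ?_⟩
  have hs := P.isAdjointSol_iff.mpr ⟨Φ, Ψ, hA⟩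
  have h1 := h _ _ _ hs
  have h0 : ∫ x in Ioo (0 : ℝ) 1, (φ 0 x) ^ 2 = ‖φ 0‖ ^ 2 := by
    rw [← real_inner_self_eq_norm_sq, inner_L2I]
    simp only [sq]
  rw [← norm_sq_of_slices hT (hK _ _ _ hs), h0] at h1
  simp_rw [fun i => (norm_sq_class hT (hA.forward i).ae).symm] at h1
  have h2 : ∀ a : ℝ, 0 ≤ a → a ^ 2 ≤ C * ‖K φT‖ ^ 2 → a ≤ √C * ‖K φT‖ := by
    intro a ha hle
    refine (sq_le_sq₀ ha (by positivity)).mp ?_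
    rwa [mul_pow, Real.sq_sqrt hC.le]
  refine ⟨h2 _ (norm_nonneg _) ?_, fun i => h2 _ (norm_nonneg _) ?_⟩
  · have : 0 ≤ ∑ i, ‖Ψ i‖ ^ 2 := Finset.sum_nonneg fun i _ => sq_nonneg _
    linarith
  · have h3 : ‖Ψ i‖ ^ 2 ≤ ∑ i, ‖Ψ i‖ ^ 2 :=
      Finset.single_le_sum (f := fun i => ‖Ψ i‖ ^ 2) (fun i _ => sq_nonneg _) (Finset.mem_univ i)
    linarith [sq_nonneg ‖φ 0‖]

/-- The linear part of the dual functional is represented by some `r` through the observation, and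
the final state under the control `f` is orthogonal to `φ_T` as soon as `f + r` is orthogonal to
`φ χ_ω`. -/
theorem exists_dual_representation (hobs : P.Observability) {K : L2I →ₗ[ℝ] L2Q P.ω P.T}
    (hK : ∀ φT φ ψ, P.IsAdjointSol φT φ ψ → P.IsRestriction φ (K φT)) (y₀ : L2I)
    (yd : Fin 2 → L2Q P.Od P.T) : ∃ r ∈ closure (range K),
      (∀ φT φ ψ, P.IsAdjointSol φT φ ψ → quadratic r (K φT) = P.dualF y₀ yd φ ψ) ∧
      ∀ f y q, P.IsOptimalitySol y₀ yd f y q →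
        ∀ φT, inner ℝ (y P.T) φT = inner ℝ (f + r) (K φT) := by
  have hT := P.T_pos.le
  choose yd' hyd using fun i => P.exists_ext P.Od_meas P.Od_sub (yd i)
  -- `y` is the uncontrolled state.
  obtain ⟨y, Y, q, Q, hO⟩ := P.coupling.exists_isOptimality P.energy hT y₀ yd' 0
  have h0 : ∀ {φT φ Φ ψ Ψ}, P.coupling.IsAdjoint P.energy φT φ Φ ψ Ψ →
      inner ℝ (y P.T) φT = inner ℝ y₀ (φ 0) - ∑ i, P.α i * inner ℝ (yd' i) (Ψ i) := by
    intro φT φ Φ ψ Ψ hA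
    have := Coupling.inner_final_eq hT hO hA
    rwa [inner_zero_left, add_zero] at this
  obtain ⟨C, hC, hb⟩ := P.observability_bound hobs hK
  obtain ⟨r, hr, hr'⟩ := exists_inner_eq_of_le K (innerₛₗ ℝ (y P.T))
    (C := (‖y₀‖ + ∑ i, P.α i * ‖yd' i‖) * C) fun φT => by
      obtain ⟨φ, Φ, ψ, Ψ, hA⟩ := P.coupling.exists_isAdjoint P.energy hT φT
      obtain ⟨b1, b2⟩ := hb hA
      rw [innerₛₗ_apply_apply, h0 hA]
      refine (abs_sub _ _).trans ?_
      rw [mul_assoc, add_mul, Finset.sum_mul]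
      refine add_le_add ((abs_real_inner_le_norm _ _).trans
        (mul_le_mul_of_nonneg_left b1 (norm_nonneg _))) ((Finset.abs_sum_le_sum_abs _ _).trans
        (Finset.sum_le_sum fun i _ => ?_))
      rw [abs_mul, abs_of_pos (P.α_pos i), mul_assoc]
      exact mul_le_mul_of_nonneg_left ((abs_real_inner_le_norm _ _).trans
        (mul_le_mul_of_nonneg_left (b2 i) (norm_nonneg _))) (P.α_pos i).le
  refine ⟨r, hr, fun φT φ ψ hs => ?_, fun f z p hz φT => ?_⟩
  · obtain ⟨Φ, Ψ, hA⟩ := P.isAdjointSol_iff.mp hs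
    have e : ∀ i, ∫ t in (0 : ℝ)..P.T, ∫ x in P.Od, P.α i * ψ i t x * yd i (x, t)
        = P.α i * inner ℝ (yd' i) (Ψ i) := by
      intro i
      rw [inner_extension_eq_integral P.Od_meas P.Od_sub hT (hyd i) (hA.forward i).ae,
        ← intervalIntegral.integral_const_mul]
      simp_rw [← integral_const_mul]
      refine intervalIntegral.integral_congr fun t _ => integral_congr_ae
        (Eventually.of_forall fun x => ?_)
      simp only
      ring
    rw [quadratic, hr', innerₛₗ_apply_apply, h0 hA, norm_sq_of_slices hT (hK _ _ _ hs), dualF,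
      inner_L2I]
    simp_rw [e]
    ring
  · obtain ⟨φ, Φ, ψ, Ψ, hA⟩ := P.coupling.exists_isAdjoint P.energy hT φT
    obtain ⟨f', hf⟩ := P.exists_ext P.ω_open.measurableSet P.ω_sub f
    obtain ⟨Z, R, hO'⟩ := (P.isOptimalitySol_iff hyd hf).mp hz
    have h1 := Coupling.inner_final_eq hT hO' hA
    have h2 := h0 hA
    have h3 : inner ℝ r (K φT) = inner ℝ (y P.T) φT := hr' φT
    have hs := P.isAdjointSol_iff.mpr ⟨Φ, Ψ, hA⟩
    rw [inner_extension_eq_integral P.ω_open.measurableSet P.ω_sub hT hf hA.backward.ae,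
      ← inner_eq_integral_of_slices hT (hK _ _ _ hs)] at h1
    rw [inner_add_left, h3, h2, h1]
    change _ = _ + (_ - ∑ i, P.coupling.α i * _)
    ring

theorem exists_isOptimalitySol (y₀ : L2I) (yd : Fin 2 → L2Q P.Od P.T) (f : L2Q P.ω P.T) :
    ∃ y q, P.IsOptimalitySol y₀ yd f y q := by
  choose yd' hyd using fun i => P.exists_ext P.Od_meas P.Od_sub (yd i)
  obtain ⟨f', hf⟩ := P.exists_ext P.ω_open.measurableSet P.ω_sub f
  obtain ⟨y, Y, q, Q, h⟩ := P.coupling.exists_isOptimality P.energy P.T_pos.le y₀ yd' f'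
  exact ⟨y, q, (P.isOptimalitySol_iff hyd hf).mpr ⟨Y, Q, h⟩⟩

end ControlData

end HierControl

end

/-- If the observability inequality holds for the adjoint system, then the optimality system is null
controllable. Moreover the dual functional `F` on `L²(0,1)` factors through `φ_T ↦ φ χ_ω` and a
continuous, strictly convex, coercive functional `Φ` on the closure of the range of that map; the
minimizer `fbar` of `Φ` is a null control, and it is `φ χ_ω` whenever `F` has a minimizer `φ_T`. -/
theorem proposition4p1 (P : HierControl.ControlData) (hobs : P.Observability) :
    P.NullControllable ∧
    P.AdjointWellPosed ∧
    ∀ (y₀ : HierControl.L2I) (yd : Fin 2 → HierControl.L2Q P.Od P.T),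
      ∃ (Φ : HierControl.L2Q P.ω P.T → ℝ) (fbar : HierControl.L2Q P.ω P.T),
        ContinuousOn Φ P.obsSpace ∧
        StrictConvexOn ℝ P.obsSpace Φ ∧
        Tendsto Φ (Bornology.cobounded (HierControl.L2Q P.ω P.T) ⊓ 𝓟 P.obsSpace) atTop ∧
        (∀ φT φ ψ, P.IsAdjointSol φT φ ψ →
          ∃ g, P.IsRestriction φ g ∧ Φ g = P.dualF y₀ yd φ ψ) ∧
        fbar ∈ P.obsSpace ∧ IsMinOn Φ P.obsSpace fbar ∧
        P.SteersToZero y₀ yd fbar ∧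
        (∀ φT φ ψ, P.IsAdjointSol φT φ ψ →
          (∀ φT' φ' ψ', P.IsAdjointSol φT' φ' ψ' → P.dualF y₀ yd φ ψ ≤ P.dualF y₀ yd φ' ψ') →
          P.IsRestriction φ fbar) := by
  obtain ⟨K, hK⟩ := P.exists_observation
  have hS : P.obsSpace = (LinearMap.range K).topologicalClosure := by
    rw [P.obsSpace_eq hK, Submodule.topologicalClosure_coe, LinearMap.coe_range]
  have steer : ∀ y₀ yd, ∃ r : HierControl.L2Q P.ω P.T, r ∈ P.obsSpace ∧
      (∀ φT φ ψ, P.IsAdjointSol φT φ ψ →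
        HierControl.quadratic r (K φT) = P.dualF y₀ yd φ ψ) ∧ P.SteersToZero y₀ yd (-r) := by
    intro y₀ yd
    obtain ⟨r, hr, hF, hy⟩ := P.exists_dual_representation hobs hK y₀ yd
    refine ⟨r, P.obsSpace_eq hK ▸ hr, hF, P.exists_isOptimalitySol y₀ yd _, fun y q h => ?_⟩
    refine ext_inner_right ℝ fun φT => ?_
    rw [hy _ _ _ h, neg_add_cancel, inner_zero_left, inner_zero_left]
  refine ⟨fun y₀ yd => ?_, P.adjointWellPosed, fun y₀ yd => ?_⟩
  · obtain ⟨r, -, -, hr⟩ := steer y₀ yd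
    exact ⟨-r, hr⟩
  · obtain ⟨r, hr, hF, hst⟩ := steer y₀ yd
    have hneg : -r ∈ P.obsSpace := by
      rw [hS] at hr ⊢
      exact Submodule.neg_mem _ hr
    refine ⟨HierControl.quadratic r, -r, (HierControl.continuous_quadratic r).continuousOn,
      HierControl.strictConvexOn_quadratic r (hS ▸ Submodule.convex _),
      (HierControl.tendsto_quadratic_cobounded r).mono_left inf_le_left,
      fun φT φ ψ h => ⟨K φT, hK _ _ _ h, hF _ _ _ h⟩, hneg,
      fun g _ => HierControl.quadratic_neg_le r g, hst, fun φT φ ψ h hmin => ?_⟩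
    -- `K φT` minimizes the functional over the observations, hence over their closure.
    have hle : ∀ g ∈ P.obsSpace,
        HierControl.quadratic r (K φT) ≤ HierControl.quadratic r g := by
      intro g hg
      rw [P.obsSpace_eq hK] at hg
      refine closure_minimal (s := range K)
        (t := {g | HierControl.quadratic r (K φT) ≤ HierControl.quadratic r g}) ?_
        (isClosed_le continuous_const (HierControl.continuous_quadratic r)) hg
      rintro _ ⟨φT', rfl⟩
      obtain ⟨φ', ψ', h', -⟩ := P.adjointWellPosed φT'
      have := hmin _ _ _ h'
      rwa [← hF _ _ _ h, ← hF _ _ _ h'] at this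
    rw [← HierControl.eq_neg_of_quadratic_le r (hle _ hneg)]
    exact hK _ _ _ h
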